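/- Let $(M,g)$ be a compact Kähler manifold without boundary, of complex dimension $m\ge 2$. In local holomorphic coordinates write $\phi_{i\bar j}=\partial^2\phi/\partial z^i\partial\bar z^j$, $\Delta\phi=g^{i\bar j}\phi_{i\bar j}$ and $R_{i\bar jk\bar l}=-\partial_k\partial_{\bar l}g_{i\bar j}+g^{p\bar q}\,\partial_kg_{i\bar q}\,\partial_{\bar l}g_{p\bar j}$. Suppose that $(M,g)$ has nonnegative orthogonal bisectional curvature, that is, for every $p\in M$ and every unitary basis $e_1,\dots,e_m$ of the holomorphic tangent space at $p$ we have $R(e_i,\overline{e_i},e_j,\overline{e_j})\ge 0$ for all $i\ne j$. Then for all real numbers $L$, $A$, $\Lambda$ there is a constant $C$, depending only on $(M,g)$, $L$, $A$ and $\Lambda$, with the following property. Let $f:M\to\mathbb R$ satisfy $f>0$, $\sup_M f\le\Lambda$ and $\inf_M\Delta f^{1/(m-1)}\ge -A$, and let $\phi\in C^4(M)$ be a real-valued function with $\sup_M\phi-\inf_M\phi\le L$ that solves the complex Monge–Ampère equation $$\det(g_{i\bar j}+\phi_{i\bar j})=f\,\det(g_{i\bar j})$$ and for which $(g_{i\bar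 j}+\phi_{i\bar j})$ is positive definite everywhere. Then $|\Delta\phi|\le C$ on $M$. -/

import Mathlib

open scoped Manifold ContDiff ComplexConjugate ComplexOrder

noncomputable section

/-- The model space `ℂ^m`. -/
abbrev CSpace (m : ℕ) : Type := EuclideanSpace ℂ (Fin m)

/-- The Wirtinger derivative `∂F/∂z^i = (∂F/∂x^i - √-1 ∂F/∂y^i)/2` on `ℂ^m`. -/
def dz {m : ℕ} (i : Fin m) (F : CSpace m → ℂ) (z : CSpace m) : ℂ :=
  (fderiv ℝ F z (EuclideanSpace.single i 1) -
    Complex.I * fderiv ℝ F z (EuclideanSpace.single i Complex.I)) / 2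

/-- The Wirtinger derivative `∂F/∂z̄^i = (∂F/∂x^i + √-1 ∂F/∂y^i)/2` on `ℂ^m`. -/
def dzbar {m : ℕ} (i : Fin m) (F : CSpace m → ℂ) (z : CSpace m) : ℂ :=
  (fderiv ℝ F z (EuclideanSpace.single i 1) +
    Complex.I * fderiv ℝ F z (EuclideanSpace.single i Complex.I)) / 2

/-- The holomorphic coordinate vector `∂/∂z^i` of the chart `e`, at the point of `M` with
coordinates `z`. -/
def coordVec {m : ℕ} {M : Type*} [TopologicalSpace M] [ChartedSpace (CSpace m) M]
    (e : OpenPartialHomeomorph M (CSpace m)) (z : CSpace m) (i : Fin m) :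
    TangentSpace 𝓘(ℂ, CSpace m) (e.symm z) :=
  mfderiv 𝓘(ℂ, CSpace m) 𝓘(ℂ, CSpace m) e.symm z
    (EuclideanSpace.single i (1 : ℂ) : CSpace m)

/-- The components `g_{i j̄} = g(∂/∂z^i, ∂/∂z̄^j)` of a field of sesquilinear forms in the
chart `e`, as a function of the coordinates `z`. -/
def formMatrix {m : ℕ} {M : Type*} [TopologicalSpace M] [ChartedSpace (CSpace m) M]
    (h : ∀ x : M, TangentSpace 𝓘(ℂ, CSpace m) x →ₗ[ℂ]
      TangentSpace 𝓘(ℂ, CSpace m) x →ₗ⋆[ℂ] ℂ)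
    (e : OpenPartialHomeomorph M (CSpace m)) (z : CSpace m) : Matrix (Fin m) (Fin m) ℂ :=
  Matrix.of fun i j => h (e.symm z) (coordVec e z i) (coordVec e z j)

/-- A (smooth) Kähler metric on a complex manifold of dimension `m`: a smoothly varying positive
definite Hermitian form on the holomorphic tangent spaces, linear in the first and
conjugate-linear in the second argument, whose fundamental form is closed; in holomorphic
coordinates the last condition reads `∂_k g_{i j̄} = ∂_i g_{k j̄}`. -/
structure KahlerMetric (m : ℕ) (M : Type*) [TopologicalSpace M]
    [ChartedSpace (CSpace m) M] where
  form : ∀ x : M, TangentSpace 𝓘(ℂ, CSpace m) x →ₗ[ℂ]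
    TangentSpace 𝓘(ℂ, CSpace m) x →ₗ⋆[ℂ] ℂ
  conj_symm : ∀ (x : M) (u v : TangentSpace 𝓘(ℂ, CSpace m) x),
    conj (form x u v) = form x v u
  pos : ∀ (x : M) (v : TangentSpace 𝓘(ℂ, CSpace m) x), v ≠ 0 → 0 < (form x v v).re
  smooth : ∀ e ∈ atlas (CSpace m) M, ∀ i j : Fin m,
    ContDiffOn ℝ ∞ (fun z => formMatrix form e z i j) e.target
  closed : ∀ e ∈ atlas (CSpace m) M, ∀ z ∈ e.target, ∀ i j k : Fin m,
    dz k (fun w => formMatrix form e w i j) z = dz i (fun w => formMatrix form e w k j) z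

/-- The complex Hessian `u_{i j̄} = ∂²u/∂z^i∂z̄^j` of a real function `u` in the chart `e`. -/
def complexHessian {m : ℕ} {M : Type*} [TopologicalSpace M]
    (e : OpenPartialHomeomorph M (CSpace m)) (u : M → ℝ) (z : CSpace m) :
    Matrix (Fin m) (Fin m) ℂ :=
  Matrix.of fun i j => dz i (dzbar j fun w => ((u (e.symm w) : ℝ) : ℂ)) z

namespace KahlerMetric

variable {m : ℕ} {M : Type*} [TopologicalSpace M] [ChartedSpace (CSpace m) M]

/-- The matrix `(g_{i j̄})` of the metric in the chart `e`. -/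
def matrix (g : KahlerMetric m M) (e : OpenPartialHomeomorph M (CSpace m)) (z : CSpace m) :
    Matrix (Fin m) (Fin m) ℂ :=
  formMatrix g.form e z

/-- The curvature tensor in the chart `e`:
`R_{i j̄ k l̄} = - ∂_k ∂_l̄ g_{i j̄} + g^{p q̄} ∂_k g_{i q̄} ∂_l̄ g_{p j̄}`,
where `g^{p q̄}` is the `(q, p)` entry of the inverse matrix of `(g_{i j̄})`. -/
def curvature (g : KahlerMetric m M) (e : OpenPartialHomeomorph M (CSpace m)) (z : CSpace m)
    (i j k l : Fin m) : ℂ :=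
  -dz k (dzbar l fun w => g.matrix e w i j) z +
    ∑ p, ∑ q, (g.matrix e z)⁻¹ q p *
      dz k (fun w => g.matrix e w i q) z * dzbar l (fun w => g.matrix e w p j) z

/-- Nonnegative orthogonal bisectional curvature: `R(v_a, v̄_a, v_b, v̄_b) ≥ 0` for `a ≠ b` and
every unitary basis `v_1, …, v_m` of a holomorphic tangent space. The vectors are given by their
components in a chart. -/
def NonnegOrthogonalBisectional (g : KahlerMetric m M) : Prop :=
  ∀ e ∈ atlas (CSpace m) M, ∀ z ∈ e.target, ∀ v : Fin m → Fin m → ℂ,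
    (∀ a b, ∑ i, ∑ j, g.matrix e z i j * v a i * conj (v b j) = if a = b then 1 else 0) →
    ∀ a b, a ≠ b →
      0 ≤ (∑ i, ∑ j, ∑ k, ∑ l,
        g.curvature e z i j k l * v a i * conj (v a j) * v b k * conj (v b l)).re

/-- The Laplacian `Δu = g^{i j̄} u_{i j̄}`, computed at `x` in the preferred chart at `x`
(for `u` of class `C²` every holomorphic chart gives the same value, and the trace is real). -/
def laplacian (g : KahlerMetric m M) (u : M → ℝ) (x : M) : ℝ :=
  let e := chartAt (CSpace m) x
  ((g.matrix e (e x))⁻¹ * complexHessian e u (e x)).trace.re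

/-- The complex Monge-Ampère equation `det(g_{i j̄} + φ_{i j̄}) = f det(g_{i j̄})`, in local
holomorphic coordinates. -/
def SolvesMongeAmpere (g : KahlerMetric m M) (f φ : M → ℝ) : Prop :=
  ∀ e ∈ atlas (CSpace m) M, ∀ z ∈ e.target,
    (g.matrix e z + complexHessian e φ z).det = (f (e.symm z) : ℂ) * (g.matrix e z).det

/-- The Hermitian form `(g_{i j̄} + φ_{i j̄})` is positive definite everywhere. -/
def PosDefPotential (g : KahlerMetric m M) (φ : M → ℝ) : Prop :=
  ∀ e ∈ atlas (CSpace m) M, ∀ z ∈ e.target,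
    (g.matrix e z + complexHessian e φ z).PosDef

end KahlerMetric

end

/-!
Put `H = f ^ (1 / (m - 1))`, `W = g + ∂∂̄φ` and `u = m + Δφ = tr_g W`. If `φ` has oscillation at
most `L` and `u ≤ K` for some `K ≥ 1`, then `0 < W ≤ K g` bounds `∂∂̄φ` along complex lines, and
interpolation between `φ` and `∂∂̄φ` on discs of radius `K ^ (-1 / 2)` gives `|∂φ|² ≤ C K`. Let
`μ i` be the eigenvalues of `W` with respect to `g` at a maximum point of `u - δ φ`. There the
Bochner formula for `tr_g W`, combined with the equation `det W = H ^ (m - 1) det g`, the sign of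
the orthogonal bisectional curvature and `∂u = δ ∂φ`, leads to
`(m - 1) ΔH / H - m / ((m - 1) E) δ² m C K ≤ δ (m - σ)`, where `E = (∑ μ)² - ∑ μ²` and
`σ = ∑ μ⁻¹`. Since `∑ μ ≤ E σ`, a suitable `δ` absorbs the gradient term into `δ σ`, so that
`H σ` is bounded, and `∏ μ = H ^ (m - 1)` turns this into the bound `μ i ≤ (H σ) ^ (m - 1)`.
-/

noncomputable section

open Filter Topology Matrix

open scoped Matrix.Norms.Operator

section Wirtinger

variable {E F : Type*} [NormedAddCommGroup E] [NormedSpace ℂ E]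
  [NormedAddCommGroup F] [NormedSpace ℂ F]

/-- The operator `F ↦ (∂_v F + c ∂_{√-1 v} F) / 2`. For `c = -√-1` and `c = √-1` it is the
Wirtinger derivative along `v` and along its conjugate; keeping `c` as a parameter lets the calculus
rules be stated once for both. -/
def wirtinger (c : ℂ) (v : E) (f : E → F) (z : E) : F :=
  (2⁻¹ : ℂ) • (fderiv ℝ f z v + c • fderiv ℝ f z (Complex.I • v))

variable {c c' : ℂ} {v w z : E} {f g : E → F}

theorem wirtinger_congr (h : f =ᶠ[𝓝 z] g) : wirtinger c v f z = wirtinger c v g z := by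
  simp only [wirtinger, h.fderiv_eq]

theorem wirtinger_const (a : F) : wirtinger c v (fun _ => a) z = 0 := by
  simp [wirtinger]

theorem wirtinger_add (hf : DifferentiableAt ℝ f z) (hg : DifferentiableAt ℝ g z) :
    wirtinger c v (fun y => f y + g y) z = wirtinger c v f z + wirtinger c v g z := by
  simp only [wirtinger, fderiv_fun_add hf hg, _root_.add_apply]
  module

theorem wirtinger_sub (hf : DifferentiableAt ℝ f z) (hg : DifferentiableAt ℝ g z) :
    wirtinger c v (fun y => f y - g y) z = wirtinger c v f z - wirtinger c v g z := by
  simp only [wirtinger, fderiv_fun_sub hf hg, _root_.sub_apply]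
  module

theorem wirtinger_sum {ι : Type*} (s : Finset ι) {f : ι → E → F}
    (hf : ∀ i ∈ s, DifferentiableAt ℝ (f i) z) :
    wirtinger c v (fun y => ∑ i ∈ s, f i y) z = ∑ i ∈ s, wirtinger c v (f i) z := by
  simp only [wirtinger, fderiv_fun_sum hf, _root_.sum_apply, Finset.smul_sum,
    ← Finset.sum_add_distrib]

theorem wirtinger_clm_comp {F' : Type*} [NormedAddCommGroup F'] [NormedSpace ℂ F']
    (L : F →L[ℂ] F')
    (hf : DifferentiableAt ℝ f z) :
    wirtinger c v (fun y => L (f y)) z = L (wirtinger c v f z) := by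
  have h := ((L.restrictScalars ℝ).hasFDerivAt.comp z hf.hasFDerivAt).fderiv
  simp only [Function.comp_def, ContinuousLinearMap.coe_restrictScalars'] at h
  simp [wirtinger, h]

theorem wirtinger_const_smul (a : ℂ) (hf : DifferentiableAt ℝ f z) :
    wirtinger c v (fun y => a • f y) z = a • wirtinger c v f z :=
  wirtinger_clm_comp (a • ContinuousLinearMap.id ℂ F) hf

theorem star_wirtinger [StarAddMonoid F] [ContinuousStar F] [StarModule ℂ F]
    (hf : DifferentiableAt ℝ f z) :
    star (wirtinger c v f z) = wirtinger (conj c) v (fun y => star (f y)) z := by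
  simp [wirtinger, hf.hasFDerivAt.star.fderiv, star_smul]

theorem wirtinger_smul_vec (hc : c ^ 2 = -1) (a : ℂ) :
    wirtinger c (a • v) f z = (a.re - c * a.im) • wirtinger c v f z := by
  have hav : a • v = a.re • v + a.im • (Complex.I • v) := by
    rw [← Complex.coe_smul a.re, ← Complex.coe_smul a.im, smul_smul, ← add_smul, Complex.re_add_im]
  have hIav : Complex.I • a • v = a.re • (Complex.I • v) - a.im • v := by
    rw [hav, ← Complex.coe_smul a.re, ← Complex.coe_smul a.im, ← Complex.coe_smul a.re,
      ← Complex.coe_smul a.im]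
    match_scalars
    linear_combination (a.im : ℂ) * Complex.I_sq
  rw [wirtinger, hIav, hav]
  simp only [wirtinger, map_add, map_sub, map_smul, ← Complex.coe_smul (E := F)]
  match_scalars
  · ring
  · linear_combination (a.im / 2 : ℂ) * hc

theorem wirtinger_vec_sum {ι : Type*} (s : Finset ι) (v : ι → E) :
    wirtinger c (∑ i ∈ s, v i) f z = ∑ i ∈ s, wirtinger c (v i) f z := by
  simp only [wirtinger, Finset.smul_sum, map_sum, ← Finset.sum_add_distrib]

theorem contDiffAt_wirtinger {k n : WithTop ℕ∞} (hf : ContDiffAt ℝ n f z) (hk : k + 1 ≤ n) :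
    ContDiffAt ℝ k (wirtinger c v f) z := by
  have h := hf.fderiv_right hk
  unfold wirtinger
  fun_prop

theorem wirtinger_wirtinger (hf : ContDiffAt ℝ 2 f z) :
    wirtinger c v (wirtinger c' w f) z =
      (4⁻¹ : ℂ) • (fderiv ℝ (fderiv ℝ f) z v w + c' • fderiv ℝ (fderiv ℝ f) z v (Complex.I • w)
        + c • fderiv ℝ (fderiv ℝ f) z (Complex.I • v) w
        + (c * c') • fderiv ℝ (fderiv ℝ f) z (Complex.I • v) (Complex.I • w)) := by
  have hf' : DifferentiableAt ℝ (fderiv ℝ f) z :=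
    (hf.fderiv_right (m := 1) (by norm_num)).differentiableAt (by norm_num)
  have h : HasFDerivAt (wirtinger c' w f) ((2⁻¹ : ℂ) • ((fderiv ℝ (fderiv ℝ f) z).flip w
      + c' • (fderiv ℝ (fderiv ℝ f) z).flip (Complex.I • w))) z := by
    have e (x : E) : HasFDerivAt (fun y => fderiv ℝ f y x) ((fderiv ℝ (fderiv ℝ f) z).flip x) z :=
      by simpa using hf'.hasFDerivAt.clm_apply (hasFDerivAt_const x z)
    exact ((e w).add ((e _).const_smul c')).const_smul _
  rw [wirtinger, h.fderiv]
  simp only [_root_.smul_apply, _root_.add_apply, ContinuousLinearMap.flip_apply]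
  module

theorem wirtinger_comm (hf : ContDiffAt ℝ 2 f z) :
    wirtinger c v (wirtinger c' w f) z = wirtinger c' w (wirtinger c v f) z := by
  have hs : IsSymmSndFDerivAt ℝ f z := hf.isSymmSndFDerivAt (by simp)
  rw [wirtinger_wirtinger hf, wirtinger_wirtinger hf, hs.eq w v, hs.eq w (Complex.I • v),
    hs.eq (Complex.I • w) v, hs.eq (Complex.I • w) (Complex.I • v)]
  module

section Algebra

variable {R : Type*} [NormedRing R] [NormedAlgebra ℂ R] {f g : E → R}

theorem wirtinger_mul (hf : DifferentiableAt ℝ f z) (hg : DifferentiableAt ℝ g z) :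
    wirtinger c v (fun y => f y * g y) z = wirtinger c v f z * g z + f z * wirtinger c v g z := by
  simp only [wirtinger, fderiv_fun_mul' hf hg, _root_.add_apply, _root_.smul_apply,
    MulOpposite.smul_eq_mul_unop, MulOpposite.unop_op, smul_eq_mul, smul_add, mul_add, add_mul,
    smul_mul_assoc, mul_smul_comm]
  abel

theorem wirtinger_const_mul (a : R) (hg : DifferentiableAt ℝ g z) :
    wirtinger c v (fun y => a * g y) z = a * wirtinger c v g z := by
  rw [wirtinger_mul (differentiableAt_const a) hg, wirtinger_const, zero_mul, zero_add]

theorem wirtinger_const_mul_mul_const (a b : R) (hg : DifferentiableAt ℝ g z) :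
    wirtinger c v (fun y => a * g y * b) z = a * wirtinger c v g z * b := by
  rw [wirtinger_mul (hg.const_mul a) (differentiableAt_const b), wirtinger_const_mul a hg,
    wirtinger_const, mul_zero, add_zero]

theorem wirtinger_ringInverse [HasSummableGeomSeries R] (hf : DifferentiableAt ℝ f z)
    (hz : IsUnit (f z)) :
    wirtinger c v (fun y => Ring.inverse (f y)) z =
      -(Ring.inverse (f z) * wirtinger c v f z * Ring.inverse (f z)) := by
  obtain ⟨a, ha⟩ := hz
  have h : HasFDerivAt (Ring.inverse : R → R) _ (f z) := ha ▸ hasFDerivAt_ringInverse (𝕜 := ℝ) a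
  have hfz := (h.comp z hf.hasFDerivAt).fderiv
  rw [Function.comp_def] at hfz
  simp only [wirtinger, hfz, ← ha, Ring.inverse_unit, ContinuousLinearMap.comp_apply,
    _root_.neg_apply, ContinuousLinearMap.mulLeftRight_apply, mul_smul_comm, smul_mul_assoc,
    mul_add, add_mul]
  module

end Algebra

theorem wirtinger_prod {ι : Type*} [DecidableEq ι] (s : Finset ι) {f : ι → E → ℂ}
    (hf : ∀ i ∈ s, DifferentiableAt ℝ (f i) z) :
    wirtinger c v (fun y => ∏ i ∈ s, f i y) z =
      ∑ i ∈ s, (∏ j ∈ s.erase i, f j z) * wirtinger c v (f i) z := by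
  simp only [wirtinger, fderiv_finsetProd hf, _root_.sum_apply, _root_.smul_apply, smul_eq_mul,
    Finset.mul_sum, ← Finset.sum_add_distrib]
  exact Finset.sum_congr rfl fun i _ => by ring

theorem wirtinger_pow {f : E → ℂ} (n : ℕ) (hf : DifferentiableAt ℝ f z) :
    wirtinger c v (fun y => f y ^ n) z = n * f z ^ (n - 1) * wirtinger c v f z := by
  simp only [wirtinger, fderiv_fun_pow n hf, _root_.smul_apply, smul_eq_mul, nsmul_eq_mul]
  ring

theorem wirtinger_inv {f : E → ℂ} (hf : DifferentiableAt ℝ f z) (h0 : f z ≠ 0) :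
    wirtinger c v (fun y => (f y)⁻¹) z = -wirtinger c v f z / f z ^ 2 := by
  have h := wirtinger_ringInverse (c := c) (v := v) hf h0.isUnit
  simp only [Ring.inverse_eq_inv'] at h
  rw [h]
  ring

end Wirtinger

local notation "∂ₕ" => wirtinger (-Complex.I)
local notation "∂ₐ" => wirtinger Complex.I

section MatrixCalculus

variable {E n : Type*} [NormedAddCommGroup E] [NormedSpace ℂ E] [Fintype n]
  {c : ℂ} {v z : E} {k : WithTop ℕ∞} {G : E → Matrix n n ℂ}

theorem contDiffAt_matrix_apply (hG : ContDiffAt ℝ k G z) (i j : n) :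
    ContDiffAt ℝ k (fun y => G y i j) z :=
  ((Matrix.entryLinearMap ℂ ℂ i j).toContinuousLinearMap.restrictScalars ℝ)
    |>.contDiff.contDiffAt.comp z hG

theorem differentiableAt_matrix_apply (hG : DifferentiableAt ℝ G z) (i j : n) :
    DifferentiableAt ℝ (fun y => G y i j) z :=
  ((Matrix.entryLinearMap ℂ ℂ i j).toContinuousLinearMap.restrictScalars ℝ).differentiableAt.comp
    z hG

theorem contDiffAt_matrix_iff :
    ContDiffAt ℝ k G z ↔ ∀ i j, ContDiffAt ℝ k (fun y => G y i j) z := by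
  classical
  refine ⟨contDiffAt_matrix_apply, fun hG => ?_⟩
  have hsum : G = fun y => ∑ i, ∑ j, G y i j • Matrix.single i j (1 : ℂ) := by
    funext y
    conv_lhs => rw [Matrix.matrix_eq_sum_single (G y)]
    simp only [Matrix.smul_single, smul_eq_mul, mul_one]
  rw [hsum]
  fun_prop

theorem wirtinger_matrix_apply (hG : DifferentiableAt ℝ G z) (i j : n) :
    wirtinger c v G z i j = wirtinger c v (fun y => G y i j) z :=
  (wirtinger_clm_comp (Matrix.entryLinearMap ℂ ℂ i j).toContinuousLinearMap hG).symm

theorem wirtinger_trace (hG : DifferentiableAt ℝ G z) :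
    wirtinger c v (fun y => (G y).trace) z = (wirtinger c v G z).trace :=
  wirtinger_clm_comp (Matrix.traceLinearMap n ℂ ℂ).toContinuousLinearMap hG

theorem contDiffAt_trace (hG : ContDiffAt ℝ k G z) : ContDiffAt ℝ k (fun y => (G y).trace) z :=
  ((Matrix.traceLinearMap n ℂ ℂ).toContinuousLinearMap.restrictScalars ℝ)
    |>.contDiff.contDiffAt.comp z hG

theorem conjTranspose_wirtinger_of_isHermitian (hG : DifferentiableAt ℝ G z)
    (hGH : ∀ᶠ y in 𝓝 z, (G y).IsHermitian) :
    (wirtinger c v G z)ᴴ = wirtinger (conj c) v G z := by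
  ext i j
  rw [Matrix.conjTranspose_apply, wirtinger_matrix_apply hG, wirtinger_matrix_apply hG,
    star_wirtinger (differentiableAt_matrix_apply hG j i)]
  exact wirtinger_congr (hGH.mono fun y hy => hy.apply i j)

variable [DecidableEq n]

theorem contDiffAt_det (hG : ContDiffAt ℝ k G z) : ContDiffAt ℝ k (fun y => (G y).det) z := by
  simp only [Matrix.det_apply']
  exact ContDiffAt.sum fun σ _ =>
    contDiffAt_const.mul (contDiffAt_prod fun i _ => contDiffAt_matrix_apply hG _ _)

theorem contDiffAt_matrix_inv (hG : ContDiffAt ℝ k G z) (hz : IsUnit (G z)) :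
    ContDiffAt ℝ k (fun y => (G y)⁻¹) z := by
  obtain ⟨a, ha⟩ := hz
  simp only [Matrix.nonsing_inv_eq_ringInverse]
  exact ContDiffAt.comp z (ha ▸ contDiffAt_ringInverse ℝ a) hG

theorem wirtinger_matrix_inv (hG : DifferentiableAt ℝ G z) (hz : IsUnit (G z)) :
    wirtinger c v (fun y => (G y)⁻¹) z = -((G z)⁻¹ * wirtinger c v G z * (G z)⁻¹) := by
  simp only [Matrix.nonsing_inv_eq_ringInverse]
  exact wirtinger_ringInverse hG hz

theorem wirtinger_det_eq_sum_updateCol (hG : DifferentiableAt ℝ G z) :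
    wirtinger c v (fun y => (G y).det) z =
      ∑ i, ((G z).updateCol i fun l => wirtinger c v G z l i).det := by
  have hGij := fun i j => differentiableAt_matrix_apply hG i j
  have hprod (σ : Equiv.Perm n) : DifferentiableAt ℝ (fun y => ∏ i, G y (σ i) i) z := by
    fun_prop
  simp only [Matrix.det_apply', wirtinger_matrix_apply hG]
  rw [wirtinger_sum _ fun σ _ => (hprod σ).const_mul _, Finset.sum_comm]
  refine Finset.sum_congr rfl fun σ _ => ?_
  rw [wirtinger_const_mul _ (hprod σ), wirtinger_prod _ fun i _ => hGij _ _, Finset.mul_sum]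
  refine Finset.sum_congr rfl fun i _ => ?_
  rw [← Finset.mul_prod_erase _ _ (Finset.mem_univ i), Matrix.updateCol_self,
    mul_comm (∏ j ∈ Finset.univ.erase i, G z (σ j) j)]
  congr 2
  exact Finset.prod_congr rfl fun j hj => by rw [Matrix.updateCol_ne (Finset.ne_of_mem_erase hj)]

theorem wirtinger_det (hG : DifferentiableAt ℝ G z) (hz : IsUnit (G z)) :
    wirtinger c v (fun y => (G y).det) z = (G z).det * ((G z)⁻¹ * wirtinger c v G z).trace := by
  have hdet : (G z).det ≠ 0 := ((Matrix.isUnit_iff_isUnit_det _).1 hz).ne_zero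
  rw [wirtinger_det_eq_sum_updateCol hG, Matrix.inv_def, Ring.inverse_eq_inv', Matrix.smul_mul,
    Matrix.trace_smul, smul_eq_mul, mul_inv_cancel_left₀ hdet]
  refine Finset.sum_congr rfl fun i _ => ?_
  rw [← Matrix.cramer_apply, Matrix.cramer_eq_adjugate_mulVec]
  rfl

end MatrixCalculus

section Chern

variable {E n : Type*} [NormedAddCommGroup E] [NormedSpace ℂ E] [Fintype n] [DecidableEq n]
  {c : ℂ} {v z : E} {G W : E → Matrix n n ℂ}

/-- The covariant derivative `∂W - ∂G G⁻¹ W` along `v` of a field of forms `W` with respect to the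
Chern connection of the Hermitian metric `G`; `∂` is `wirtinger c v`, so that `c = √-1` gives the
conjugate operator `∂̄W - ∂̄G G⁻¹ W`. -/
def chernDeriv (c : ℂ) (v : E) (G W : E → Matrix n n ℂ) (z : E) : Matrix n n ℂ :=
  wirtinger c v W z - wirtinger c v G z * (G z)⁻¹ * W z

/-- The curvature form `∂G G⁻¹ ∂̄G - ∂∂̄G` of the Hermitian metric `G` in the direction `v`, whose
`(i, j)` entry is `R_{i j̄ v v̄}`. -/
def chernCurvature (v : E) (G : E → Matrix n n ℂ) (z : E) : Matrix n n ℂ :=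
  -chernDeriv (-Complex.I) v G (∂ₐ v G) z

theorem wirtinger_trace_inv_mul (hG : DifferentiableAt ℝ G z) (hW : DifferentiableAt ℝ W z)
    (hGz : IsUnit (G z)) :
    wirtinger c v (fun y => ((G y)⁻¹ * W y).trace) z =
      ((G z)⁻¹ * chernDeriv c v G W z).trace := by
  have hinv : DifferentiableAt ℝ (fun y => (G y)⁻¹) z := by
    obtain ⟨a, ha⟩ := hGz
    simp only [Matrix.nonsing_inv_eq_ringInverse]
    exact DifferentiableAt.comp z (ha ▸ (hasFDerivAt_ringInverse (𝕜 := ℝ) a).differentiableAt) hG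
  rw [wirtinger_trace (hinv.fun_mul hW), wirtinger_mul hinv hW, wirtinger_matrix_inv hG hGz,
    chernDeriv]
  congr 1
  noncomm_ring

theorem contDiffAt_chernDeriv (hG : ContDiffAt ℝ 2 G z) (hW : ContDiffAt ℝ 2 W z)
    (hGz : IsUnit (G z)) : ContDiffAt ℝ 1 (chernDeriv c v G W) z :=
  (contDiffAt_wirtinger hW (by norm_num)).sub
    (((contDiffAt_wirtinger hG (by norm_num)).mul
      ((contDiffAt_matrix_inv hG hGz).of_le (by norm_num))).mul (hW.of_le (by norm_num)))

theorem trace_bochner_identity {P Q W a b A B X Y : Matrix n n ℂ} (hWQ : W * Q = 1) :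
    (P * (Y - (X * P * W - b * P * a * P * W + b * P * A) - a * P * (B - b * P * W))).trace =
      (P * -(X - a * P * b) * P * W).trace - (P * -(Y - A * Q * B)).trace
        + (P * (A - a * P * W) * Q * (B - W * P * b)).trace := by
  have hQW : Q * W = 1 := mul_eq_one_comm.1 hWQ
  have hexp : P * (A - a * P * W) * Q * (B - W * P * b) =
      P * A * Q * B - P * A * (Q * W) * P * b - P * a * P * (W * Q) * B
        + P * a * P * (W * Q) * W * P * b := by noncomm_ring
  have hcross : (P * b * (P * a * P * W - P * A)).trace =
      ((P * a * P * W - P * A) * (P * b)).trace := Matrix.trace_mul_comm _ _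
  rw [hexp, hQW, hWQ, ← Matrix.trace_sub, ← Matrix.trace_add, ← sub_eq_zero, ← Matrix.trace_sub]
  rw [← sub_eq_zero, ← Matrix.trace_sub] at hcross
  rw [← hcross]
  congr 1
  noncomm_ring

theorem wirtinger_wirtinger_trace_inv_mul (hG : ContDiffAt ℝ 2 G z) (hW : ContDiffAt ℝ 2 W z)
    (hGz : IsUnit (G z)) (hWz : IsUnit (W z)) (hGH : ∀ᶠ y in 𝓝 z, (G y).IsHermitian)
    (hWH : ∀ᶠ y in 𝓝 z, (W y).IsHermitian) :
    ∂ₕ v (∂ₐ v fun y => ((G y)⁻¹ * W y).trace) z =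
      ((G z)⁻¹ * chernCurvature v G z * (G z)⁻¹ * W z).trace
        - ((G z)⁻¹ * chernCurvature v W z).trace
        + ((G z)⁻¹ * chernDeriv (-Complex.I) v G W z * (W z)⁻¹ *
          (chernDeriv (-Complex.I) v G W z)ᴴ).trace := by
  have hG1 : DifferentiableAt ℝ G z := hG.differentiableAt (by norm_num)
  have hW1 : DifferentiableAt ℝ W z := hW.differentiableAt (by norm_num)
  have hG' : DifferentiableAt ℝ (∂ₐ v G) z :=
    (contDiffAt_wirtinger (k := 1) hG (by norm_num)).differentiableAt (by norm_num)
  have hW' : DifferentiableAt ℝ (∂ₐ v W) z :=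
    (contDiffAt_wirtinger (k := 1) hW (by norm_num)).differentiableAt (by norm_num)
  have hinv : DifferentiableAt ℝ (fun y => (G y)⁻¹) z :=
    (contDiffAt_matrix_inv hG hGz).differentiableAt (by norm_num)
  have hunit : ∀ᶠ y in 𝓝 z, IsUnit (G y) :=
    hG.continuousAt.eventually (Units.isOpen.mem_nhds hGz)
  have hanti : (∂ₐ v fun y => ((G y)⁻¹ * W y).trace) =ᶠ[𝓝 z]
      fun y => ((G y)⁻¹ * chernDeriv Complex.I v G W y).trace := by
    filter_upwards [hunit, hG.eventually (by norm_num), hW.eventually (by norm_num)]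
      with y hy hGy hWy
    exact wirtinger_trace_inv_mul (hGy.differentiableAt (by norm_num))
      (hWy.differentiableAt (by norm_num)) hy
  have hderiv : ∂ₕ v (chernDeriv Complex.I v G W) z =
      ∂ₕ v (∂ₐ v W) z - (∂ₕ v (∂ₐ v G) z * (G z)⁻¹ * W z
        - ∂ₐ v G z * (G z)⁻¹ * ∂ₕ v G z * (G z)⁻¹ * W z + ∂ₐ v G z * (G z)⁻¹ * ∂ₕ v W z) := by
    unfold chernDeriv
    rw [wirtinger_sub hW' ((hG'.fun_mul hinv).fun_mul hW1), wirtinger_mul (hG'.fun_mul hinv) hW1,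
      wirtinger_mul hG' hinv, wirtinger_matrix_inv hG1 hGz]
    noncomm_ring
  have hconj : (chernDeriv (-Complex.I) v G W z)ᴴ = ∂ₐ v W z - W z * (G z)⁻¹ * ∂ₐ v G z := by
    simp only [chernDeriv, Matrix.conjTranspose_sub, Matrix.conjTranspose_mul,
      Matrix.conjTranspose_nonsing_inv, conjTranspose_wirtinger_of_isHermitian hG1 hGH,
      conjTranspose_wirtinger_of_isHermitian hW1 hWH, hGH.self_of_nhds.eq, hWH.self_of_nhds.eq,
      map_neg, Complex.conj_I, neg_neg, Matrix.mul_assoc]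
  rw [wirtinger_congr hanti, wirtinger_trace_inv_mul hG1
    ((contDiffAt_chernDeriv hG hW hGz).differentiableAt (by norm_num)) hGz, hconj]
  simp only [chernCurvature]
  rw [chernDeriv, hderiv]
  exact trace_bochner_identity
    (Matrix.mul_nonsing_inv _ ((Matrix.isUnit_iff_isUnit_det _).1 hWz))

theorem wirtinger_trace_inv_mul_wirtinger (hG : ContDiffAt ℝ 2 G z) (hGz : IsUnit (G z)) :
    ∂ₕ v (fun y => ((G y)⁻¹ * ∂ₐ v G y).trace) z = -((G z)⁻¹ * chernCurvature v G z).trace := by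
  rw [wirtinger_trace_inv_mul (hG.differentiableAt (by norm_num))
    ((contDiffAt_wirtinger (k := 1) hG (by norm_num)).differentiableAt (by norm_num)) hGz,
    chernCurvature, Matrix.mul_neg, Matrix.trace_neg, neg_neg]

section Determinant

variable {H : E → ℂ} {d : ℕ}

theorem trace_inv_mul_wirtinger_of_det_eq (hH : DifferentiableAt ℝ H z)
    (hG : DifferentiableAt ℝ G z) (hW : DifferentiableAt ℝ W z) (hHz : H z ≠ 0)
    (hGz : IsUnit (G z)) (hWz : IsUnit (W z))
    (hdet : ∀ᶠ y in 𝓝 z, (W y).det = H y ^ d * (G y).det) :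
    ((W z)⁻¹ * wirtinger c v W z).trace =
      d * (wirtinger c v H z / H z) + ((G z)⁻¹ * wirtinger c v G z).trace := by
  have hGdet : DifferentiableAt ℝ (fun y => (G y).det) z := by
    have hGij := fun i j => differentiableAt_matrix_apply hG i j
    simp only [Matrix.det_apply']
    fun_prop
  have hne : (W z).det ≠ 0 := ((Matrix.isUnit_iff_isUnit_det _).1 hWz).ne_zero
  have h := wirtinger_congr (c := c) (v := v) hdet
  rw [wirtinger_det hW hWz, wirtinger_mul (hH.fun_pow d) hGdet, wirtinger_pow d hH,
    wirtinger_det hG hGz] at h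
  refine mul_left_cancel₀ hne ?_
  rw [h, hdet.self_of_nhds]
  rcases d with _ | d
  · simp
  · simp only [Nat.add_sub_cancel]
    field_simp
    ring

theorem trace_inv_mul_chernDeriv_of_det_eq (hH : DifferentiableAt ℝ H z)
    (hG : DifferentiableAt ℝ G z) (hW : DifferentiableAt ℝ W z) (hHz : H z ≠ 0)
    (hGz : IsUnit (G z)) (hWz : IsUnit (W z))
    (hdet : ∀ᶠ y in 𝓝 z, (W y).det = H y ^ d * (G y).det) :
    ((W z)⁻¹ * chernDeriv c v G W z).trace = d * (wirtinger c v H z / H z) := by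
  rw [chernDeriv, Matrix.mul_sub, Matrix.trace_sub,
    trace_inv_mul_wirtinger_of_det_eq hH hG hW hHz hGz hWz hdet, Matrix.trace_mul_comm (W z)⁻¹,
    Matrix.mul_nonsing_inv_cancel_right _ _ ((Matrix.isUnit_iff_isUnit_det _).1 hWz),
    Matrix.trace_mul_comm (G z)⁻¹, add_sub_cancel_right]

theorem trace_inv_mul_chernCurvature_of_det_eq (hH : ContDiffAt ℝ 2 H z)
    (hG : ContDiffAt ℝ 2 G z) (hW : ContDiffAt ℝ 2 W z) (hHz : H z ≠ 0)
    (hGz : IsUnit (G z)) (hWz : IsUnit (W z))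
    (hdet : ∀ᶠ y in 𝓝 z, (W y).det = H y ^ d * (G y).det) :
    ((W z)⁻¹ * chernCurvature v W z).trace =
      ((G z)⁻¹ * chernCurvature v G z).trace
        - d * (∂ₕ v (∂ₐ v H) z / H z - ∂ₕ v H z * ∂ₐ v H z / H z ^ 2) := by
  have hH' : DifferentiableAt ℝ (∂ₐ v H) z :=
    (contDiffAt_wirtinger (k := 1) hH (by norm_num)).differentiableAt (by norm_num)
  have hHinv : DifferentiableAt ℝ (fun y => (H y)⁻¹) z :=
    (hH.differentiableAt (by norm_num)).inv hHz
  have hG' : DifferentiableAt ℝ (fun y => ((G y)⁻¹ * ∂ₐ v G y).trace) z :=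
    (contDiffAt_trace (((contDiffAt_matrix_inv hG hGz).of_le (by norm_num)).mul
      (contDiffAt_wirtinger (k := 1) hG (by norm_num)))).differentiableAt (by norm_num)
  have hfirst : (fun y => ((W y)⁻¹ * ∂ₐ v W y).trace) =ᶠ[𝓝 z]
      fun y => d * (∂ₐ v H y * (H y)⁻¹) + ((G y)⁻¹ * ∂ₐ v G y).trace := by
    filter_upwards [hdet.eventually_nhds, hH.eventually (by norm_num), hG.eventually (by norm_num),
      hW.eventually (by norm_num), hH.continuousAt.eventually_ne hHz,
      hG.continuousAt.eventually (Units.isOpen.mem_nhds hGz),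
      hW.continuousAt.eventually (Units.isOpen.mem_nhds hWz)] with y hy hHy hGy hWy hH0 hGu hWu
    exact trace_inv_mul_wirtinger_of_det_eq (hHy.differentiableAt (by norm_num))
      (hGy.differentiableAt (by norm_num)) (hWy.differentiableAt (by norm_num)) hH0 hGu hWu hy
  have h := wirtinger_congr (c := -Complex.I) (v := v) hfirst
  rw [wirtinger_trace_inv_mul_wirtinger hW hWz,
    wirtinger_add ((hH'.fun_mul hHinv).const_mul _) hG',
    wirtinger_const_mul _ (hH'.fun_mul hHinv), wirtinger_mul hH' hHinv,
    wirtinger_inv (hH.differentiableAt (by norm_num)) hHz,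
    wirtinger_trace_inv_mul_wirtinger hG hGz] at h
  linear_combination -h

end Determinant

end Chern

section Eigenvalues

variable {ι : Type*} [Fintype ι] {μ : ι → ℝ} {x : ι → ℂ}

theorem sum_sq_lt_sq_sum [Nontrivial ι] (hμ : ∀ i, 0 < μ i) : ∑ i, μ i ^ 2 < (∑ i, μ i) ^ 2 := by
  rw [sq, Finset.sum_mul]
  refine Finset.sum_lt_sum_of_nonempty Finset.univ_nonempty fun i _ => ?_
  rw [sq]
  refine mul_lt_mul_of_pos_left ?_ (hμ i)
  obtain ⟨j, hj⟩ := exists_ne i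
  exact Finset.single_lt_sum hj (Finset.mem_univ i) (Finset.mem_univ j) (hμ j)
    fun k _ _ => (hμ k).le

theorem sum_mul_norm_sum_le (hμ : ∀ i, 0 ≤ μ i) :
    (∑ i, μ i) * ‖∑ i, x i‖ ≤
      ∑ i, (∑ j, μ j - μ i) * ‖x i‖ + ‖∑ i, (μ i : ℂ) * x i‖ := by
  set S := ∑ i, μ i
  have hle (i : ι) : 0 ≤ S - μ i :=
    sub_nonneg.2 (Finset.single_le_sum (fun j _ => hμ j) (Finset.mem_univ i))
  have hsplit : (S : ℂ) * ∑ i, x i = ∑ i, ((S - μ i : ℝ) : ℂ) * x i + ∑ i, (μ i : ℂ) * x i := by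
    simp only [Finset.mul_sum, ← Finset.sum_add_distrib, Complex.ofReal_sub]
    exact Finset.sum_congr rfl fun i _ => by ring
  calc S * ‖∑ i, x i‖ = ‖(S : ℂ) * ∑ i, x i‖ := by
        rw [norm_mul, Complex.norm_real, Real.norm_of_nonneg (Finset.sum_nonneg fun i _ => hμ i)]
    _ ≤ ‖∑ i, ((S - μ i : ℝ) : ℂ) * x i‖ + ‖∑ i, (μ i : ℂ) * x i‖ := hsplit ▸ norm_add_le _ _
    _ ≤ ∑ i, (S - μ i) * ‖x i‖ + ‖∑ i, (μ i : ℂ) * x i‖ := by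
      gcongr
      refine norm_sum_le_of_le _ fun i _ => ?_
      rw [norm_mul, Complex.norm_real, Real.norm_of_nonneg (hle i)]

theorem sq_sum_sub_mul_le (a : ι → ℝ) :
    (∑ i, (∑ j, μ j - μ i) * a i) ^ 2 ≤
      ((Fintype.card ι - 1) * (∑ i, μ i) ^ 2 - ((∑ i, μ i) ^ 2 - ∑ i, μ i ^ 2)) *
        ∑ i, a i ^ 2 := by
  refine (Finset.sum_mul_sq_le_sq_mul_sq _ _ _).trans_eq ?_
  congr 1
  simp only [sub_sq, Finset.sum_add_distrib, Finset.sum_sub_distrib, ← Finset.mul_sum,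
    Finset.sum_const, Finset.card_univ, nsmul_eq_mul]
  ring

theorem sq_le_of_mul_le_add {S t Y s E n X : ℝ} (hS : 0 < S) (hE : 0 < E) (hES : E ≤ S ^ 2)
    (hn : 0 < n) (hX : 0 ≤ X) (hSt : 0 ≤ S * t) (hle : S * t ≤ Y + s)
    (hY : Y ^ 2 ≤ (n * S ^ 2 - E) * X) : t ^ 2 ≤ n * X + (n + 1) / E * s ^ 2 := by
  set ε := E / (n * S ^ 2) with hε
  have hε0 : 0 < ε := by positivity
  have hyoung : (Y + s) ^ 2 ≤ (1 + ε) * Y ^ 2 + (1 + ε⁻¹) * s ^ 2 := by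
    have h : (1 + ε) * Y ^ 2 + (1 + ε⁻¹) * s ^ 2 - (Y + s) ^ 2 = ε⁻¹ * (ε * Y - s) ^ 2 := by
      field_simp
      ring
    have : 0 ≤ ε⁻¹ * (ε * Y - s) ^ 2 := by positivity
    linarith
  have hfirst : (1 + ε) * (n * S ^ 2 - E) ≤ n * S ^ 2 := by
    have h : n * S ^ 2 - (1 + ε) * (n * S ^ 2 - E) = ε * E := by
      rw [hε]
      field_simp
      ring
    have : 0 ≤ ε * E := by positivity
    linarith
  have hsecond : 1 + ε⁻¹ ≤ S ^ 2 * ((n + 1) / E) := by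
    rw [hε, inv_div, one_add_div hE.ne', mul_div_assoc', div_le_div_iff_of_pos_right hE]
    linarith
  have hsq : S ^ 2 * t ^ 2 ≤ S ^ 2 * (n * X + (n + 1) / E * s ^ 2) := calc
    S ^ 2 * t ^ 2 = (S * t) ^ 2 := by ring
    _ ≤ (Y + s) ^ 2 := by gcongr
    _ ≤ (1 + ε) * Y ^ 2 + (1 + ε⁻¹) * s ^ 2 := hyoung
    _ ≤ (1 + ε) * ((n * S ^ 2 - E) * X) + S ^ 2 * ((n + 1) / E) * s ^ 2 := by gcongr
    _ = (1 + ε) * (n * S ^ 2 - E) * X + S ^ 2 * ((n + 1) / E) * s ^ 2 := by ring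
    _ ≤ n * S ^ 2 * X + S ^ 2 * ((n + 1) / E) * s ^ 2 := by gcongr
    _ = S ^ 2 * (n * X + (n + 1) / E * s ^ 2) := by ring
  exact le_of_mul_le_mul_left hsq (by positivity)

/-- Cauchy–Schwarz gives the factor `card ι` in front of `∑ ‖x i‖²`; the improvement to
`card ι - 1` for vectors that are almost orthogonal to `μ` is what the exponent `1 / (m - 1)` in
the hypothesis on `f` accounts for. -/
theorem sq_norm_sum_le [Nontrivial ι] (hμ : ∀ i, 0 < μ i) :
    ‖∑ i, x i‖ ^ 2 ≤ (Fintype.card ι - 1) * ∑ i, ‖x i‖ ^ 2 +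
      Fintype.card ι / ((∑ i, μ i) ^ 2 - ∑ i, μ i ^ 2) * ‖∑ i, (μ i : ℂ) * x i‖ ^ 2 := by
  have hS : 0 < ∑ i, μ i := Finset.sum_pos (fun i _ => hμ i) Finset.univ_nonempty
  have hcard : (1 : ℝ) < Fintype.card ι := by exact_mod_cast Fintype.one_lt_card
  have hq : 0 ≤ ∑ i, μ i ^ 2 := Finset.sum_nonneg fun i _ => by positivity
  refine (sq_le_of_mul_le_add hS (sub_pos.2 (sum_sq_lt_sq_sum hμ)) (sub_le_self _ hq)
    (sub_pos.2 hcard) (Finset.sum_nonneg fun i _ => by positivity) (by positivity)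
    (sum_mul_norm_sum_le fun i => (hμ i).le) (sq_sum_sub_mul_le fun i => ‖x i‖)).trans_eq ?_
  rw [sub_add_cancel]

theorem sum_mul_div_sub_one_nonneg (hμ : ∀ i, 0 < μ i) (r : ι → ι → ℝ)
    (hsymm : ∀ i k, r i k = r k i) (hr : ∀ i k, i ≠ k → 0 ≤ r i k) :
    0 ≤ ∑ k, ∑ i, r k i * (μ i / μ k - 1) := by
  have hswap : ∑ k, ∑ i, r k i * (μ i / μ k - 1) = ∑ k, ∑ i, r k i * (μ k / μ i - 1) := by
    rw [Finset.sum_comm]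
    simp only [hsymm]
  have hpair : 0 ≤ ∑ k, ∑ i, (r k i * (μ i / μ k - 1) + r k i * (μ k / μ i - 1)) := by
    refine Finset.sum_nonneg fun k _ => Finset.sum_nonneg fun i _ => ?_
    have hi := hμ i
    have hk := hμ k
    rcases eq_or_ne k i with rfl | hki
    · simp [div_self hk.ne']
    have hsq : r k i * (μ i / μ k - 1) + r k i * (μ k / μ i - 1) =
        r k i * ((μ i - μ k) ^ 2 / (μ i * μ k)) := by
      field_simp
      ring
    rw [hsq]
    have := hr k i hki
    positivity
  simp only [Finset.sum_add_distrib] at hpair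
  linarith

end Eigenvalues

section KahlerFamilies

variable {E ι : Type*} [NormedAddCommGroup E] [NormedSpace ℂ E] [Fintype ι]

/-- `G` is, near `z`, the coordinate matrix of a Kähler metric of class `C²` in the constant frame
`v`: positive definite, and closed in the sense that `∂_k G_{i j̄} = ∂_i G_{k j̄}`. -/
structure IsKahlerAt (v : ι → E) (G : E → Matrix ι ι ℂ) (z : E) : Prop where
  contDiffAt : ContDiffAt ℝ 2 G z
  posDef : ∀ᶠ y in 𝓝 z, (G y).PosDef
  closed : ∀ᶠ y in 𝓝 z, ∀ i j k, ∂ₕ (v k) G y i j = ∂ₕ (v i) G y k j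

namespace IsKahlerAt

variable {v : ι → E} {G W : E → Matrix ι ι ℂ} {z : E}

theorem isHermitian (hG : IsKahlerAt v G z) : ∀ᶠ y in 𝓝 z, (G y).IsHermitian :=
  hG.posDef.mono fun _ hy => hy.isHermitian

theorem differentiableAt (hG : IsKahlerAt v G z) : DifferentiableAt ℝ G z :=
  hG.contDiffAt.differentiableAt (by norm_num)

theorem eventually_differentiableAt (hG : IsKahlerAt v G z) :
    ∀ᶠ y in 𝓝 z, DifferentiableAt ℝ G y :=
  (hG.contDiffAt.eventually (by norm_num)).mono fun _ hy => hy.differentiableAt (by norm_num)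

theorem antiholo_closed (hG : IsKahlerAt v G z) :
    ∀ᶠ y in 𝓝 z, ∀ i j k, ∂ₐ (v k) G y j i = ∂ₐ (v i) G y j k := by
  filter_upwards [hG.closed, hG.isHermitian.eventually_nhds, hG.eventually_differentiableAt]
    with y hclosed hherm hdiff i j k
  have hconj (l : ι) : ∂ₐ (v l) G y = (∂ₕ (v l) G y)ᴴ := by
    rw [conjTranspose_wirtinger_of_isHermitian hdiff hherm, map_neg, Complex.conj_I, neg_neg]
  rw [hconj, hconj, Matrix.conjTranspose_apply, Matrix.conjTranspose_apply, hclosed]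

theorem holo_antiholo_symm (hG : IsKahlerAt v G z) (k i : ι) :
    ∂ₕ (v k) (∂ₐ (v k) G) z i i = ∂ₕ (v i) (∂ₐ (v i) G) z k k := by
  have hcomm (l : ι) : ∂ₕ (v k) (∂ₐ (v l) G) z = ∂ₐ (v l) (∂ₕ (v k) G) z :=
    wirtinger_comm hG.contDiffAt
  have hdiff (c : ℂ) (l : ι) : DifferentiableAt ℝ (wirtinger c (v l) G) z :=
    (contDiffAt_wirtinger (k := 1) hG.contDiffAt (by norm_num)).differentiableAt (by norm_num)
  calc ∂ₕ (v k) (∂ₐ (v k) G) z i i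
      = ∂ₕ (v k) (∂ₐ (v i) G) z i k := by
        rw [wirtinger_matrix_apply (hdiff _ _), wirtinger_matrix_apply (hdiff _ _)]
        exact wirtinger_congr (hG.antiholo_closed.mono fun y hy => hy i i k)
    _ = ∂ₐ (v i) (∂ₕ (v i) G) z k k := by
        rw [hcomm, wirtinger_matrix_apply (hdiff _ _), wirtinger_matrix_apply (hdiff _ _)]
        exact wirtinger_congr (hG.closed.mono fun y hy => hy i k k)
    _ = ∂ₕ (v i) (∂ₐ (v i) G) z k k := by rw [wirtinger_comm hG.contDiffAt]

variable [DecidableEq ι]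

theorem isUnit (hG : IsKahlerAt v G z) : IsUnit (G z) :=
  hG.posDef.self_of_nhds.isUnit

theorem chernCurvature_symm (hG : IsKahlerAt v G z) (k i : ι) :
    chernCurvature (v k) G z i i = chernCurvature (v i) G z k k := by
  have hholo (l : ι) : ∂ₕ (v k) G z i l = ∂ₕ (v i) G z k l := hG.closed.self_of_nhds i l k
  have hanti (l : ι) : ∂ₐ (v k) G z l i = ∂ₐ (v i) G z l k :=
    hG.antiholo_closed.self_of_nhds i l k
  simp only [chernCurvature, chernDeriv, Matrix.neg_apply, Matrix.sub_apply, Matrix.mul_apply,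
    hG.holo_antiholo_symm k i, hholo, hanti]

theorem chernDeriv_symm (hG : IsKahlerAt v G z) (hW : IsKahlerAt v W z) (k i j : ι) :
    chernDeriv (-Complex.I) (v k) G W z i j = chernDeriv (-Complex.I) (v i) G W z k j := by
  have hholo (l : ι) : ∂ₕ (v k) G z i l = ∂ₕ (v i) G z k l := hG.closed.self_of_nhds i l k
  simp only [chernDeriv, Matrix.sub_apply, Matrix.mul_assoc _ (G z)⁻¹, Matrix.mul_apply, hholo,
    hW.closed.self_of_nhds i j k]

end IsKahlerAt

end KahlerFamilies

section DiagonalPoint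

variable {E ι : Type*} [NormedAddCommGroup E] [NormedSpace ℂ E] [Fintype ι] [DecidableEq ι]
  {G W : E → Matrix ι ι ℂ} {H : E → ℝ} {μ : ι → ℝ} {d : ℕ} {z : E}

theorem inv_diagonal_ofReal (hμ : ∀ i, 0 < μ i) :
    (Matrix.diagonal fun i => (μ i : ℂ))⁻¹ = Matrix.diagonal fun i => (μ i : ℂ)⁻¹ := by
  refine Matrix.inv_eq_right_inv ?_
  have hne (i : ι) : (μ i : ℂ) ≠ 0 := Complex.ofReal_ne_zero.2 (hμ i).ne'
  simp [hne]

theorem re_wirtinger_wirtinger_trace_of_diagonal {v : E} (hμ : ∀ i, 0 < μ i)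
    (hG : ContDiffAt ℝ 2 G z) (hW : ContDiffAt ℝ 2 W z)
    (hGH : ∀ᶠ y in 𝓝 z, (G y).IsHermitian) (hWH : ∀ᶠ y in 𝓝 z, (W y).IsHermitian)
    (hWz : IsUnit (W z)) (hG1 : G z = 1) (hW1 : W z = Matrix.diagonal fun i => (μ i : ℂ)) :
    (∂ₕ v (∂ₐ v fun y => ((G y)⁻¹ * W y).trace) z).re =
      ∑ i, (chernCurvature v G z i i).re * μ i - ∑ i, (chernCurvature v W z i i).re
        + ∑ p, ∑ i, ‖chernDeriv (-Complex.I) v G W z p i‖ ^ 2 / μ i := by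
  rw [wirtinger_wirtinger_trace_inv_mul hG hW (hG1 ▸ isUnit_one) hWz hGH hWH, hG1]
  simp only [hW1, inv_diagonal_ofReal hμ, inv_one, Matrix.one_mul, Matrix.mul_one, Matrix.trace,
    Matrix.diag, Matrix.mul_diagonal, Complex.add_re, Complex.sub_re, Complex.re_sum,
    Complex.re_mul_ofReal]
  congr 1
  refine Finset.sum_congr rfl fun p _ => ?_
  rw [Matrix.mul_apply, Complex.re_sum]
  refine Finset.sum_congr rfl fun i _ => ?_
  rw [Matrix.mul_diagonal, Matrix.conjTranspose_apply, mul_right_comm, Complex.star_def,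
    Complex.mul_conj', ← Complex.ofReal_inv, ← Complex.ofReal_pow, ← Complex.ofReal_mul,
    Complex.ofReal_re, div_eq_mul_inv]

theorem sum_re_chernCurvature_div_of_det_eq {v : E} (hμ : ∀ i, 0 < μ i)
    (hH : ContDiffAt ℝ 2 (fun y => (H y : ℂ)) z) (hHz : H z ≠ 0)
    (hG : ContDiffAt ℝ 2 G z) (hW : ContDiffAt ℝ 2 W z) (hWz : IsUnit (W z))
    (hdet : ∀ᶠ y in 𝓝 z, (W y).det = (H y : ℂ) ^ d * (G y).det) (hG1 : G z = 1)
    (hW1 : W z = Matrix.diagonal fun i => (μ i : ℂ)) :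
    ∑ i, (chernCurvature v W z i i).re / μ i =
      ∑ i, (chernCurvature v G z i i).re
        - d * ((∂ₕ v (∂ₐ v fun y => (H y : ℂ)) z).re / H z
          - ‖∂ₕ v (fun y => (H y : ℂ)) z‖ ^ 2 / H z ^ 2) := by
  have hconj : ∂ₐ v (fun y => (H y : ℂ)) z = conj (∂ₕ v (fun y => (H y : ℂ)) z) := by
    rw [starRingEnd_apply, star_wirtinger (hH.differentiableAt (by norm_num))]
    simp
  have h := congrArg Complex.re (trace_inv_mul_chernCurvature_of_det_eq (v := v) hH hG hW
    (Complex.ofReal_ne_zero.2 hHz) (hG1 ▸ isUnit_one) hWz hdet)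
  rw [hconj, Complex.mul_conj', hG1, hW1, inv_diagonal_ofReal hμ] at h
  simp only [inv_one, Matrix.one_mul, Matrix.trace, Matrix.diag, Matrix.diagonal_mul,
    ← Complex.ofReal_inv, ← Complex.ofReal_pow, ← Complex.ofReal_div, ← Complex.ofReal_natCast,
    Complex.sub_re, Complex.re_sum, Complex.re_ofReal_mul, Complex.div_ofReal_re,
    Complex.ofReal_re] at h
  simpa only [div_eq_inv_mul] using h

variable {v : ι → E}

/-- The curvature of `W` is eliminated by summing over all directions: the Kähler symmetry turns
`∑ k, R^W_k(i, i) / μ k` into the trace that the determinant equation computes. -/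
theorem sum_re_wirtinger_wirtinger_trace_div (hμ : ∀ i, 0 < μ i) (hG : IsKahlerAt v G z)
    (hW : IsKahlerAt v W z) (hH : ContDiffAt ℝ 2 (fun y => (H y : ℂ)) z) (hHz : H z ≠ 0)
    (hdet : ∀ᶠ y in 𝓝 z, (W y).det = (H y : ℂ) ^ d * (G y).det) (hG1 : G z = 1)
    (hW1 : W z = Matrix.diagonal fun i => (μ i : ℂ)) :
    ∑ k, (∂ₕ (v k) (∂ₐ (v k) fun y => ((G y)⁻¹ * W y).trace) z).re / μ k =
      ∑ k, ∑ i, (chernCurvature (v k) G z i i).re * (μ i / μ k - 1)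
        + ∑ p, d * ((∂ₕ (v p) (∂ₐ (v p) fun y => (H y : ℂ)) z).re / H z
          - ‖∂ₕ (v p) (fun y => (H y : ℂ)) z‖ ^ 2 / H z ^ 2)
        + ∑ k, ∑ p, ∑ i, ‖chernDeriv (-Complex.I) (v k) G W z p i‖ ^ 2 / μ i / μ k := by
  have htrace : ∑ k, ∑ i, (chernCurvature (v k) W z i i).re / μ k =
      ∑ k, ∑ i, (chernCurvature (v k) G z i i).re
        - ∑ p, d * ((∂ₕ (v p) (∂ₐ (v p) fun y => (H y : ℂ)) z).re / H z
          - ‖∂ₕ (v p) (fun y => (H y : ℂ)) z‖ ^ 2 / H z ^ 2) := by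
    rw [Finset.sum_comm, ← Finset.sum_sub_distrib]
    refine Finset.sum_congr rfl fun p _ => ?_
    simp only [hW.chernCurvature_symm _ p]
    exact sum_re_chernCurvature_div_of_det_eq hμ hH hHz hG.contDiffAt hW.contDiffAt hW.isUnit
      hdet hG1 hW1
  simp only [fun k => re_wirtinger_wirtinger_trace_of_diagonal (v := v k) hμ hG.contDiffAt
    hW.contDiffAt hG.isHermitian hW.isHermitian hW.isUnit hG1 hW1, add_div, sub_div,
    Finset.sum_add_distrib, Finset.sum_sub_distrib, Finset.sum_div, htrace, mul_sub, mul_one,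
    mul_div_assoc]
  ring

theorem sum_sq_norm_chernDeriv_le (hμ : ∀ i, 0 < μ i) (hG : IsKahlerAt v G z)
    (hW : IsKahlerAt v W z) :
    ∑ p, ∑ k, ‖chernDeriv (-Complex.I) (v p) G W z k k / μ k‖ ^ 2 ≤
      ∑ k, ∑ p, ∑ i, ‖chernDeriv (-Complex.I) (v k) G W z p i‖ ^ 2 / μ i / μ k := by
  rw [Finset.sum_comm]
  refine Finset.sum_le_sum fun k _ => Finset.sum_le_sum fun p _ => ?_
  rw [hG.chernDeriv_symm hW, norm_div, Complex.norm_real, Real.norm_of_nonneg (hμ k).le, div_pow,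
    sq (μ k), ← div_div]
  exact Finset.single_le_sum
    (f := fun i => ‖chernDeriv (-Complex.I) (v k) G W z p i‖ ^ 2 / μ i / μ k)
    (fun i _ => by have := hμ i; have := hμ k; positivity) (Finset.mem_univ k)

theorem neg_sq_norm_wirtinger_trace_le [Nontrivial ι] {v : E} (hμ : ∀ i, 0 < μ i)
    (hH : DifferentiableAt ℝ (fun y => (H y : ℂ)) z) (hHz : H z ≠ 0)
    (hG : DifferentiableAt ℝ G z) (hW : DifferentiableAt ℝ W z) (hWz : IsUnit (W z))
    (hdet : ∀ᶠ y in 𝓝 z, (W y).det = (H y : ℂ) ^ (Fintype.card ι - 1) * (G y).det)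
    (hG1 : G z = 1) (hW1 : W z = Matrix.diagonal fun i => (μ i : ℂ)) :
    -(Fintype.card ι / ((Fintype.card ι - 1) * ((∑ i, μ i) ^ 2 - ∑ i, μ i ^ 2)) *
        ‖∂ₕ v (fun y => ((G y)⁻¹ * W y).trace) z‖ ^ 2) ≤
      ∑ k, ‖chernDeriv (-Complex.I) v G W z k k / μ k‖ ^ 2
        - (Fintype.card ι - 1) * (‖∂ₕ v (fun y => (H y : ℂ)) z‖ ^ 2 / H z ^ 2) := by
  set T := chernDeriv (-Complex.I) v G W z with hT
  have hcard : (0 : ℝ) < Fintype.card ι - 1 := by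
    rw [sub_pos]; exact_mod_cast Fintype.one_lt_card
  have hGz : IsUnit (G z) := hG1 ▸ isUnit_one
  have hgrad : ∂ₕ v (fun y => ((G y)⁻¹ * W y).trace) z = ∑ k, (μ k : ℂ) * (T k k / μ k) := by
    rw [wirtinger_trace_inv_mul hG hW hGz, ← hT, hG1, inv_one, Matrix.one_mul, Matrix.trace]
    exact Finset.sum_congr rfl fun k _ =>
      (mul_div_cancel₀ _ (Complex.ofReal_ne_zero.2 (hμ k).ne')).symm
  have hlog : ∑ k, T k k / μ k =
      ((Fintype.card ι - 1 : ℝ) : ℂ) * (∂ₕ v (fun y => (H y : ℂ)) z / H z) := by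
    have h := trace_inv_mul_chernDeriv_of_det_eq (c := -Complex.I) (v := v) hH hG hW
      (Complex.ofReal_ne_zero.2 hHz) hGz hWz hdet
    rw [Nat.cast_pred Fintype.card_pos, ← hT, hW1, inv_diagonal_ofReal hμ] at h
    simpa only [Matrix.trace, Matrix.diag, Matrix.diagonal_mul, div_eq_inv_mul, Complex.ofReal_sub,
      Complex.ofReal_natCast, Complex.ofReal_one] using h
  have hCS := sq_norm_sum_le (x := fun k => T k k / μ k) hμ
  rw [← hgrad, hlog, norm_mul, norm_div, Complex.norm_real, Complex.norm_real, Real.norm_eq_abs,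
    Real.norm_eq_abs, mul_pow, div_pow, sq_abs, sq_abs] at hCS
  have hE := sub_pos.2 (sum_sq_lt_sq_sum hμ)
  rw [neg_le_sub_iff_le_add]
  refine le_of_mul_le_mul_left ?_ hcard
  calc _ = (Fintype.card ι - 1 : ℝ) ^ 2 * (‖∂ₕ v (fun y => (H y : ℂ)) z‖ ^ 2 / H z ^ 2) := by ring
    _ ≤ _ := hCS
    _ = _ := by field_simp

theorem sum_re_wirtinger_wirtinger_trace_div_ge [Nontrivial ι] (hμ : ∀ i, 0 < μ i)
    (hG : IsKahlerAt v G z) (hW : IsKahlerAt v W z)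
    (hH : ContDiffAt ℝ 2 (fun y => (H y : ℂ)) z) (hHz : H z ≠ 0)
    (hdet : ∀ᶠ y in 𝓝 z, (W y).det = (H y : ℂ) ^ (Fintype.card ι - 1) * (G y).det)
    (hG1 : G z = 1) (hW1 : W z = Matrix.diagonal fun i => (μ i : ℂ))
    (hR : ∀ i k, i ≠ k → 0 ≤ (chernCurvature (v k) G z i i).re) :
    (Fintype.card ι - 1) / H z * ∑ p, (∂ₕ (v p) (∂ₐ (v p) fun y => (H y : ℂ)) z).re
        - Fintype.card ι / ((Fintype.card ι - 1) * ((∑ i, μ i) ^ 2 - ∑ i, μ i ^ 2)) *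
          ∑ p, ‖∂ₕ (v p) (fun y => ((G y)⁻¹ * W y).trace) z‖ ^ 2 ≤
      ∑ k, (∂ₕ (v k) (∂ₐ (v k) fun y => ((G y)⁻¹ * W y).trace) z).re / μ k := by
  have hcast : ((Fintype.card ι - 1 : ℕ) : ℝ) = Fintype.card ι - 1 :=
    Nat.cast_pred Fintype.card_pos
  have hcurv := sum_mul_div_sub_one_nonneg hμ (fun k i => (chernCurvature (v k) G z i i).re)
    (fun k i => by rw [hG.chernCurvature_symm]) fun k i hki => hR i k hki.symm
  have hgrad := Finset.sum_le_sum fun p (_ : p ∈ Finset.univ) =>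
    neg_sq_norm_wirtinger_trace_le (v := v p) hμ (hH.differentiableAt (by norm_num)) hHz
      hG.differentiableAt hW.differentiableAt hW.isUnit hdet hG1 hW1
  have hT := sum_sq_norm_chernDeriv_le hμ hG hW
  rw [sum_re_wirtinger_wirtinger_trace_div hμ hG hW hH hHz hdet hG1 hW1, hcast]
  have hdensity : ∑ p, (Fintype.card ι - 1 : ℝ) *
        ((∂ₕ (v p) (∂ₐ (v p) fun y => (H y : ℂ)) z).re / H z
          - ‖∂ₕ (v p) (fun y => (H y : ℂ)) z‖ ^ 2 / H z ^ 2) =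
      (Fintype.card ι - 1) / H z * ∑ p, (∂ₕ (v p) (∂ₐ (v p) fun y => (H y : ℂ)) z).re
        - ∑ p, (Fintype.card ι - 1) * (‖∂ₕ (v p) (fun y => (H y : ℂ)) z‖ ^ 2 / H z ^ 2) := by
    rw [Finset.mul_sum, ← Finset.sum_sub_distrib]
    exact Finset.sum_congr rfl fun p _ => by ring
  rw [Finset.sum_neg_distrib, Finset.sum_sub_distrib, ← Finset.mul_sum] at hgrad
  linarith

end DiagonalPoint

section Laplacian

open Laplacian InnerProductSpace

theorem fderiv_fderiv_comp_add_clm {E F G : Type*} [NormedAddCommGroup E] [NormedSpace ℝ E]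
    [NormedAddCommGroup F] [NormedSpace ℝ F] [NormedAddCommGroup G] [NormedSpace ℝ G]
    {f : E → F} {a : E} {x : G} (L : G →L[ℝ] E) (hf : ContDiffAt ℝ 2 f (a + L x)) (v w : G) :
    fderiv ℝ (fderiv ℝ fun y => f (a + L y)) x v w =
      fderiv ℝ (fderiv ℝ f) (a + L x) (L v) (L w) := by
  have hL (y : G) : HasFDerivAt (fun y => a + L y) L y := L.hasFDerivAt.const_add a
  have hfirst : fderiv ℝ (fun y => f (a + L y)) =ᶠ[𝓝 x] fun y => (fderiv ℝ f (a + L y)).comp L := by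
    filter_upwards [(hL x).continuousAt.eventually (hf.eventually (by simp))] with y hy
    exact ((hy.differentiableAt (by simp)).hasFDerivAt.comp y (hL y)).fderiv
  have hsecond : HasFDerivAt (fderiv ℝ f) (fderiv ℝ (fderiv ℝ f) (a + L x)) (a + L x) :=
    ((hf.fderiv_right (m := 1) (by norm_num)).differentiableAt (by simp)).hasFDerivAt
  have hcomp := (hsecond.comp x (hL x)).clm_comp (hasFDerivAt_const L x)
  simp only [Function.comp_def] at hcomp
  simp [hfirst.fderiv_eq, hcomp.fderiv]

theorem deriv_deriv_nonpos_of_isLocalMax {f : ℝ → ℝ} {x : ℝ} (h : IsLocalMax f x)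
    (hf : ContinuousAt f x) : deriv (deriv f) x ≤ 0 := by
  by_contra! hpos
  have hmin : IsLocalMin f x := isLocalMin_of_deriv_deriv_pos hpos h.deriv_eq_zero hf
  have hconst : f =ᶠ[𝓝 x] fun _ => f x := by
    filter_upwards [h, hmin] with y h₁ h₂ using le_antisymm h₁ h₂
  simp [hconst.deriv.deriv_eq] at hpos

theorem fderiv_fderiv_self_nonpos_of_isLocalMax {E : Type*} [NormedAddCommGroup E]
    [NormedSpace ℝ E] {f : E → ℝ} {x : E} (h : IsLocalMax f x) (hf : ContDiffAt ℝ 2 f x) (v : E) :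
    fderiv ℝ (fderiv ℝ f) x v v ≤ 0 := by
  let L : ℝ →L[ℝ] E := .toSpanSingleton ℝ v
  have hx : x + L 0 = x := by simp
  have hline : ContinuousAt (fun t => x + L t) 0 := by fun_prop
  have hf' : ContDiffAt ℝ 2 f (x + L 0) := hx.symm ▸ hf
  have hg : ContDiffAt ℝ 2 (fun t => f (x + L t)) 0 :=
    hf'.comp 0 (contDiffAt_const.add L.contDiff.contDiffAt)
  have hmax : IsLocalMax (fun t => f (x + L t)) 0 := by
    have h' : ∀ᶠ y in 𝓝 (x + L 0), f y ≤ f (x + L 0) := hx.symm ▸ h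
    exact hline.eventually h'
  have hderiv := fderiv_fderiv_comp_add_clm L hf' 1 1
  have hfderiv : DifferentiableAt ℝ (fderiv ℝ fun t => f (x + L t)) 0 :=
    (hg.fderiv_right (m := 1) (by norm_num)).differentiableAt (by simp)
  have hdd : deriv (deriv fun t => f (x + L t)) 0 =
      fderiv ℝ (fderiv ℝ fun t => f (x + L t)) 0 1 1 := by
    have := (hfderiv.hasFDerivAt.clm_apply (hasFDerivAt_const (1 : ℝ) 0)).hasDerivAt.deriv
    simpa [fderiv_apply_one_eq_deriv] using this
  have hL : L 1 = v := by simp [L]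
  rw [hx, hL, ← hdd] at hderiv
  exact hderiv ▸ deriv_deriv_nonpos_of_isLocalMax hmax hg.continuousAt

theorem laplacian_nonpos_of_isLocalMax {E : Type*} [NormedAddCommGroup E] [InnerProductSpace ℝ E]
    [FiniteDimensional ℝ E] {f : E → ℝ} {x : E} (h : IsLocalMax f x) (hf : ContDiffAt ℝ 2 f x) :
    Δ f x ≤ 0 := by
  rw [laplacian_eq_iteratedFDeriv_stdOrthonormalBasis]
  refine Finset.sum_nonpos fun i _ => ?_
  rw [iteratedFDeriv_two_apply]
  exact fderiv_fderiv_self_nonpos_of_isLocalMax h hf _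

theorem laplacian_norm_sq (z : ℂ) : Δ (fun w : ℂ => ‖w‖ ^ 2) z = 4 := by
  have h : fderiv ℝ (fun w : ℂ => ‖w‖ ^ 2) = (2 • innerSL ℝ : ℂ →L[ℝ] ℂ →L[ℝ] ℝ) := fderiv_norm_sq
  rw [laplacian_eq_iteratedFDeriv_complexPlane]
  simp only [iteratedFDeriv_two_apply, h, ContinuousLinearMap.fderiv]
  have hinner (w : ℂ) : (2 • innerSL ℝ : ℂ →L[ℝ] ℂ →L[ℝ] ℝ) w w = 2 * ‖w‖ ^ 2 := by
    rw [← real_inner_self_eq_norm_sq, two_smul, two_mul]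
    rfl
  simp only [Matrix.cons_val, hinner]
  norm_num

theorem laplacian_comp_linearIsometryEquiv {E F : Type*} [NormedAddCommGroup E]
    [InnerProductSpace ℝ E] [FiniteDimensional ℝ E] [NormedAddCommGroup F] [NormedSpace ℝ F]
    {f : E → F} {x : E} (σ : E ≃ₗᵢ[ℝ] E) (hf : ContDiffAt ℝ 2 f (σ x)) :
    Δ (fun y => f (σ y)) x = Δ f (σ x) := by
  have h := fderiv_fderiv_comp_add_clm (a := 0) (x := x) (f := f)
    (σ.toContinuousLinearEquiv : E →L[ℝ] E) (by simpa using hf)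
  simp only [zero_add] at h
  rw [laplacian_eq_iteratedFDeriv_stdOrthonormalBasis,
    laplacian_eq_iteratedFDeriv_orthonormalBasis f ((stdOrthonormalBasis ℝ E).map σ)]
  simp only [iteratedFDeriv_two_apply]
  exact Finset.sum_congr rfl fun i _ => by simpa using h _ _

end Laplacian

section Interpolation

open Laplacian InnerProductSpace

/-- The superharmonic function with Laplacian `-N` which is nonnegative on the right half of the
disc of radius `d` and at least `M` on its circular boundary. -/
def halfDiscBarrier (d M N : ℝ) (z : ℂ) : ℝ :=
  (((2 * M / d + N * d / 2 : ℝ) : ℂ) * z - ((M / d ^ 2 + N / 4 : ℝ) : ℂ) * z ^ 2).re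
    - N / 4 * ‖z‖ ^ 2

variable {d M N : ℝ}

theorem halfDiscBarrier_eq (hd : d ≠ 0) (z : ℂ) : halfDiscBarrier d M N z =
    M / d ^ 2 * (z.im ^ 2 + z.re * (2 * d - z.re)) + N / 2 * (z.re * (d - z.re)) := by
  rw [halfDiscBarrier, ← Complex.normSq_eq_norm_sq, Complex.normSq_apply, Complex.sub_re,
    Complex.re_ofReal_mul, Complex.re_ofReal_mul, pow_two z, Complex.mul_re]
  field_simp
  ring

theorem contDiff_halfDiscBarrier : ContDiff ℝ 2 (halfDiscBarrier d M N) := by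
  unfold halfDiscBarrier
  have hpoly : ContDiff ℝ 2 fun z : ℂ =>
      ((2 * M / d + N * d / 2 : ℝ) : ℂ) * z - ((M / d ^ 2 + N / 4 : ℝ) : ℂ) * z ^ 2 := by fun_prop
  exact (Complex.reCLM.contDiff.comp hpoly).sub (contDiff_const.mul (contDiff_norm_sq ℝ))

theorem laplacian_halfDiscBarrier (z : ℂ) : Δ (halfDiscBarrier d M N) z = -N := by
  have hharm : HarmonicAt (fun z : ℂ => (((2 * M / d + N * d / 2 : ℝ) : ℂ) * z -
      ((M / d ^ 2 + N / 4 : ℝ) : ℂ) * z ^ 2).re) z :=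
    AnalyticAt.harmonicAt_re (by fun_prop)
  have hnorm : ContDiffAt ℝ 2 (fun w : ℂ => ‖w‖ ^ 2) z := (contDiff_norm_sq ℝ).contDiffAt
  have hsub := hharm.1.laplacian_sub (f₂ := (N / 4) • fun w : ℂ => ‖w‖ ^ 2)
    (hnorm.const_smul (N / 4))
  rw [hharm.2.self_of_nhds, laplacian_smul (N / 4) hnorm, laplacian_norm_sq] at hsub
  refine hsub.trans ?_
  simp

theorem fderiv_halfDiscBarrier_zero :
    fderiv ℝ (halfDiscBarrier d M N) 0 1 = 2 * M / d + N * d / 2 := by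
  have hpoly := ((hasDerivAt_id (0 : ℂ)).const_mul ((2 * M / d + N * d / 2 : ℝ) : ℂ)).sub
    (((hasDerivAt_id (0 : ℂ)).pow 2).const_mul ((M / d ^ 2 + N / 4 : ℝ) : ℂ))
  have hre := Complex.reCLM.hasFDerivAt.comp (0 : ℂ) (hpoly.hasFDerivAt.restrictScalars ℝ)
  have h := hre.sub ((hasStrictFDerivAt_norm_sq (0 : ℂ)).hasFDerivAt.const_mul (N / 4))
  have h' : fderiv ℝ (halfDiscBarrier d M N) 0 = _ := h.fderiv
  rw [h']
  simp

theorem le_of_laplacian_pos {E : Type*} [NormedAddCommGroup E] [InnerProductSpace ℝ E]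
    [FiniteDimensional ℝ E] {f : E → ℝ} {K : Set E} {c : ℝ} (hK : IsCompact K)
    (hf : ContinuousOn f K) (hf₂ : ∀ x ∈ interior K, ContDiffAt ℝ 2 f x)
    (hΔ : ∀ x ∈ interior K, 0 < Δ f x) (hc : ∀ x ∈ K, x ∉ interior K → f x ≤ c) {x : E}
    (hx : x ∈ K) : f x ≤ c := by
  obtain ⟨y, hy, hmax⟩ := hK.exists_isMaxOn ⟨x, hx⟩ hf
  refine (hmax hx).trans (hc y hy fun hint => ?_)
  have hlocal : IsLocalMax f y := hmax.isLocalMax (mem_interior_iff_mem_nhds.1 hint)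
  exact (hΔ y hint).not_ge (laplacian_nonpos_of_isLocalMax hlocal (hf₂ y hint))

/-- Reflection of the complex plane in the imaginary axis. -/
def reflectRe : ℂ ≃ₗᵢ[ℝ] ℂ :=
  Complex.conjLIE.trans (LinearIsometryEquiv.neg ℝ)

theorem reflectRe_apply (z : ℂ) : reflectRe z = -conj z := rfl

theorem le_halfDiscBarrier (hd : 0 < d) (hM : 0 ≤ M) (hN : 0 ≤ N) {z : ℂ} (hre : 0 ≤ z.re)
    (hz : ‖z‖ = d) : M ≤ halfDiscBarrier d M N z := by
  have hsq : z.re * z.re + z.im * z.im = d ^ 2 := by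
    rw [← Complex.normSq_apply, Complex.normSq_eq_norm_sq, hz]
  have hred : z.re ≤ d := hz ▸ Complex.re_le_norm z
  have hcross : 0 ≤ z.re * (d - z.re) := mul_nonneg hre (sub_nonneg.2 hred)
  rw [halfDiscBarrier_eq hd.ne']
  calc M = M / d ^ 2 * d ^ 2 := by field_simp
    _ ≤ M / d ^ 2 * (z.im ^ 2 + z.re * (2 * d - z.re)) := by gcongr; linarith
    _ ≤ _ := le_add_of_nonneg_right (by positivity)

/-- The part of a function which is odd under reflection in the imaginary axis. It has the same
derivative in the real direction at the origin, and it vanishes on the imaginary axis. -/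
def oddPart (q : ℂ → ℝ) : ℂ → ℝ :=
  (2⁻¹ : ℝ) • (q - fun z => q (reflectRe z))

variable {q : ℂ → ℝ} {z : ℂ}

theorem oddPart_apply : oddPart q z = (q z - q (reflectRe z)) / 2 := by
  simp only [oddPart, Pi.smul_apply, Pi.sub_apply, smul_eq_mul]
  ring

theorem contDiffAt_oddPart (hq : ContDiffAt ℝ 2 q z) (hq' : ContDiffAt ℝ 2 q (reflectRe z)) :
    ContDiffAt ℝ 2 (oddPart q) z :=
  (hq.sub (hq'.comp z reflectRe.contDiff.contDiffAt)).const_smul (2⁻¹ : ℝ)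

theorem laplacian_oddPart (hq : ContDiffAt ℝ 2 q z) (hq' : ContDiffAt ℝ 2 q (reflectRe z)) :
    Δ (oddPart q) z = (Δ q z - Δ q (reflectRe z)) / 2 := by
  have hσ : ContDiffAt ℝ 2 (fun z => q (reflectRe z)) z :=
    hq'.comp z reflectRe.contDiff.contDiffAt
  rw [oddPart, laplacian_smul (f := q - fun z => q (reflectRe z)) _ (hq.sub hσ),
    hq.laplacian_sub hσ, laplacian_comp_linearIsometryEquiv _ hq', smul_eq_mul]
  ring

theorem fderiv_oddPart_zero (hq : DifferentiableAt ℝ q 0) :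
    fderiv ℝ (oddPart q) 0 1 = fderiv ℝ q 0 1 := by
  have hσ : HasFDerivAt (fun z => q (reflectRe z))
      ((fderiv ℝ q 0).comp (reflectRe.toContinuousLinearEquiv : ℂ →L[ℝ] ℂ)) 0 := by
    have hq' : HasFDerivAt q (fderiv ℝ q 0) (reflectRe 0) := by
      rw [map_zero]
      exact hq.hasFDerivAt
    exact hq'.comp 0 reflectRe.toContinuousLinearEquiv.hasFDerivAt
  have h := (hq.hasFDerivAt.sub hσ).const_smul (2⁻¹ : ℝ)
  have h' : fderiv ℝ (oddPart q) 0 = _ := h.fderiv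
  rw [h']
  simp [reflectRe_apply]
  ring

theorem oddPart_le_halfDiscBarrier_of_boundary (hd : 0 < d) (hN : 0 ≤ N)
    (hM : ∀ z, ‖z‖ ≤ d → |q z| ≤ M) (hre : 0 ≤ z.re) (hz : ‖z‖ ≤ d)
    (hboundary : z.re = 0 ∨ ‖z‖ = d) : oddPart q z ≤ halfDiscBarrier d M N z := by
  have hM0 : 0 ≤ M := (abs_nonneg _).trans (hM z hz)
  rcases hboundary with h | h
  · have hσz : reflectRe z = z := by simp [reflectRe_apply, Complex.ext_iff, h]
    rw [oddPart_apply, hσz, halfDiscBarrier_eq hd.ne', h]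
    simp only [sub_self, zero_div, zero_mul, mul_zero, add_zero]
    positivity
  · have h₁ := abs_le.1 (hM z hz)
    have h₂ := abs_le.1 (hM (reflectRe z) ((reflectRe.norm_map z).trans_le hz))
    rw [oddPart_apply]
    linarith [le_halfDiscBarrier hd hM0 hN hre h]

theorem oddPart_le_halfDiscBarrier (hd : 0 < d) (hq : ∀ z, ‖z‖ ≤ d → ContDiffAt ℝ 2 q z)
    (hM : ∀ z, ‖z‖ ≤ d → |q z| ≤ M) (hN : ∀ z, ‖z‖ ≤ d → |Δ q z| < N) (hre : 0 ≤ z.re)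
    (hz : ‖z‖ ≤ d) : oddPart q z ≤ halfDiscBarrier d M N z := by
  have hσ {w : ℂ} (hw : ‖w‖ ≤ d) : ‖reflectRe w‖ ≤ d := (reflectRe.norm_map w).trans_le hw
  have hodd (w : ℂ) (hw : ‖w‖ ≤ d) : ContDiffAt ℝ 2 (oddPart q) w :=
    contDiffAt_oddPart (hq w hw) (hq _ (hσ hw))
  have hcont (w : ℂ) (hw : ‖w‖ ≤ d) : ContDiffAt ℝ 2 (oddPart q - halfDiscBarrier d M N) w :=
    (hodd w hw).sub contDiff_halfDiscBarrier.contDiffAt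
  have hΔ (w : ℂ) (hw : ‖w‖ ≤ d) : 0 < Δ (oddPart q - halfDiscBarrier d M N) w := by
    rw [(hodd w hw).laplacian_sub contDiff_halfDiscBarrier.contDiffAt,
      laplacian_oddPart (hq w hw) (hq _ (hσ hw)), laplacian_halfDiscBarrier]
    linarith [abs_lt.1 (hN w hw), abs_lt.1 (hN _ (hσ hw))]
  let K : Set ℂ := Metric.closedBall 0 d ∩ {w | 0 ≤ w.re}
  have hnorm {w : ℂ} (hw : w ∈ K) : ‖w‖ ≤ d := mem_closedBall_zero_iff.1 hw.1
  have hboundary (w : ℂ) (hw : w ∈ K) (hwK : w ∉ interior K) : w.re = 0 ∨ ‖w‖ = d := by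
    by_contra! hne
    have hopen : IsOpen (Metric.ball (0 : ℂ) d ∩ {w | 0 < w.re}) :=
      Metric.isOpen_ball.inter (isOpen_lt continuous_const Complex.continuous_re)
    refine hwK (interior_maximal (fun y hy => ?_) hopen
      ⟨mem_ball_zero_iff.2 ((hnorm hw).lt_of_ne hne.2), lt_of_le_of_ne hw.2 hne.1.symm⟩)
    exact ⟨Metric.ball_subset_closedBall hy.1, (show 0 < y.re from hy.2).le⟩
  refine sub_nonpos.1 (le_of_laplacian_pos (f := oddPart q - halfDiscBarrier d M N) (K := K) ?_
    (fun w hw => (hcont w (hnorm hw)).continuousAt.continuousWithinAt)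
    (fun w hw => hcont w (hnorm (interior_subset hw)))
    (fun w hw => hΔ w (hnorm (interior_subset hw))) (fun w hw hwK => sub_nonpos.2 ?_)
    ⟨mem_closedBall_zero_iff.2 hz, hre⟩)
  · exact (isCompact_closedBall 0 d).inter_right
      (isClosed_le continuous_const Complex.continuous_re)
  · exact oddPart_le_halfDiscBarrier_of_boundary hd ((abs_nonneg _).trans (hN w (hnorm hw)).le) hM
      hw.2 (hnorm hw) (hboundary w hw hwK)

theorem fderiv_one_le_of_abs_laplacian_lt (hd : 0 < d) (hq : ∀ z, ‖z‖ ≤ d → ContDiffAt ℝ 2 q z)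
    (hM : ∀ z, ‖z‖ ≤ d → |q z| ≤ M) (hN : ∀ z, ‖z‖ ≤ d → |Δ q z| < N) :
    fderiv ℝ q 0 1 ≤ 2 * M / d + N * d / 2 := by
  have h0 : ‖(0 : ℂ)‖ ≤ d := by simpa using hd.le
  have hq0 : ContDiffAt ℝ 2 q 0 := hq 0 h0
  have hodd : DifferentiableAt ℝ (oddPart q) 0 :=
    (contDiffAt_oddPart hq0 (by rwa [map_zero])).differentiableAt (by simp)
  have hbarrier : DifferentiableAt ℝ (halfDiscBarrier d M N) 0 :=
    contDiff_halfDiscBarrier.contDiffAt.differentiableAt (by simp)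
  let K : Set ℂ := {z | 0 ≤ z.re}
  have hmax : IsLocalMaxOn (oddPart q - halfDiscBarrier d M N) K 0 := by
    filter_upwards [self_mem_nhdsWithin, mem_nhdsWithin_of_mem_nhds (Metric.ball_mem_nhds 0 hd)]
      with z hre hz
    have h := oddPart_le_halfDiscBarrier hd hq hM hN hre (mem_ball_zero_iff.1 hz).le
    simp only [Pi.sub_apply]
    have hzero : oddPart q 0 = 0 := by simp [oddPart_apply]
    have hzero' : halfDiscBarrier d M N 0 = 0 := by simp [halfDiscBarrier]
    linarith
  have hcone : (1 : ℂ) ∈ posTangentConeAt K 0 :=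
    mem_posTangentConeAt_of_segment_subset (by
      rw [segment_eq_image]
      rintro _ ⟨t, ht, rfl⟩
      simpa [K] using ht.1)
  have h := hmax.hasFDerivWithinAt_nonpos
    (hodd.hasFDerivAt.sub hbarrier.hasFDerivAt).hasFDerivWithinAt hcone
  rw [_root_.sub_apply, fderiv_oddPart_zero (hq0.differentiableAt (by simp)),
    fderiv_halfDiscBarrier_zero] at h
  linarith

end Interpolation

section ComplexLines

open Laplacian InnerProductSpace

variable {E F : Type*} [NormedAddCommGroup E] [NormedSpace ℂ E] [NormedAddCommGroup F]
  [NormedSpace ℂ F] {v z : E}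

theorem laplacian_comp_complexLine {f : E → F} {ζ : ℂ} (hf : ContDiffAt ℝ 2 f (z + ζ • v)) :
    Δ (fun ξ : ℂ => f (z + ξ • v)) ζ = (4 : ℂ) • ∂ₕ v (∂ₐ v f) (z + ζ • v) := by
  let L : ℂ →L[ℝ] E := (ContinuousLinearMap.toSpanSingleton ℂ v).restrictScalars ℝ
  have h := fderiv_fderiv_comp_add_clm L hf
  have hsymm : IsSymmSndFDerivAt ℝ f (z + ζ • v) := hf.isSymmSndFDerivAt (by simp)
  simp only [L, ContinuousLinearMap.coe_restrictScalars',
    ContinuousLinearMap.toSpanSingleton_apply] at h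
  simp only [laplacian_eq_iteratedFDeriv_complexPlane, iteratedFDeriv_two_apply, Matrix.cons_val,
    h, wirtinger_wirtinger hf, hsymm.eq (Complex.I • v) v, neg_mul, Complex.I_mul_I, one_smul]
  module

variable {f : E → ℝ}

theorem contDiffAt_ofReal_comp {n : WithTop ℕ∞} (hf : ContDiffAt ℝ n f z) :
    ContDiffAt ℝ n (fun y => (f y : ℂ)) z :=
  Complex.ofRealCLM.contDiff.contDiffAt.comp z hf

theorem holo_antiholo_wirtinger_ofReal (hf : ContDiffAt ℝ 2 f z) :
    ∂ₕ v (∂ₐ v fun y => (f y : ℂ)) z = (Δ (fun ζ : ℂ => f (z + ζ • v)) 0 / 4 : ℝ) := by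
  have hz : z + (0 : ℂ) • v = z := by simp
  have hf' : ContDiffAt ℝ 2 f (z + (0 : ℂ) • v) := hz.symm ▸ hf
  have hline : ContDiffAt ℝ 2 (fun ζ : ℂ => f (z + ζ • v)) 0 :=
    hf'.comp 0 (by fun_prop)
  have h := laplacian_comp_complexLine (contDiffAt_ofReal_comp hf')
  have hreal := hline.laplacian_CLM_comp_left (l := Complex.ofRealCLM)
  simp only [Function.comp_def, Complex.ofRealCLM_apply] at hreal
  rw [hz, hreal, smul_eq_mul] at h
  push_cast
  rw [h]
  ring

theorem re_wirtinger_wirtinger_nonpos_of_isLocalMax (h : IsLocalMax f z)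
    (hf : ContDiffAt ℝ 2 f z) : (∂ₕ v (∂ₐ v fun y => (f y : ℂ)) z).re ≤ 0 := by
  have hz : z + (0 : ℂ) • v = z := by simp
  have hline : ContDiff ℝ 2 fun ζ : ℂ => z + ζ • v := by fun_prop
  have hmax : IsLocalMax (fun ζ : ℂ => f (z + ζ • v)) 0 := by
    have h' : ∀ᶠ y in 𝓝 (z + (0 : ℂ) • v), f y ≤ f (z + (0 : ℂ) • v) := hz.symm ▸ h
    exact hline.continuous.continuousAt.eventually h'
  have hcont : ContDiffAt ℝ 2 (fun ζ : ℂ => f (z + ζ • v)) 0 :=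
    ContDiffAt.comp 0 (hz.symm ▸ hf) hline.contDiffAt
  rw [holo_antiholo_wirtinger_ofReal hf, Complex.ofReal_re]
  linarith [laplacian_nonpos_of_isLocalMax hmax hcont]

theorem holo_wirtinger_ofReal (hf : DifferentiableAt ℝ f z) :
    ∂ₕ v (fun y => (f y : ℂ)) z =
      ((fderiv ℝ f z v : ℝ) - Complex.I * (fderiv ℝ f z (Complex.I • v) : ℝ)) / 2 := by
  have h : HasFDerivAt (fun y => (f y : ℂ)) (Complex.ofRealCLM.comp (fderiv ℝ f z)) z :=
    Complex.ofRealCLM.hasFDerivAt.comp z hf.hasFDerivAt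
  simp only [wirtinger, h.fderiv, ContinuousLinearMap.comp_apply, Complex.ofRealCLM_apply,
    smul_eq_mul]
  ring

theorem norm_wirtinger_le_of_forall_fderiv_le {T : ℝ} (hf : DifferentiableAt ℝ f z)
    (hT : ∀ c : ℂ, ‖c‖ = 1 → fderiv ℝ f z (c • v) ≤ 2 * T) : ‖∂ₕ v (fun y => (f y : ℂ)) z‖ ≤ T := by
  obtain ⟨c, hc, hcv⟩ := Complex.exists_norm_eq_mul_self (∂ₕ v (fun y => (f y : ℂ)) z)
  have hrot : ∂ₕ (c • v) (fun y => (f y : ℂ)) z = (‖∂ₕ v (fun y => (f y : ℂ)) z‖ : ℝ) := by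
    rw [wirtinger_smul_vec (by simp), hcv, smul_eq_mul, neg_mul, sub_neg_eq_add,
      mul_comm Complex.I, Complex.re_add_im]
  have hre := congrArg Complex.re (holo_wirtinger_ofReal (v := c • v) hf)
  rw [hrot] at hre
  simp at hre
  linarith [hT c hc]

theorem norm_wirtinger_wirtinger_smul {f : E → ℂ} (hf : ContDiffAt ℝ 2 f z) (c : ℂ) :
    ‖∂ₕ (c • v) (∂ₐ (c • v) f) z‖ = ‖c‖ ^ 2 * ‖∂ₕ v (∂ₐ v f) z‖ := by
  have hanti : ∂ₐ (c • v) f = fun y => conj c * ∂ₐ v f y := by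
    funext y
    rw [wirtinger_smul_vec (by simp), smul_eq_mul]
    congr 1
    simp [Complex.ext_iff]
  have hdiff : DifferentiableAt ℝ (∂ₐ v f) z :=
    (contDiffAt_wirtinger (k := 1) hf (by norm_num)).differentiableAt (by simp)
  have hc : (c.re - -Complex.I * c.im : ℂ) = c := by simp [Complex.ext_iff]
  rw [wirtinger_smul_vec (by simp), hanti, wirtinger_const_mul _ hdiff, hc, norm_smul, norm_mul,
    RCLike.norm_conj]
  ring

theorem fderiv_le_of_wirtinger_wirtinger_lt {d M N : ℝ} (hd : 0 < d)
    (hf : ∀ ζ : ℂ, ‖ζ‖ ≤ d → ContDiffAt ℝ 2 f (z + ζ • v))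
    (hM : ∀ ζ : ℂ, ‖ζ‖ ≤ d → |f (z + ζ • v) - f z| ≤ M)
    (hN : ∀ ζ : ℂ, ‖ζ‖ ≤ d → ‖∂ₕ v (∂ₐ v fun y => (f y : ℂ)) (z + ζ • v)‖ < N) :
    fderiv ℝ f z v ≤ 2 * (M / d + N * d) := by
  let L : ℂ →L[ℝ] E := (ContinuousLinearMap.toSpanSingleton ℂ v).restrictScalars ℝ
  have hline (ζ : ℂ) : HasFDerivAt (fun ζ : ℂ => z + ζ • v) L ζ := L.hasFDerivAt.const_add z
  have hq (ζ : ℂ) (hζ : ‖ζ‖ ≤ d) : ContDiffAt ℝ 2 (fun ζ : ℂ => f (z + ζ • v)) ζ :=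
    ContDiffAt.comp ζ (hf ζ hζ) (by fun_prop)
  have hΔ (ζ : ℂ) (hζ : ‖ζ‖ ≤ d) :
      |Δ ((fun ζ : ℂ => f (z + ζ • v)) - fun _ : ℂ => f z : ℂ → ℝ) ζ| < 4 * N := by
    have hreal := (hq ζ hζ).laplacian_CLM_comp_left (l := Complex.ofRealCLM)
    simp only [Function.comp_def, Complex.ofRealCLM_apply] at hreal
    rw [(hq ζ hζ).laplacian_sub contDiffAt_const, laplacian_const, Pi.zero_apply, sub_zero,
      ← Real.norm_eq_abs, ← Complex.norm_real, ← hreal,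
      laplacian_comp_complexLine (contDiffAt_ofReal_comp (hf ζ hζ)), norm_smul]
    simpa using hN ζ hζ
  have hgrad := fderiv_one_le_of_abs_laplacian_lt hd
    (fun ζ hζ => (hq ζ hζ).sub contDiffAt_const) hM hΔ
  have hz : z + (0 : ℂ) • v = z := by simp
  have hf0 : HasFDerivAt f (fderiv ℝ f z) (z + (0 : ℂ) • v) :=
    hz.symm ▸ (hz ▸ (hf 0 (by simpa using hd.le)).differentiableAt (by simp)).hasFDerivAt
  have hchain := ((hf0.comp 0 (hline 0)).sub_const (f z)).fderiv
  calc fderiv ℝ f z v = fderiv ℝ ((fun ζ : ℂ => f (z + ζ • v)) - fun _ => f z) 0 1 := by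
        refine Eq.trans ?_ (DFunLike.congr_fun hchain 1).symm
        simp [L]
    _ ≤ 2 * M / d + 4 * N * d / 2 := hgrad
    _ = 2 * (M / d + N * d) := by ring

theorem norm_wirtinger_le_of_wirtinger_wirtinger_lt {d M N : ℝ} (hd : 0 < d)
    (hf : ∀ ζ : ℂ, ‖ζ‖ ≤ d → ContDiffAt ℝ 2 f (z + ζ • v))
    (hM : ∀ ζ : ℂ, ‖ζ‖ ≤ d → |f (z + ζ • v) - f z| ≤ M)
    (hN : ∀ ζ : ℂ, ‖ζ‖ ≤ d → ‖∂ₕ v (∂ₐ v fun y => (f y : ℂ)) (z + ζ • v)‖ < N) :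
    ‖∂ₕ v (fun y => (f y : ℂ)) z‖ ≤ M / d + N * d := by
  have hz : z + (0 : ℂ) • v = z := by simp
  have hf0 : DifferentiableAt ℝ f z :=
    (hz ▸ hf 0 (by simpa using hd.le)).differentiableAt (by simp)
  refine norm_wirtinger_le_of_forall_fderiv_le hf0 fun c hc => ?_
  have hζc {ζ : ℂ} (hζ : ‖ζ‖ ≤ d) : ‖ζ * c‖ ≤ d := by rwa [norm_mul, hc, mul_one]
  have hf' (ζ : ℂ) (hζ : ‖ζ‖ ≤ d) : ContDiffAt ℝ 2 f (z + ζ • c • v) := by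
    simpa only [mul_smul] using hf _ (hζc hζ)
  refine fderiv_le_of_wirtinger_wirtinger_lt hd hf' (fun ζ hζ => ?_) fun ζ hζ => ?_
  · simpa only [mul_smul] using hM _ (hζc hζ)
  · rw [norm_wirtinger_wirtinger_smul (contDiffAt_ofReal_comp (hf' ζ hζ)), hc, one_pow, one_mul]
    simpa only [mul_smul] using hN _ (hζc hζ)

/-- The Hessian may be of size `K`, so the gradient is estimated on the disc of radius `r / √K`. -/
theorem norm_sq_wirtinger_le {r K L B : ℝ} (hr : 0 < r) (hK : 1 ≤ K)
    (hf : ∀ ζ : ℂ, ‖ζ‖ ≤ r → ContDiffAt ℝ 2 f (z + ζ • v))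
    (hL : ∀ ζ : ℂ, ‖ζ‖ ≤ r → |f (z + ζ • v) - f z| ≤ L)
    (hB : ∀ ζ : ℂ, ‖ζ‖ ≤ r → ‖∂ₕ v (∂ₐ v fun y => (f y : ℂ)) (z + ζ • v)‖ < B * K) :
    ‖∂ₕ v (fun y => (f y : ℂ)) z‖ ^ 2 ≤ (L / r + B * r) ^ 2 * K := by
  have hK0 : 0 < K := zero_lt_one.trans_le hK
  have hsqrt : √K ^ 2 = K := Real.sq_sqrt hK0.le
  have hsqrt0 : 0 < √K := Real.sqrt_pos.2 hK0
  have hdr : r / √K ≤ r := div_le_self hr.le (Real.one_le_sqrt.2 hK)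
  have h := norm_wirtinger_le_of_wirtinger_wirtinger_lt (div_pos hr hsqrt0)
    (fun ζ hζ => hf ζ (hζ.trans hdr)) (fun ζ hζ => hL ζ (hζ.trans hdr))
    (fun ζ hζ => hB ζ (hζ.trans hdr))
  calc ‖∂ₕ v (fun y => (f y : ℂ)) z‖ ^ 2
      ≤ (L / (r / √K) + B * K * (r / √K)) ^ 2 := pow_le_pow_left₀ (norm_nonneg _) h 2
    _ = ((L / r + B * r) * √K) ^ 2 := by
        congr 1
        field_simp
        rw [hsqrt]
        ring
    _ = (L / r + B * r) ^ 2 * K := by rw [mul_pow, hsqrt]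

end ComplexLines

section Frames

variable {E F ι : Type*} [NormedAddCommGroup E] [NormedSpace ℂ E] [NormedAddCommGroup F]
  [NormedSpace ℂ F] [Fintype ι] {z : E}

theorem holo_wirtinger_sum_smul (a : ι → ℂ) (v : ι → E) (f : E → F) :
    ∂ₕ (∑ i, a i • v i) f z = ∑ i, a i • ∂ₕ (v i) f z := by
  simp [wirtinger_vec_sum, wirtinger_smul_vec, mul_comm Complex.I]

theorem antiholo_wirtinger_sum_smul (a : ι → ℂ) (v : ι → E) (f : E → F) :
    ∂ₐ (∑ i, a i • v i) f z = ∑ i, conj (a i) • ∂ₐ (v i) f z := by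
  have hconj (b : ℂ) : conj b = b.re - Complex.I * b.im := by
    simp [Complex.ext_iff]
  simp [wirtinger_vec_sum, wirtinger_smul_vec, hconj]

theorem holo_antiholo_wirtinger_sum_smul {f : E → F} (hf : ContDiffAt ℝ 2 f z) (a b : ι → ℂ)
    (v : ι → E) :
    ∂ₕ (∑ i, a i • v i) (∂ₐ (∑ j, b j • v j) f) z =
      ∑ i, ∑ j, (a i * conj (b j)) • ∂ₕ (v i) (∂ₐ (v j) f) z := by
  have hd (j : ι) : DifferentiableAt ℝ (∂ₐ (v j) f) z :=
    (contDiffAt_wirtinger (k := 1) hf (by norm_num)).differentiableAt (by norm_num)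
  have hanti : ∂ₐ (∑ j, b j • v j) f = fun y => ∑ j, conj (b j) • ∂ₐ (v j) f y :=
    funext fun y => antiholo_wirtinger_sum_smul b v f
  rw [holo_wirtinger_sum_smul, hanti]
  refine Finset.sum_congr rfl fun i _ => ?_
  rw [wirtinger_sum _ fun j _ => (hd j).fun_const_smul _, Finset.smul_sum]
  exact Finset.sum_congr rfl fun j _ => by rw [wirtinger_const_smul _ (hd j), mul_smul]

/-- The frame whose `a`-th vector has the components `V a` in the frame `v`. The matrix of a
sesquilinear form changes from `A` to `V * A * Vᴴ`. -/
def changeFrame (V : Matrix ι ι ℂ) (v : ι → E) (a : ι) : E :=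
  ∑ i, V a i • v i

/-- The matrix of the complex Hessian `∂∂̄f` in the frame `v`. -/
def hessianMatrix (v : ι → E) (f : E → ℂ) (z : E) : Matrix ι ι ℂ :=
  Matrix.of fun i j => ∂ₕ (v i) (∂ₐ (v j) f) z

theorem mul_mul_conjTranspose_apply (V A : Matrix ι ι ℂ) (a b : ι) :
    (V * A * Vᴴ) a b = V a ⬝ᵥ A *ᵥ star (V b) := by
  rw [Matrix.mul_assoc]
  rfl

theorem holo_antiholo_wirtinger_eq_dotProduct {f : E → ℂ} (hf : ContDiffAt ℝ 2 f z)
    (a b : ι → ℂ) (v : ι → E) :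
    ∂ₕ (∑ i, a i • v i) (∂ₐ (∑ j, b j • v j) f) z = a ⬝ᵥ hessianMatrix v f z *ᵥ star b := by
  rw [holo_antiholo_wirtinger_sum_smul hf]
  simp only [dotProduct, Matrix.mulVec, hessianMatrix, Matrix.of_apply, Pi.star_apply,
    RCLike.star_def, Finset.mul_sum, smul_eq_mul, mul_assoc, mul_comm (conj (b _))]

theorem hessianMatrix_changeFrame {f : E → ℂ} (hf : ContDiffAt ℝ 2 f z) (V : Matrix ι ι ℂ)
    (v : ι → E) : hessianMatrix (changeFrame V v) f z = V * hessianMatrix v f z * Vᴴ := by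
  ext a b
  rw [mul_mul_conjTranspose_apply]
  exact holo_antiholo_wirtinger_eq_dotProduct hf _ _ v

theorem contDiffAt_hessianMatrix {f : E → ℂ} {k n : WithTop ℕ∞} (hf : ContDiffAt ℝ n f z)
    (hk : k + 2 ≤ n) (v : ι → E) : ContDiffAt ℝ k (hessianMatrix v f) z :=
  contDiffAt_matrix_iff.2 fun i j =>
    contDiffAt_wirtinger (n := k + 1)
      (contDiffAt_wirtinger hf (by rwa [add_assoc, one_add_one_eq_two])) le_rfl

theorem wirtinger_hessianMatrix_symm {f : E → ℂ} (hf : ContDiffAt ℝ 3 f z) (v : ι → E)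
    (i j k : ι) : ∂ₕ (v k) (hessianMatrix v f) z i j = ∂ₕ (v i) (hessianMatrix v f) z k j := by
  have hd : DifferentiableAt ℝ (hessianMatrix v f) z :=
    (contDiffAt_hessianMatrix (k := 1) hf (by norm_num) v).differentiableAt (by norm_num)
  rw [wirtinger_matrix_apply hd, wirtinger_matrix_apply hd]
  exact wirtinger_comm (contDiffAt_wirtinger hf (by norm_num))

theorem IsKahlerAt.add_hessianMatrix {v : ι → E} {G : E → Matrix ι ι ℂ} {f : E → ℂ}
    (hG : IsKahlerAt v G z) (hf : ContDiffAt ℝ 4 f z)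
    (hpos : ∀ᶠ y in 𝓝 z, (G y + hessianMatrix v f y).PosDef) :
    IsKahlerAt v (fun y => G y + hessianMatrix v f y) z where
  contDiffAt := hG.contDiffAt.add (contDiffAt_hessianMatrix hf (by norm_num) v)
  posDef := hpos
  closed := by
    filter_upwards [hG.closed, hG.eventually_differentiableAt, hf.eventually (by simp)]
      with y hclosed hGy hfy i j k
    have hHy : DifferentiableAt ℝ (hessianMatrix v f) y :=
      (contDiffAt_hessianMatrix (k := 2) hfy (by norm_num) v).differentiableAt (by norm_num)
    rw [wirtinger_add hGy hHy, wirtinger_add hGy hHy, Matrix.add_apply, Matrix.add_apply,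
      hclosed i j k, wirtinger_hessianMatrix_symm (hfy.of_le (by norm_num))]

variable [DecidableEq ι] {c : ℂ} {w : E} {G W : E → Matrix ι ι ℂ} {V : Matrix ι ι ℂ}

theorem IsKahlerAt.changeFrame {v : ι → E} (hG : IsKahlerAt v G z) (hV : IsUnit V) :
    IsKahlerAt (changeFrame V v) (fun y => V * G y * Vᴴ) z where
  contDiffAt := (contDiffAt_const.mul hG.contDiffAt).mul contDiffAt_const
  posDef := hG.posDef.mono fun y hy => hy.mul_mul_conjTranspose_same
    (Matrix.vecMul_injective_of_isUnit hV)
  closed := by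
    filter_upwards [hG.closed, hG.eventually_differentiableAt] with y hclosed hGy i j k
    have hswap (l p : ι) (s : ι → ℂ) :
        (∂ₕ (v l) G y *ᵥ s) p = (∂ₕ (v p) G y *ᵥ s) l := by
      simp only [Matrix.mulVec, dotProduct, hclosed p _ l]
    have hentry (a b : ι) : (V * ∂ₕ (_root_.changeFrame V v a) G y * Vᴴ) b j =
        ∑ l, ∑ p, V a l * V b p * (∂ₕ (v l) G y *ᵥ star (V j)) p := by
      rw [mul_mul_conjTranspose_apply, _root_.changeFrame, holo_wirtinger_sum_smul,
        Matrix.sum_mulVec, dotProduct_sum]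
      simp only [Matrix.smul_mulVec _ (∂ₕ _ _ _), dotProduct_smul]
      simp only [dotProduct, smul_eq_mul, Finset.mul_sum, mul_assoc]
    rw [wirtinger_const_mul_mul_const _ _ hGy, wirtinger_const_mul_mul_const _ _ hGy, hentry,
      hentry, Finset.sum_comm]
    exact Finset.sum_congr rfl fun l _ => Finset.sum_congr rfl fun p _ => by
      rw [hswap p l, mul_comm (V k p)]

theorem chernDeriv_mul_mul_conjTranspose (hG : DifferentiableAt ℝ G z)
    (hW : DifferentiableAt ℝ W z) (hV : IsUnit V) :
    chernDeriv c w (fun y => V * G y * Vᴴ) (fun y => V * W y * Vᴴ) z =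
      V * chernDeriv c w G W z * Vᴴ := by
  have hVdet : IsUnit V.det := (Matrix.isUnit_iff_isUnit_det V).1 hV
  have hVHdet : IsUnit Vᴴ.det :=
    (Matrix.isUnit_iff_isUnit_det _).1 ((Matrix.isUnit_conjTranspose V).2 hV)
  rw [chernDeriv, chernDeriv, wirtinger_const_mul_mul_const _ _ hG,
    wirtinger_const_mul_mul_const _ _ hW]
  simp only [Matrix.mul_inv_rev, Matrix.mul_sub, Matrix.sub_mul, Matrix.mul_assoc]
  rw [Matrix.mul_nonsing_inv_cancel_left _ _ hVHdet, Matrix.nonsing_inv_mul_cancel_left _ _ hVdet]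

theorem chernCurvature_mul_mul_conjTranspose (hG : ContDiffAt ℝ 2 G z) (hV : IsUnit V) :
    chernCurvature w (fun y => V * G y * Vᴴ) z = V * chernCurvature w G z * Vᴴ := by
  have hanti : ∂ₐ w (fun y => V * G y * Vᴴ) =ᶠ[𝓝 z] fun y => V * ∂ₐ w G y * Vᴴ := by
    filter_upwards [hG.eventually (by simp)] with y hy
    exact wirtinger_const_mul_mul_const _ _ (hy.differentiableAt (by norm_num))
  have hd : DifferentiableAt ℝ (∂ₐ w G) z :=
    (contDiffAt_wirtinger (k := 1) hG (by norm_num)).differentiableAt (by norm_num)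
  have h := chernDeriv_mul_mul_conjTranspose (c := -Complex.I) (w := w)
    (hG.differentiableAt (by norm_num)) hd hV
  simp only [chernDeriv] at h
  simp only [chernCurvature, chernDeriv, wirtinger_congr hanti, hanti.self_of_nhds, h,
    Matrix.mul_neg, Matrix.neg_mul]

theorem trace_inv_mul_mul_mul_conjTranspose (hV : IsUnit V) (A B : Matrix ι ι ℂ) :
    ((V * A * Vᴴ)⁻¹ * (V * B * Vᴴ)).trace = (A⁻¹ * B).trace := by
  have hVdet : IsUnit V.det := (Matrix.isUnit_iff_isUnit_det V).1 hV
  have hVHdet : IsUnit Vᴴ.det :=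
    (Matrix.isUnit_iff_isUnit_det _).1 ((Matrix.isUnit_conjTranspose V).2 hV)
  simp only [Matrix.mul_inv_rev, Matrix.mul_assoc]
  rw [Matrix.nonsing_inv_mul_cancel_left _ _ hVdet, Matrix.trace_mul_comm, Matrix.mul_assoc,
    Matrix.mul_assoc, Matrix.mul_nonsing_inv _ hVHdet, Matrix.mul_one]

end Frames

section HolomorphicMaps

variable {E E' F : Type*} [NormedAddCommGroup E] [NormedSpace ℂ E] [NormedAddCommGroup E']
  [NormedSpace ℂ E'] [NormedAddCommGroup F] [NormedSpace ℂ F] {τ : E → E'} {f : E' → F}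
  {v w z : E}

theorem fderiv_comp_holomorphic (hf : DifferentiableAt ℝ f (τ z)) (hτ : DifferentiableAt ℂ τ z) :
    fderiv ℝ (fun y => f (τ y)) z v = fderiv ℝ f (τ z) (fderiv ℂ τ z v) :=
  DFunLike.congr_fun (hf.hasFDerivAt.comp z (hτ.hasFDerivAt.restrictScalars ℝ)).fderiv v

theorem fderiv_fderiv_comp_holomorphic (hf : ContDiffAt ℝ 2 f (τ z)) (hτ : ContDiffAt ℂ 2 τ z) :
    fderiv ℝ (fderiv ℝ fun y => f (τ y)) z v w =
      fderiv ℝ (fderiv ℝ f) (τ z) (fderiv ℂ τ z v) (fderiv ℂ τ z w) +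
        fderiv ℝ f (τ z) (fderiv ℂ (fderiv ℂ τ) z v w) := by
  have hτd : DifferentiableAt ℂ τ z := hτ.differentiableAt (by norm_num)
  have hτ' : DifferentiableAt ℂ (fderiv ℂ τ) z :=
    (hτ.fderiv_right (m := 1) (by norm_num)).differentiableAt (by norm_num)
  have hf' : DifferentiableAt ℝ (fderiv ℝ f) (τ z) :=
    (hf.fderiv_right (m := 1) (by norm_num)).differentiableAt (by norm_num)
  have hfτ : ContDiffAt ℝ 2 (fun y => f (τ y)) z := hf.comp z (hτ.restrict_scalars ℝ)
  have hfτ' : DifferentiableAt ℝ (fderiv ℝ fun y => f (τ y)) z :=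
    (hfτ.fderiv_right (m := 1) (by norm_num)).differentiableAt (by norm_num)
  have hfst : (fun y => fderiv ℝ (fun y => f (τ y)) y w) =ᶠ[𝓝 z]
      fun y => fderiv ℝ f (τ y) (fderiv ℂ τ y w) := by
    filter_upwards [hτ.eventually (by simp), hτ.continuousAt.eventually (hf.eventually (by simp))]
      with y hτy hfy
    exact fderiv_comp_holomorphic (hfy.differentiableAt (by norm_num))
      (hτy.differentiableAt (by norm_num))
  have hsnd : HasFDerivAt (fun y => fderiv ℂ τ y w)
      (((fderiv ℂ (fderiv ℂ τ) z).flip w).restrictScalars ℝ) z := by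
    simpa using (hτ'.hasFDerivAt.clm_apply (hasFDerivAt_const w z)).restrictScalars ℝ
  have h := ((hf'.hasFDerivAt.comp z (hτd.hasFDerivAt.restrictScalars ℝ)).clm_apply hsnd).fderiv
  have hlhs := (hfτ'.hasFDerivAt.clm_apply (hasFDerivAt_const w z)).fderiv
  rw [Filter.EventuallyEq.fderiv_eq hfst] at hlhs
  simpa [add_comm] using DFunLike.congr_fun (hlhs.symm.trans h) v

-- The terms with `D²τ` cancel, since `D²τ` is complex bilinear.
theorem holo_antiholo_wirtinger_comp_holomorphic (hf : ContDiffAt ℝ 2 f (τ z))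
    (hτ : ContDiffAt ℂ 2 τ z) :
    ∂ₕ v (∂ₐ w fun y => f (τ y)) z =
      ∂ₕ (fderiv ℂ τ z v) (∂ₐ (fderiv ℂ τ z w) f) (τ z) := by
  have hfτ : ContDiffAt ℝ 2 (fun y => f (τ y)) z := hf.comp z (hτ.restrict_scalars ℝ)
  rw [wirtinger_wirtinger hfτ, wirtinger_wirtinger hf]
  simp only [fderiv_fderiv_comp_holomorphic hf hτ, map_smul, _root_.smul_apply, smul_add,
    smul_smul, Complex.I_mul_I, neg_smul, one_smul, map_neg, smul_neg, neg_mul, neg_neg]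
  module

end HolomorphicMaps

section Charts

variable {m : ℕ}

/-- The standard frame of `ℂ^m`, along which the coordinate Wirtinger derivatives are taken. -/
def stdFrame (i : Fin m) : CSpace m :=
  EuclideanSpace.single i 1

theorem single_I_eq_smul_stdFrame (i : Fin m) :
    (EuclideanSpace.single i Complex.I : CSpace m) = Complex.I • stdFrame i := by
  ext j
  simp [stdFrame]

theorem dz_eq_wirtinger (i : Fin m) : dz i = ∂ₕ (stdFrame i) := by
  funext f z
  simp only [dz, wirtinger, single_I_eq_smul_stdFrame, stdFrame, smul_eq_mul]
  ring

theorem dzbar_eq_wirtinger (i : Fin m) : dzbar i = ∂ₐ (stdFrame i) := by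
  funext f z
  simp only [dzbar, wirtinger, single_I_eq_smul_stdFrame, stdFrame, smul_eq_mul]
  ring

theorem sum_smul_stdFrame (v : CSpace m) : ∑ i, v i • stdFrame i = v := by
  ext j
  simp [stdFrame, Pi.single_apply]

/-- The matrix whose `i`-th row holds the components of the image of the `i`-th standard vector
under the complex derivative of `τ`, i.e. the transpose of the Jacobian: the matrix of a
sesquilinear form pulls back from `A` to `J * A * Jᴴ`. -/
def pushforwardMatrix (τ : CSpace m → CSpace m) (z : CSpace m) : Matrix (Fin m) (Fin m) ℂ :=
  Matrix.of fun i => fderiv ℂ τ z (stdFrame i)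

theorem hessianMatrix_comp_holomorphic {τ : CSpace m → CSpace m} {f : CSpace m → ℂ}
    {z : CSpace m} (hf : ContDiffAt ℝ 2 f (τ z)) (hτ : ContDiffAt ℂ 2 τ z) :
    hessianMatrix stdFrame (fun y => f (τ y)) z =
      pushforwardMatrix τ z * hessianMatrix stdFrame f (τ z) * (pushforwardMatrix τ z)ᴴ := by
  ext i j
  rw [mul_mul_conjTranspose_apply, ← holo_antiholo_wirtinger_eq_dotProduct hf]
  simp only [pushforwardMatrix, Matrix.of_apply, sum_smul_stdFrame]
  exact holo_antiholo_wirtinger_comp_holomorphic hf hτ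

variable {M : Type*} [TopologicalSpace M] {e e' : OpenPartialHomeomorph M (CSpace m)}
  {z : CSpace m}

theorem complexHessian_eq_hessianMatrix (u : M → ℝ) :
    complexHessian e u = hessianMatrix stdFrame fun y => (u (e.symm y) : ℂ) := by
  funext z
  simp only [complexHessian, hessianMatrix, dz_eq_wirtinger, dzbar_eq_wirtinger]

theorem comp_symm_eventuallyEq (u : M → ℝ) (hz : z ∈ e.target) (hz' : e.symm z ∈ e'.source) :
    (fun y => u (e.symm y)) =ᶠ[𝓝 z] fun y => u (e'.symm (e' (e.symm y))) := by
  filter_upwards [(e.continuousAt_symm hz).eventually (e'.open_source.mem_nhds hz')] with y hy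
  rw [e'.left_inv hy]

variable [ChartedSpace (CSpace m) M]
  {h : ∀ x : M, TangentSpace 𝓘(ℂ, CSpace m) x →ₗ[ℂ] TangentSpace 𝓘(ℂ, CSpace m) x →ₗ⋆[ℂ] ℂ}

/-- The derivative of an inverse chart, with the tangent spaces of `M` read as `ℂ^m`. -/
def chartDeriv (e : OpenPartialHomeomorph M (CSpace m)) (z : CSpace m) :
    CSpace m →L[ℂ] CSpace m :=
  mfderiv 𝓘(ℂ, CSpace m) 𝓘(ℂ, CSpace m) e.symm z

/-- The value at `x` of a field of sesquilinear forms, with the tangent space read as `ℂ^m`. -/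
def formAt
    (h : ∀ x : M, TangentSpace 𝓘(ℂ, CSpace m) x →ₗ[ℂ] TangentSpace 𝓘(ℂ, CSpace m) x →ₗ⋆[ℂ] ℂ)
    (x : M) : CSpace m →ₗ[ℂ] CSpace m →ₗ⋆[ℂ] ℂ :=
  h x

theorem formMatrix_apply (i j : Fin m) :
    formMatrix h e z i j =
      formAt h (e.symm z) (chartDeriv e z (stdFrame i)) (chartDeriv e z (stdFrame j)) :=
  rfl

theorem formAt_chartDeriv (v w : CSpace m) :
    formAt h (e.symm z) (chartDeriv e z v) (chartDeriv e z w) =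
      v.ofLp ⬝ᵥ formMatrix h e z *ᵥ star w.ofLp := by
  conv_lhs => rw [← sum_smul_stdFrame v, ← sum_smul_stdFrame w]
  simp only [map_sum, LinearMap.sum_apply, map_smul, map_smulₛₗ, LinearMap.smul_apply, smul_eq_mul,
    ← formMatrix_apply, dotProduct, Matrix.mulVec, Pi.star_apply, RCLike.star_def, Finset.mul_sum]
  rw [Finset.sum_comm]
  exact Finset.sum_congr rfl fun i _ => Finset.sum_congr rfl fun j _ => by ring

theorem contDiffAt_comp_symm_chartAt {u : M → ℝ} {k : WithTop ℕ∞}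
    (hu : ContMDiff 𝓘(ℝ, CSpace m) 𝓘(ℝ) k u) (x : M) :
    ContDiffAt ℝ k (fun y => u ((chartAt (CSpace m) x).symm y)) (chartAt (CSpace m) x x) := by
  simpa [Function.comp_def, contDiffWithinAt_univ, chartAt_self_eq]
    using (contMDiffAt_iff.1 (hu x)).2

variable [IsManifold 𝓘(ℂ, CSpace m) ω M]

theorem contDiffAt_transition (he : e ∈ atlas (CSpace m) M) (he' : e' ∈ atlas (CSpace m) M)
    (hz : z ∈ e.target) (hz' : e.symm z ∈ e'.source) :
    ContDiffAt ℂ ω (fun y => e' (e.symm y)) z :=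
  ((contMDiffAt_of_mem_maximalAtlas (IsManifold.subset_maximalAtlas he') hz').comp z
    (contMDiffAt_symm_of_mem_maximalAtlas (IsManifold.subset_maximalAtlas he) hz)).contDiffAt

theorem chartDeriv_transition (he : e ∈ atlas (CSpace m) M) (he' : e' ∈ atlas (CSpace m) M)
    (hz : z ∈ e.target) (hz' : e.symm z ∈ e'.source) :
    chartDeriv e z = (chartDeriv e' (e' (e.symm z))).comp
      (fderiv ℂ (fun y => e' (e.symm y)) z) := by
  have hτ : DifferentiableAt ℂ (fun y => e' (e.symm y)) z :=
    (contDiffAt_transition he he' hz hz').differentiableAt (by simp)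
  have he'symm : MDifferentiableAt 𝓘(ℂ, CSpace m) 𝓘(ℂ, CSpace m) e'.symm (e' (e.symm z)) :=
    mdifferentiableAt_atlas_symm he' (e'.map_source hz')
  have hcomp : e.symm =ᶠ[𝓝 z] e'.symm ∘ fun y => e' (e.symm y) := by
    filter_upwards [(e.continuousAt_symm hz).eventually (e'.open_source.mem_nhds hz')] with y hy
    exact (e'.left_inv hy).symm
  have hchain := mfderiv_comp z he'symm hτ.mdifferentiableAt
  rw [mfderiv_eq_fderiv] at hchain
  exact hcomp.mfderiv_eq.trans hchain

theorem formMatrix_transition (he : e ∈ atlas (CSpace m) M) (he' : e' ∈ atlas (CSpace m) M)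
    (hz : z ∈ e.target) (hz' : e.symm z ∈ e'.source) :
    formMatrix h e z = pushforwardMatrix (fun y => e' (e.symm y)) z *
      formMatrix h e' (e' (e.symm z)) * (pushforwardMatrix (fun y => e' (e.symm y)) z)ᴴ := by
  ext i j
  rw [formMatrix_apply, chartDeriv_transition he he' hz hz', mul_mul_conjTranspose_apply,
    ContinuousLinearMap.comp_apply, ContinuousLinearMap.comp_apply]
  have hform := formAt_chartDeriv (h := h) (e := e') (z := e' (e.symm z))
    (fderiv ℂ (fun y => e' (e.symm y)) z (stdFrame i))
    (fderiv ℂ (fun y => e' (e.symm y)) z (stdFrame j))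
  rwa [e'.left_inv hz'] at hform

theorem contDiffAt_comp_symm_transition {u : M → ℝ} {k : WithTop ℕ∞}
    (he : e ∈ atlas (CSpace m) M) (he' : e' ∈ atlas (CSpace m) M)
    (hz : z ∈ e.target) (hz' : e.symm z ∈ e'.source)
    (hu : ContDiffAt ℝ k (fun y => u (e'.symm y)) (e' (e.symm z))) :
    ContDiffAt ℝ k (fun y => u (e.symm y)) z := by
  have hτ : ContDiffAt ℝ k (fun y => e' (e.symm y)) z :=
    ((contDiffAt_transition he he' hz hz').restrict_scalars ℝ).of_le le_top
  exact (ContDiffAt.comp (g := fun y => u (e'.symm y)) z hu hτ).congr_of_eventuallyEq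
    (comp_symm_eventuallyEq u hz hz')

theorem contDiffAt_comp_symm {u : M → ℝ} {k : WithTop ℕ∞}
    (hu : ContMDiff 𝓘(ℝ, CSpace m) 𝓘(ℝ) k u) (he : e ∈ atlas (CSpace m) M) (hz : z ∈ e.target) :
    ContDiffAt ℝ k (fun y => u (e.symm y)) z :=
  contDiffAt_comp_symm_transition he (chart_mem_atlas (CSpace m) (e.symm z)) hz
    (mem_chart_source (CSpace m) (e.symm z)) (contDiffAt_comp_symm_chartAt hu _)

theorem complexHessian_transition {u : M → ℝ} (he : e ∈ atlas (CSpace m) M)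
    (he' : e' ∈ atlas (CSpace m) M) (hz : z ∈ e.target) (hz' : e.symm z ∈ e'.source)
    (hu : ContDiffAt ℝ 2 (fun y => u (e'.symm y)) (e' (e.symm z))) :
    complexHessian e u z = pushforwardMatrix (fun y => e' (e.symm y)) z *
      complexHessian e' u (e' (e.symm z)) * (pushforwardMatrix (fun y => e' (e.symm y)) z)ᴴ := by
  have hcomp : (fun y => (u (e.symm y) : ℂ)) =ᶠ[𝓝 z]
      fun y => (u (e'.symm (e' (e.symm y))) : ℂ) :=
    (comp_symm_eventuallyEq u hz hz').fun_comp Complex.ofReal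
  rw [complexHessian_eq_hessianMatrix, complexHessian_eq_hessianMatrix,
    ← hessianMatrix_comp_holomorphic (contDiffAt_ofReal_comp hu)
      ((contDiffAt_transition he he' hz hz').of_le le_top)]
  ext i j
  refine wirtinger_congr ?_
  filter_upwards [hcomp.eventuallyEq_nhds] with y hy
  exact wirtinger_congr hy

end Charts

section HermitianForms

variable {ι : Type*} [Fintype ι]

theorem dotProduct_mulVec_star_vecMul (V A : Matrix ι ι ℂ) (w : ι → ℂ) :
    (w ᵥ* V) ⬝ᵥ A *ᵥ star (w ᵥ* V) = w ⬝ᵥ (V * A * Vᴴ) *ᵥ star w := by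
  rw [Matrix.star_vecMul, ← Matrix.dotProduct_mulVec, Matrix.mulVec_mulVec, Matrix.mulVec_mulVec,
    Matrix.mul_assoc]

theorem re_dotProduct_mulVec_star_nonneg {W : Matrix ι ι ℂ} (hW : W.PosDef) (v : ι → ℂ) :
    0 ≤ (v ⬝ᵥ W *ᵥ star v).re := by
  simpa using hW.posSemidef.re_dotProduct_nonneg (star v)

variable [DecidableEq ι]

theorem dotProduct_diagonal_mulVec_star (μ : ι → ℝ) (w : ι → ℂ) :
    w ⬝ᵥ (Matrix.diagonal fun i => (μ i : ℂ)) *ᵥ star w = (∑ i, μ i * ‖w i‖ ^ 2 : ℝ) := by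
  simp only [dotProduct, Matrix.mulVec_diagonal, Pi.star_apply, RCLike.star_def]
  push_cast
  exact Finset.sum_congr rfl fun i _ => by
    rw [mul_left_comm, Complex.mul_conj, Complex.normSq_eq_norm_sq, Complex.ofReal_pow]

variable {G W V : Matrix ι ι ℂ}

theorem isUnit_of_mul_mul_conjTranspose_eq_one (h : V * G * Vᴴ = 1) : IsUnit V :=
  IsUnit.of_mul_eq_one (G * Vᴴ) (by rw [← Matrix.mul_assoc, h])

theorem exists_unitary_mul_mul_conjTranspose_eq_diagonal (hG : G.PosDef) :
    ∃ (U : Matrix ι ι ℂ) (μ : ι → ℝ), (∀ i, 0 < μ i) ∧ U * Uᴴ = 1 ∧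
      U * G * Uᴴ = Matrix.diagonal fun i => (μ i : ℂ) := by
  refine ⟨star (hG.1.eigenvectorUnitary : Matrix ι ι ℂ), hG.1.eigenvalues, hG.eigenvalues_pos,
    ?_, ?_⟩
  · rw [← Matrix.star_eq_conjTranspose, star_star]
    exact Unitary.coe_star_mul_self _
  · have h := hG.1.conjStarAlgAut_star_eigenvectorUnitary
    rwa [Unitary.conjStarAlgAut_apply] at h

theorem exists_mul_mul_conjTranspose_eq_one (hG : G.PosDef) :
    ∃ V : Matrix ι ι ℂ, V * G * Vᴴ = 1 := by
  obtain ⟨U, ν, hν, -, hUG⟩ := exists_unitary_mul_mul_conjTranspose_eq_diagonal hG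
  set S : Matrix ι ι ℂ := Matrix.diagonal fun i => (((√(ν i))⁻¹ : ℝ) : ℂ)
  have hS : Sᴴ = S := by
    rw [Matrix.diagonal_conjTranspose]
    exact congrArg _ (funext fun i => Complex.conj_ofReal _)
  have hscale (i : ι) : (√(ν i))⁻¹ * ν i * (√(ν i))⁻¹ = 1 := by
    have hpos : √(ν i) ≠ 0 := (Real.sqrt_pos.2 (hν i)).ne'
    field_simp
    exact (Real.sq_sqrt (hν i).le).symm
  refine ⟨S * U, ?_⟩
  calc S * U * G * (S * U)ᴴ = S * (U * G * Uᴴ) * S := by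
        rw [Matrix.conjTranspose_mul, hS]
        simp only [Matrix.mul_assoc]
    _ = 1 := by
        rw [hUG, Matrix.diagonal_mul_diagonal, Matrix.diagonal_mul_diagonal,
          ← Matrix.diagonal_one]
        exact congrArg _ (funext fun i => by exact_mod_cast hscale i)

theorem exists_simultaneous_diagonalization (hG : G.PosDef) (hW : W.PosDef) :
    ∃ (V : Matrix ι ι ℂ) (μ : ι → ℝ), (∀ i, 0 < μ i) ∧ V * G * Vᴴ = 1 ∧
      V * W * Vᴴ = Matrix.diagonal fun i => (μ i : ℂ) := by
  obtain ⟨V, hV⟩ := exists_mul_mul_conjTranspose_eq_one hG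
  have hVW : (V * W * Vᴴ).PosDef := hW.mul_mul_conjTranspose_same
    (Matrix.vecMul_injective_of_isUnit (isUnit_of_mul_mul_conjTranspose_eq_one hV))
  obtain ⟨U, μ, hμ, hU, hUW⟩ := exists_unitary_mul_mul_conjTranspose_eq_diagonal hVW
  have hassoc (X : Matrix ι ι ℂ) : U * V * X * (U * V)ᴴ = U * (V * X * Vᴴ) * Uᴴ := by
    rw [Matrix.conjTranspose_mul]
    simp only [Matrix.mul_assoc]
  exact ⟨U * V, μ, hμ, by rw [hassoc, hV, Matrix.mul_one, hU], by rw [hassoc, hUW]⟩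

theorem trace_inv_mul_of_diagonalization {μ : ι → ℝ} (hG : V * G * Vᴴ = 1)
    (hW : V * W * Vᴴ = Matrix.diagonal fun i => (μ i : ℂ)) :
    (G⁻¹ * W).trace = (∑ i, μ i : ℝ) := by
  rw [← trace_inv_mul_mul_mul_conjTranspose (isUnit_of_mul_mul_conjTranspose_eq_one hG), hG, hW,
    inv_one, Matrix.one_mul, Matrix.trace_diagonal, Complex.ofReal_sum]

theorem re_dotProduct_mulVec_star_le_trace_mul (hG : G.PosDef) (hW : W.PosDef) (v : ι → ℂ) :
    (v ⬝ᵥ W *ᵥ star v).re ≤ (G⁻¹ * W).trace.re * (v ⬝ᵥ G *ᵥ star v).re := by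
  obtain ⟨V, μ, hμ, hVG, hVW⟩ := exists_simultaneous_diagonalization hG hW
  have hdet : IsUnit V.det := (Matrix.isUnit_iff_isUnit_det _).1
    (isUnit_of_mul_mul_conjTranspose_eq_one hVG)
  obtain ⟨w, rfl⟩ : ∃ w, v = w ᵥ* V := ⟨v ᵥ* V⁻¹, by
    rw [Matrix.vecMul_vecMul, Matrix.nonsing_inv_mul _ hdet, Matrix.vecMul_one]⟩
  have hone : (1 : Matrix ι ι ℂ) = Matrix.diagonal fun _ => ((1 : ℝ) : ℂ) := by simp
  rw [dotProduct_mulVec_star_vecMul, dotProduct_mulVec_star_vecMul,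
    trace_inv_mul_of_diagonalization hVG hVW, hVG, hVW, hone, dotProduct_diagonal_mulVec_star,
    dotProduct_diagonal_mulVec_star, Complex.ofReal_re, Complex.ofReal_re, Complex.ofReal_re,
    Finset.mul_sum]
  refine Finset.sum_le_sum fun i _ => ?_
  rw [one_mul]
  gcongr
  exact Finset.single_le_sum (fun j _ => (hμ j).le) (Finset.mem_univ i)

theorem trace_inv_mul_im (hG : G.IsHermitian) (hW : W.IsHermitian) :
    (G⁻¹ * W).trace.im = 0 := by
  have hstar : star (G⁻¹ * W).trace = (G⁻¹ * W).trace := by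
    rw [← Matrix.trace_conjTranspose, Matrix.conjTranspose_mul, hW.eq, hG.inv.eq,
      Matrix.trace_mul_comm]
  exact Complex.conj_eq_iff_im.1 hstar

end HermitianForms

section KahlerMetrics

theorem chernCurvature_sum_smul {E ι κ : Type*} [NormedAddCommGroup E] [NormedSpace ℂ E]
    [Fintype ι] [Fintype κ] [DecidableEq κ] {G : E → Matrix κ κ ℂ} {z : E}
    (hG : ContDiffAt ℝ 2 G z) (a : ι → ℂ) (v : ι → E) :
    chernCurvature (∑ k, a k • v k) G z = ∑ k, ∑ l, (a k * conj (a l)) •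
      (∂ₕ (v k) G z * (G z)⁻¹ * ∂ₐ (v l) G z - ∂ₕ (v k) (∂ₐ (v l) G) z) := by
  simp only [chernCurvature, chernDeriv, neg_sub, smul_sub, Finset.sum_sub_distrib]
  rw [holo_antiholo_wirtinger_sum_smul hG, holo_wirtinger_sum_smul, antiholo_wirtinger_sum_smul]
  simp only [Matrix.sum_mul, Matrix.mul_sum, Matrix.smul_mul, Matrix.mul_smul, Finset.smul_sum,
    smul_smul]
  rw [Finset.sum_comm]
  simp only [mul_comm (a _)]

variable {m : ℕ} {M : Type*} [TopologicalSpace M] [ChartedSpace (CSpace m) M]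
  {e : OpenPartialHomeomorph M (CSpace m)} {z : CSpace m}

namespace KahlerMetric

variable (g : KahlerMetric m M)

theorem isHermitian_matrix (e : OpenPartialHomeomorph M (CSpace m)) (z : CSpace m) :
    (g.matrix e z).IsHermitian :=
  Matrix.IsHermitian.ext fun _ _ => g.conj_symm _ _ _

theorem contDiffAt_matrix (he : e ∈ atlas (CSpace m) M) (hz : z ∈ e.target) :
    ContDiffAt ℝ ∞ (g.matrix e) z :=
  contDiffAt_matrix_iff.2 fun i j =>
    (g.smooth e he i j).contDiffAt (e.open_target.mem_nhds hz)

theorem curvature_eq (hG : ContDiffAt ℝ 2 (g.matrix e) z) (i j k l : Fin m) :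
    g.curvature e z i j k l = (∂ₕ (stdFrame k) (g.matrix e) z * (g.matrix e z)⁻¹ *
      ∂ₐ (stdFrame l) (g.matrix e) z - ∂ₕ (stdFrame k) (∂ₐ (stdFrame l) (g.matrix e)) z) i j := by
  have hd : ∀ᶠ y in 𝓝 z, DifferentiableAt ℝ (g.matrix e) y :=
    (hG.eventually (by simp)).mono fun y hy => hy.differentiableAt (by norm_num)
  have hd' : DifferentiableAt ℝ (∂ₐ (stdFrame l) (g.matrix e)) z :=
    (contDiffAt_wirtinger (k := 1) hG (by norm_num)).differentiableAt (by norm_num)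
  have hanti : (∂ₐ (stdFrame l) fun y => g.matrix e y i j) =ᶠ[𝓝 z]
      fun y => ∂ₐ (stdFrame l) (g.matrix e) y i j :=
    hd.mono fun y hy => (wirtinger_matrix_apply hy i j).symm
  rw [curvature, dz_eq_wirtinger, dzbar_eq_wirtinger, wirtinger_congr hanti,
    ← wirtinger_matrix_apply hd']
  simp only [← wirtinger_matrix_apply hd.self_of_nhds, Matrix.sub_apply, Matrix.mul_apply,
    Finset.sum_mul]
  rw [neg_add_eq_sub]
  congr 1
  exact Finset.sum_congr rfl fun p _ => Finset.sum_congr rfl fun q _ => by ring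

theorem NonnegOrthogonalBisectional.re_chernCurvature_nonneg {g : KahlerMetric m M}
    (hg : g.NonnegOrthogonalBisectional) (he : e ∈ atlas (CSpace m) M) (hz : z ∈ e.target)
    {V : Matrix (Fin m) (Fin m) ℂ} (hV : V * g.matrix e z * Vᴴ = 1) {a b : Fin m} (hab : a ≠ b) :
    0 ≤ (chernCurvature (changeFrame V stdFrame b) (fun y => V * g.matrix e y * Vᴴ) z a a).re := by
  have hG : ContDiffAt ℝ 2 (g.matrix e) z := (g.contDiffAt_matrix he hz).of_le (by norm_cast)
  have hunitary (a b : Fin m) :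
      ∑ i, ∑ j, g.matrix e z i j * V a i * conj (V b j) = if a = b then 1 else 0 := by
    rw [← Matrix.one_apply, ← hV, mul_mul_conjTranspose_apply]
    simp only [dotProduct, Matrix.mulVec, Finset.mul_sum, Pi.star_apply, RCLike.star_def]
    exact Finset.sum_congr rfl fun i _ => Finset.sum_congr rfl fun j _ => by ring
  have hcurv := hg e he z hz V hunitary a b hab
  rw [chernCurvature_mul_mul_conjTranspose hG (isUnit_of_mul_mul_conjTranspose_eq_one hV),
    changeFrame, chernCurvature_sum_smul hG, mul_mul_conjTranspose_apply]
  convert hcurv using 2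
  simp only [dotProduct, Matrix.mulVec, Finset.mul_sum, Finset.sum_mul, Pi.star_apply,
    RCLike.star_def, Matrix.sum_apply, Matrix.smul_apply, ← g.curvature_eq hG, smul_eq_mul]
  exact Finset.sum_congr rfl fun i _ => Finset.sum_congr rfl fun j _ =>
    Finset.sum_congr rfl fun k _ => Finset.sum_congr rfl fun l _ => by ring

variable [IsManifold 𝓘(ℂ, CSpace m) ω M]

theorem posDef_matrix (he : e ∈ atlas (CSpace m) M) (hz : z ∈ e.target) :
    (g.matrix e z).PosDef := by
  refine .of_dotProduct_mulVec_pos (g.isHermitian_matrix e z) fun ξ hξ => ?_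
  have hinj : Function.Injective (chartDeriv e z) :=
    (mdifferentiable_of_mem_atlas (I := 𝓘(ℂ, CSpace m)) he).symm.mfderiv_injective hz
  have hne : chartDeriv e z (WithLp.toLp 2 (star ξ)) ≠ 0 := by
    rw [Ne, map_eq_zero_iff _ hinj, WithLp.toLp_eq_zero, star_eq_zero]
    exact hξ
  have hform := formAt_chartDeriv (h := g.form) (e := e) (z := z) (WithLp.toLp 2 (star ξ))
    (WithLp.toLp 2 (star ξ))
  rw [star_star] at hform
  change 0 < star ξ ⬝ᵥ formMatrix g.form e z *ᵥ ξ
  rw [← hform, Complex.lt_def]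
  exact ⟨g.pos _ _ hne, (Complex.conj_eq_iff_im.1 (g.conj_symm _ _ _)).symm⟩

theorem isKahlerAt_matrix (he : e ∈ atlas (CSpace m) M) (hz : z ∈ e.target) :
    IsKahlerAt stdFrame (g.matrix e) z where
  contDiffAt := (g.contDiffAt_matrix he hz).of_le (by norm_cast)
  posDef := by
    filter_upwards [e.open_target.mem_nhds hz] with y hy
    exact g.posDef_matrix he hy
  closed := by
    filter_upwards [e.open_target.mem_nhds hz] with y hy i j k
    have hd : DifferentiableAt ℝ (g.matrix e) y :=
      (g.contDiffAt_matrix he hy).differentiableAt (by simp)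
    rw [wirtinger_matrix_apply hd, wirtinger_matrix_apply hd, ← dz_eq_wirtinger,
      ← dz_eq_wirtinger]
    exact g.closed e he y hy i j k

theorem laplacian_eq {u : M → ℝ} (he : e ∈ atlas (CSpace m) M) (hz : z ∈ e.target)
    (hu : ContDiffAt ℝ 2 (fun y => u (e.symm y)) z) :
    g.laplacian u (e.symm z) = ((g.matrix e z)⁻¹ * complexHessian e u z).trace.re := by
  set x := e.symm z with hx
  set e' := chartAt (CSpace m) x
  have he' : e' ∈ atlas (CSpace m) M := chart_mem_atlas (CSpace m) x
  have hxe' : x ∈ e'.source := mem_chart_source (CSpace m) x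
  have hu' : ContDiffAt ℝ 2 (fun y => u (e'.symm y)) (e' x) := by
    refine contDiffAt_comp_symm_transition he' he (e'.map_source hxe') ?_ ?_
    · rw [e'.left_inv hxe']
      exact e.map_target hz
    · rwa [e'.left_inv hxe', hx, e.right_inv hz]
  set J := pushforwardMatrix (fun y => e' (e.symm y)) z
  have hG : g.matrix e z = J * g.matrix e' (e' x) * Jᴴ := formMatrix_transition he he' hz hxe'
  have hJ : IsUnit J := by
    have hdet : (g.matrix e z).det ≠ 0 := (g.posDef_matrix he hz).det_pos.ne'
    rw [hG, Matrix.det_mul, Matrix.det_mul] at hdet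
    exact (Matrix.isUnit_iff_isUnit_det J).2
      (isUnit_iff_ne_zero.2 (left_ne_zero_of_mul (left_ne_zero_of_mul hdet)))
  rw [hG, complexHessian_transition he he' hz hxe' hu', trace_inv_mul_mul_mul_conjTranspose hJ]
  rfl

variable {f φ : M → ℝ}

theorem isKahlerAt_potential (hφ : ContMDiff 𝓘(ℝ, CSpace m) 𝓘(ℝ) 4 φ)
    (hpos : g.PosDefPotential φ) (he : e ∈ atlas (CSpace m) M) (hz : z ∈ e.target) :
    IsKahlerAt stdFrame (fun y => g.matrix e y + complexHessian e φ y) z := by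
  rw [complexHessian_eq_hessianMatrix]
  refine (g.isKahlerAt_matrix he hz).add_hessianMatrix
    (contDiffAt_ofReal_comp (contDiffAt_comp_symm hφ he hz)) ?_
  filter_upwards [e.open_target.mem_nhds hz] with y hy
  rw [← complexHessian_eq_hessianMatrix]
  exact hpos e he y hy

theorem trace_inv_mul_potential (hφ : ContMDiff 𝓘(ℝ, CSpace m) 𝓘(ℝ) 4 φ)
    (hpos : g.PosDefPotential φ) (he : e ∈ atlas (CSpace m) M) (hz : z ∈ e.target) :
    ((g.matrix e z)⁻¹ * (g.matrix e z + complexHessian e φ z)).trace =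
      (m + g.laplacian φ (e.symm z) : ℝ) := by
  have hG := g.posDef_matrix he hz
  have hdet : IsUnit (g.matrix e z).det := isUnit_iff_ne_zero.2 hG.det_pos.ne'
  have htrace : ((g.matrix e z)⁻¹ * (g.matrix e z + complexHessian e φ z)).trace =
      m + ((g.matrix e z)⁻¹ * complexHessian e φ z).trace := by
    rw [Matrix.mul_add, Matrix.nonsing_inv_mul _ hdet, Matrix.trace_add, Matrix.trace_one,
      Fintype.card_fin]
  refine Complex.ext ?_ (trace_inv_mul_im hG.1 (hpos e he z hz).1)
  rw [htrace, g.laplacian_eq he hz ((contDiffAt_comp_symm hφ he hz).of_le (by norm_num))]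
  simp

theorem contDiffAt_laplacian (hφ : ContMDiff 𝓘(ℝ, CSpace m) 𝓘(ℝ) 4 φ)
    (hpos : g.PosDefPotential φ) (he : e ∈ atlas (CSpace m) M) (hz : z ∈ e.target) :
    ContDiffAt ℝ 2 (fun y => m + g.laplacian φ (e.symm y)) z := by
  have hG := g.isKahlerAt_matrix he hz
  have htrace := contDiffAt_trace ((contDiffAt_matrix_inv hG.contDiffAt hG.isUnit).mul
    (g.isKahlerAt_potential hφ hpos he hz).contDiffAt)
  refine (Complex.reCLM.contDiff.contDiffAt.comp z htrace).congr_of_eventuallyEq ?_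
  filter_upwards [e.open_target.mem_nhds hz] with y hy
  rw [Function.comp_apply, g.trace_inv_mul_potential hφ hpos he hy, Complex.reCLM_apply,
    Complex.ofReal_re]

theorem contDiffAt_density (hφ : ContMDiff 𝓘(ℝ, CSpace m) 𝓘(ℝ) 4 φ)
    (hMA : g.SolvesMongeAmpere f φ) (hpos : g.PosDefPotential φ)
    (he : e ∈ atlas (CSpace m) M) (hz : z ∈ e.target) :
    ContDiffAt ℝ 2 (fun y => f (e.symm y)) z := by
  have hquot : ContDiffAt ℝ 2 (fun y => (g.matrix e y + complexHessian e φ y).det *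
      ((g.matrix e y).det)⁻¹) z :=
    (contDiffAt_det (g.isKahlerAt_potential hφ hpos he hz).contDiffAt).mul
      ((contDiffAt_det (g.isKahlerAt_matrix he hz).contDiffAt).inv
        (g.posDef_matrix he hz).det_pos.ne')
  refine (Complex.reCLM.contDiff.contDiffAt.comp z hquot).congr_of_eventuallyEq ?_
  filter_upwards [e.open_target.mem_nhds hz] with y hy
  rw [Function.comp_apply, hMA e he y hy,
    mul_inv_cancel_right₀ (g.posDef_matrix he hy).det_pos.ne', Complex.reCLM_apply,
    Complex.ofReal_re]

end KahlerMetric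

end KahlerMetrics

section MaximumPoint

variable {E : Type*} [NormedAddCommGroup E] [NormedSpace ℂ E] {u φ H : E → ℝ} {δ : ℝ} {z : E}

theorem holo_wirtinger_eq_of_isLocalMax_sub (hmax : IsLocalMax (fun y => u y - δ * φ y) z)
    (hu : DifferentiableAt ℝ u z) (hφ : DifferentiableAt ℝ φ z) (w : E) :
    ∂ₕ w (fun y => (u y : ℂ)) z = δ * ∂ₕ w (fun y => (φ y : ℂ)) z := by
  have hfderiv : fderiv ℝ u z = δ • fderiv ℝ φ z := by
    rw [← sub_eq_zero, ← hmax.fderiv_eq_zero, fderiv_fun_sub hu (hφ.const_mul δ),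
      fderiv_const_mul hφ]
  rw [holo_wirtinger_ofReal hu, holo_wirtinger_ofReal hφ, hfderiv]
  simp only [_root_.smul_apply, smul_eq_mul]
  push_cast
  ring

theorem re_wirtinger_wirtinger_le_of_isLocalMax_sub
    (hmax : IsLocalMax (fun y => u y - δ * φ y) z) (hu : ContDiffAt ℝ 2 u z)
    (hφ : ContDiffAt ℝ 2 φ z) (w : E) :
    (∂ₕ w (∂ₐ w fun y => (u y : ℂ)) z).re ≤ δ * (∂ₕ w (∂ₐ w fun y => (φ y : ℂ)) z).re := by
  have hd {f : E → ℝ} (hf : ContDiffAt ℝ 2 f z) :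
      DifferentiableAt ℝ (∂ₐ w fun y => (f y : ℂ)) z :=
    (contDiffAt_wirtinger (k := 1) (contDiffAt_ofReal_comp hf) (by norm_num)).differentiableAt
      (by norm_num)
  have hanti : (∂ₐ w fun y => ((u y - δ * φ y : ℝ) : ℂ)) =ᶠ[𝓝 z]
      fun y => ∂ₐ w (fun y => (u y : ℂ)) y - δ * ∂ₐ w (fun y => (φ y : ℂ)) y := by
    filter_upwards [(contDiffAt_ofReal_comp hu).eventually (by simp),
      (contDiffAt_ofReal_comp hφ).eventually (by simp)] with y hyu hyφ
    have hyφ' := hyφ.differentiableAt two_ne_zero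
    simp only [Complex.ofReal_sub, Complex.ofReal_mul]
    rw [wirtinger_sub (hyu.differentiableAt two_ne_zero) (hyφ'.const_mul _),
      wirtinger_const_mul _ hyφ']
  have hnonpos := re_wirtinger_wirtinger_nonpos_of_isLocalMax (v := w) hmax
    (hu.sub (contDiffAt_const.mul hφ))
  rw [wirtinger_congr hanti, wirtinger_sub (hd hu) ((hd hφ).const_mul _),
    wirtinger_const_mul _ (hd hφ), Complex.sub_re, Complex.re_ofReal_mul] at hnonpos
  linarith

variable {ι : Type*} [Fintype ι] {v : ι → E}

theorem sum_norm_sq_wirtinger_le_of_isLocalMax_sub {T : ℝ}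
    (hmax : IsLocalMax (fun y => u y - δ * φ y) z) (hu : DifferentiableAt ℝ u z)
    (hφ : DifferentiableAt ℝ φ z) (hT : ∀ k, ‖∂ₕ (v k) (fun y => (φ y : ℂ)) z‖ ^ 2 ≤ T) :
    ∑ k, ‖∂ₕ (v k) (fun y => (u y : ℂ)) z‖ ^ 2 ≤ δ ^ 2 * (Fintype.card ι * T) := by
  calc ∑ k, ‖∂ₕ (v k) (fun y => (u y : ℂ)) z‖ ^ 2
      ≤ ∑ _k : ι, δ ^ 2 * T := Finset.sum_le_sum fun k _ => by
        rw [holo_wirtinger_eq_of_isLocalMax_sub hmax hu hφ, norm_mul, Complex.norm_real, mul_pow,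
          Real.norm_eq_abs, sq_abs]
        exact mul_le_mul_of_nonneg_left (hT k) (sq_nonneg δ)
    _ = δ ^ 2 * (Fintype.card ι * T) := by
        rw [Finset.sum_const, Finset.card_univ, nsmul_eq_mul]
        ring

theorem sum_re_wirtinger_wirtinger_div_le_of_isLocalMax_sub {μ : ι → ℝ}
    (hmax : IsLocalMax (fun y => u y - δ * φ y) z) (hu : ContDiffAt ℝ 2 u z)
    (hφ : ContDiffAt ℝ 2 φ z) (hμ : ∀ k, 0 < μ k)
    (hφμ : ∀ k, (∂ₕ (v k) (∂ₐ (v k) fun y => (φ y : ℂ)) z).re = μ k - 1) :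
    ∑ k, (∂ₕ (v k) (∂ₐ (v k) fun y => (u y : ℂ)) z).re / μ k ≤
      δ * (Fintype.card ι - ∑ k, (μ k)⁻¹) := by
  calc ∑ k, (∂ₕ (v k) (∂ₐ (v k) fun y => (u y : ℂ)) z).re / μ k
      ≤ ∑ k, δ * (μ k - 1) / μ k := Finset.sum_le_sum fun k _ => by
        rw [← hφμ k]
        exact div_le_div_of_nonneg_right
          (re_wirtinger_wirtinger_le_of_isLocalMax_sub hmax hu hφ (v k)) (hμ k).le
    _ = ∑ k, δ * (1 - (μ k)⁻¹) := Finset.sum_congr rfl fun k _ => by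
        rw [mul_div_assoc, sub_div, div_self (hμ k).ne', one_div]
    _ = δ * (Fintype.card ι - ∑ k, (μ k)⁻¹) := by
        rw [← Finset.mul_sum, Finset.sum_sub_distrib, Finset.sum_const, Finset.card_univ,
          nsmul_one]

variable [DecidableEq ι] [Nontrivial ι] {G W : E → Matrix ι ι ℂ}

theorem le_of_isLocalMax_trace_sub {μ : ι → ℝ} {T : ℝ} (hμ : ∀ i, 0 < μ i)
    (hG : IsKahlerAt v G z) (hW : IsKahlerAt v W z) (hu : ContDiffAt ℝ 2 u z)
    (hφ : ContDiffAt ℝ 2 φ z) (hH : ContDiffAt ℝ 2 H z) (hHz : H z ≠ 0)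
    (htrace : (fun y => ((G y)⁻¹ * W y).trace) =ᶠ[𝓝 z] fun y => (u y : ℂ))
    (hdet : ∀ᶠ y in 𝓝 z, (W y).det = (H y : ℂ) ^ (Fintype.card ι - 1) * (G y).det)
    (hφW : W z = G z + hessianMatrix v (fun y => (φ y : ℂ)) z)
    (hG1 : G z = 1) (hW1 : W z = Matrix.diagonal fun i => (μ i : ℂ))
    (hR : ∀ i k, i ≠ k → 0 ≤ (chernCurvature (v k) G z i i).re)
    (hmax : IsLocalMax (fun y => u y - δ * φ y) z)
    (hT : ∀ k, ‖∂ₕ (v k) (fun y => (φ y : ℂ)) z‖ ^ 2 ≤ T) :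
    ((Fintype.card ι : ℝ) - 1) / H z * (hessianMatrix v (fun y => (H y : ℂ)) z).trace.re -
      Fintype.card ι / (((Fintype.card ι : ℝ) - 1) * ((∑ i, μ i) ^ 2 - ∑ i, μ i ^ 2)) *
        (δ ^ 2 * (Fintype.card ι * T)) ≤
      δ * (Fintype.card ι - ∑ i, (μ i)⁻¹) := by
  have hbochner := sum_re_wirtinger_wirtinger_trace_div_ge hμ hG hW (contDiffAt_ofReal_comp hH)
    hHz hdet hG1 hW1 hR
  have hanti (k : ι) : (∂ₐ (v k) fun y => ((G y)⁻¹ * W y).trace) =ᶠ[𝓝 z]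
      ∂ₐ (v k) fun y => (u y : ℂ) :=
    htrace.eventuallyEq_nhds.mono fun y hy => wirtinger_congr hy
  simp only [wirtinger_congr htrace, wirtinger_congr (hanti _)] at hbochner
  have hφμ (k : ι) : (∂ₕ (v k) (∂ₐ (v k) fun y => (φ y : ℂ)) z).re = μ k - 1 := by
    have hentry := congrFun (congrFun (hW1.symm.trans (hG1 ▸ hφW)) k) k
    rw [Matrix.diagonal_apply_eq, Matrix.add_apply, Matrix.one_apply_eq] at hentry
    have hre := congrArg Complex.re hentry
    rw [Complex.ofReal_re, Complex.add_re, Complex.one_re] at hre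
    exact (sub_eq_of_eq_add' hre).symm
  have hsecond := sum_re_wirtinger_wirtinger_div_le_of_isLocalMax_sub hmax hu hφ hμ hφμ
  have hcard : (1 : ℝ) < Fintype.card ι := by exact_mod_cast Fintype.one_lt_card
  have hcoeff : 0 ≤ Fintype.card ι /
      (((Fintype.card ι : ℝ) - 1) * ((∑ i, μ i) ^ 2 - ∑ i, μ i ^ 2)) :=
    div_nonneg (Nat.cast_nonneg _)
      (mul_pos (sub_pos.2 hcard) (sub_pos.2 (sum_sq_lt_sq_sum hμ))).le
  have hgrad := mul_le_mul_of_nonneg_left (sum_norm_sq_wirtinger_le_of_isLocalMax_sub hmax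
    (hu.differentiableAt two_ne_zero) (hφ.differentiableAt two_ne_zero) hT) hcoeff
  simp only [Matrix.trace, Matrix.diag_apply, hessianMatrix, Matrix.of_apply, Complex.re_sum]
  linarith

theorem exists_eigenvalues_of_isLocalMax_trace_sub {T : ℝ}
    (hG : IsKahlerAt v G z) (hW : IsKahlerAt v W z) (hu : ContDiffAt ℝ 2 u z)
    (hφ : ContDiffAt ℝ 2 φ z) (hH : ContDiffAt ℝ 2 H z) (hHz : H z ≠ 0)
    (htrace : (fun y => ((G y)⁻¹ * W y).trace) =ᶠ[𝓝 z] fun y => (u y : ℂ))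
    (hdet : ∀ᶠ y in 𝓝 z, (W y).det = (H y : ℂ) ^ (Fintype.card ι - 1) * (G y).det)
    (hφW : W z = G z + hessianMatrix v (fun y => (φ y : ℂ)) z)
    (hR : ∀ V : Matrix ι ι ℂ, V * G z * Vᴴ = 1 → ∀ i k, i ≠ k →
      0 ≤ (chernCurvature (changeFrame V v k) (fun y => V * G y * Vᴴ) z i i).re)
    (hmax : IsLocalMax (fun y => u y - δ * φ y) z)
    (hT : ∀ a : ι → ℂ, a ⬝ᵥ G z *ᵥ star a = 1 →
      ‖∂ₕ (∑ i, a i • v i) (fun y => (φ y : ℂ)) z‖ ^ 2 ≤ T) :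
    ∃ μ : ι → ℝ, (∀ i, 0 < μ i) ∧ ∑ i, μ i = u z ∧ ∏ i, μ i = H z ^ (Fintype.card ι - 1) ∧
      ((Fintype.card ι : ℝ) - 1) / H z *
          ((G z)⁻¹ * hessianMatrix v (fun y => (H y : ℂ)) z).trace.re -
        Fintype.card ι / (((Fintype.card ι : ℝ) - 1) * ((∑ i, μ i) ^ 2 - ∑ i, μ i ^ 2)) *
          (δ ^ 2 * (Fintype.card ι * T)) ≤
        δ * (Fintype.card ι - ∑ i, (μ i)⁻¹) := by
  obtain ⟨V, μ, hμ, hVG, hVW⟩ := exists_simultaneous_diagonalization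
    hG.posDef.self_of_nhds hW.posDef.self_of_nhds
  have hV : IsUnit V := isUnit_of_mul_mul_conjTranspose_eq_one hVG
  have hunit (k : ι) : V k ⬝ᵥ G z *ᵥ star (V k) = 1 := by
    rw [← mul_mul_conjTranspose_apply, hVG, Matrix.one_apply_eq]
  have hsum : ∑ i, μ i = u z := by
    have htr : (u z : ℂ) = (∑ i, μ i : ℝ) :=
      htrace.self_of_nhds.symm.trans (trace_inv_mul_of_diagonalization hVG hVW)
    exact_mod_cast htr.symm
  have hprod : ∏ i, μ i = H z ^ (Fintype.card ι - 1) := by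
    have hVGdet := congrArg Matrix.det hVG
    have hVWdet := congrArg Matrix.det hVW
    simp only [Matrix.det_mul, Matrix.det_diagonal, Matrix.det_one, hdet.self_of_nhds]
      at hVGdet hVWdet
    have hcast : ((∏ i, μ i : ℝ) : ℂ) = (H z ^ (Fintype.card ι - 1) : ℝ) := by
      push_cast
      linear_combination (H z : ℂ) ^ (Fintype.card ι - 1) * hVGdet - hVWdet
    exact_mod_cast hcast
  refine ⟨μ, hμ, hsum, hprod, ?_⟩
  have hineq := le_of_isLocalMax_trace_sub hμ (hG.changeFrame hV) (hW.changeFrame hV) hu hφ hH hHz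
    (by simpa only [trace_inv_mul_mul_mul_conjTranspose hV] using htrace)
    (hdet.mono fun y hy => by simp only [Matrix.det_mul, hy]; ring)
    (by rw [hφW, hessianMatrix_changeFrame (contDiffAt_ofReal_comp hφ), Matrix.mul_add,
      Matrix.add_mul])
    hVG hVW (hR V hVG) hmax fun k => hT (V k) (hunit k)
  have hlap : (V * hessianMatrix v (fun y => (H y : ℂ)) z * Vᴴ).trace =
      ((G z)⁻¹ * hessianMatrix v (fun y => (H y : ℂ)) z).trace := by
    rw [← trace_inv_mul_mul_mul_conjTranspose hV, hVG, inv_one, Matrix.one_mul]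
  rwa [hessianMatrix_changeFrame (contDiffAt_ofReal_comp hH), hlap] at hineq

end MaximumPoint

section MaximumPointOnManifold

variable {m : ℕ} {M : Type*} [TopologicalSpace M] [ChartedSpace (CSpace m) M]
  [IsManifold 𝓘(ℂ, CSpace m) ω M] {e : OpenPartialHomeomorph M (CSpace m)} {z : CSpace m}
  {f φ : M → ℝ}

theorem KahlerMetric.exists_eigenvalues_of_isMax (g : KahlerMetric m M) (hm : 2 ≤ m)
    (hg : g.NonnegOrthogonalBisectional) {δ T : ℝ} (hf : ∀ x, 0 < f x)
    (hφ : ContMDiff 𝓘(ℝ, CSpace m) 𝓘(ℝ) 4 φ) (hMA : g.SolvesMongeAmpere f φ)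
    (hpos : g.PosDefPotential φ) (he : e ∈ atlas (CSpace m) M) (hz : z ∈ e.target)
    (hmax : ∀ x, g.laplacian φ x - δ * φ x ≤ g.laplacian φ (e.symm z) - δ * φ (e.symm z))
    (hT : ∀ w : CSpace m, w.ofLp ⬝ᵥ g.matrix e z *ᵥ star w.ofLp = 1 →
      ‖∂ₕ w (fun y => (φ (e.symm y) : ℂ)) z‖ ^ 2 ≤ T) :
    ∃ μ : Fin m → ℝ, (∀ i, 0 < μ i) ∧ ∑ i, μ i = m + g.laplacian φ (e.symm z) ∧
      ∏ i, μ i = (f (e.symm z) ^ (1 / ((m : ℝ) - 1))) ^ (m - 1) ∧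
      ((m : ℝ) - 1) / f (e.symm z) ^ (1 / ((m : ℝ) - 1)) *
          g.laplacian (fun y => f y ^ (1 / ((m : ℝ) - 1))) (e.symm z) -
        m / (((m : ℝ) - 1) * ((∑ i, μ i) ^ 2 - ∑ i, μ i ^ 2)) * (δ ^ 2 * (m * T)) ≤
        δ * (m - ∑ i, (μ i)⁻¹) := by
  have : Nontrivial (Fin m) := Fin.nontrivial_iff_two_le.2 hm
  have hm1 : ((m - 1 : ℕ) : ℝ) = (m : ℝ) - 1 := by
    rw [Nat.cast_sub (by omega), Nat.cast_one]
  have hm1' : ((m : ℝ) - 1) ≠ 0 := by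
    rw [← hm1]
    exact_mod_cast (by omega : m - 1 ≠ 0)
  have hHpow (x : M) : (f x ^ (1 / ((m : ℝ) - 1))) ^ (m - 1) = f x := by
    rw [← Real.rpow_natCast, ← Real.rpow_mul (hf x).le, hm1, one_div_mul_cancel hm1',
      Real.rpow_one]
  have hH : ContDiffAt ℝ 2 (fun y => f (e.symm y) ^ (1 / ((m : ℝ) - 1))) z :=
    (g.contDiffAt_density hφ hMA hpos he hz).rpow_const_of_ne (hf _).ne'
  have htarget : ∀ᶠ y in 𝓝 z, y ∈ e.target := e.open_target.mem_nhds hz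
  have hmain := exists_eigenvalues_of_isLocalMax_trace_sub (δ := δ) (T := T)
    (g.isKahlerAt_matrix he hz) (g.isKahlerAt_potential hφ hpos he hz)
    (g.contDiffAt_laplacian hφ hpos he hz)
    ((contDiffAt_comp_symm hφ he hz).of_le (by norm_num)) hH
    (Real.rpow_pos_of_pos (hf _) _).ne'
    (htarget.mono fun y hy => g.trace_inv_mul_potential hφ hpos he hy)
    (htarget.mono fun y hy => by
      rw [hMA e he y hy, Fintype.card_fin, ← Complex.ofReal_pow, hHpow])
    (by rw [complexHessian_eq_hessianMatrix])
    (fun V hV i k hik => hg.re_chernCurvature_nonneg he hz hV hik)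
    (Eventually.of_forall fun y => by linarith [hmax (e.symm y)])
    (fun a ha => by
      rw [show ∑ i, a i • stdFrame i = WithLp.toLp 2 a from sum_smul_stdFrame (WithLp.toLp 2 a)]
      exact hT (WithLp.toLp 2 a) ha)
  rwa [Fintype.card_fin,
    ← complexHessian_eq_hessianMatrix fun y => f y ^ (1 / ((m : ℝ) - 1)),
    ← g.laplacian_eq he hz hH] at hmain

end MaximumPointOnManifold

section GradientBound

section CompactFamilies

variable {ι : Type*} [Fintype ι]

theorem re_dotProduct_mulVec_star_smul (A : Matrix ι ι ℂ) (t : ℝ) (v : EuclideanSpace ℂ ι) :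
    ((t • v).ofLp ⬝ᵥ A *ᵥ star (t • v).ofLp).re = t ^ 2 * (v.ofLp ⬝ᵥ A *ᵥ star v.ofLp).re := by
  rw [WithLp.ofLp_smul, star_smul, star_trivial, Matrix.mulVec_smul, smul_dotProduct,
    dotProduct_smul, smul_smul, Complex.real_smul, Complex.re_ofReal_mul, sq]

theorem re_dotProduct_mulVec_star_pos {A : Matrix ι ι ℂ} (hA : A.PosDef)
    {v : EuclideanSpace ℂ ι} (hv : v ≠ 0) : 0 < (v.ofLp ⬝ᵥ A *ᵥ star v.ofLp).re := by
  have hstar : star v.ofLp ≠ 0 := by simpa using hv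
  have hpos := hA.dotProduct_mulVec_pos hstar
  rw [star_star] at hpos
  exact (Complex.lt_def.1 hpos).1

theorem continuousOn_re_dotProduct_mulVec_star {X : Type*} [TopologicalSpace X]
    {G : X → Matrix ι ι ℂ} {s : Set X} (hc : ∀ i j, ContinuousOn (fun y => G y i j) s)
    (t : Set (EuclideanSpace ℂ ι)) :
    ContinuousOn (fun p : X × EuclideanSpace ℂ ι => (p.2.ofLp ⬝ᵥ G p.1 *ᵥ star p.2.ofLp).re)
      (s ×ˢ t) := by
  have hentry (i j : ι) : ContinuousOn (fun p : X × EuclideanSpace ℂ ι => G p.1 i j) (s ×ˢ t) :=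
    (hc i j).comp continuousOn_fst fun p hp => hp.1
  have hcoord (i : ι) : Continuous fun p : X × EuclideanSpace ℂ ι => p.2 i := by fun_prop
  exact Complex.continuous_re.comp_continuousOn <| continuousOn_finsetSum _ fun i _ =>
    (hcoord i).continuousOn.mul <| continuousOn_finsetSum _ fun j _ =>
      (hentry i j).mul (hcoord j).star.continuousOn

theorem exists_re_dotProduct_mulVec_star_bounds {X : Type*} [TopologicalSpace X]
    {G : X → Matrix ι ι ℂ} {s : Set X} (hs : IsCompact s)
    (hc : ∀ i j, ContinuousOn (fun y => G y i j) s) (hG : ∀ y ∈ s, (G y).PosDef) :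
    ∃ a b : ℝ, 0 < a ∧ 0 ≤ b ∧ ∀ y ∈ s, ∀ v : EuclideanSpace ℂ ι,
      a * ‖v‖ ^ 2 ≤ (v.ofLp ⬝ᵥ G y *ᵥ star v.ofLp).re ∧
        (v.ofLp ⬝ᵥ G y *ᵥ star v.ofLp).re ≤ b * ‖v‖ ^ 2 := by
  have hcont := continuousOn_re_dotProduct_mulVec_star hc (Metric.sphere 0 1)
  have hcomp := hs.prod (isCompact_sphere (0 : EuclideanSpace ℂ ι) 1)
  obtain ⟨a, ha, haQ⟩ := hcomp.exists_forall_le' hcont (a := 0) fun p hp =>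
    re_dotProduct_mulVec_star_pos (hG p.1 hp.1) (ne_zero_of_mem_unit_sphere ⟨p.2, hp.2⟩)
  obtain ⟨b, hbQ⟩ := hcomp.bddAbove_image hcont
  refine ⟨a, max b 0, ha, le_max_right _ _, fun y hy v => ?_⟩
  obtain rfl | hv := eq_or_ne v 0
  · simp
  have hnorm : ‖v‖ ≠ 0 := norm_ne_zero_iff.2 hv
  have hmem : (y, ‖v‖⁻¹ • v) ∈ s ×ˢ Metric.sphere (0 : EuclideanSpace ℂ ι) 1 :=
    ⟨hy, by simp [norm_smul, inv_mul_cancel₀ hnorm]⟩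
  have hscale : (v.ofLp ⬝ᵥ G y *ᵥ star v.ofLp).re =
      ((‖v‖⁻¹ • v).ofLp ⬝ᵥ G y *ᵥ star (‖v‖⁻¹ • v).ofLp).re * ‖v‖ ^ 2 := by
    rw [mul_comm, ← re_dotProduct_mulVec_star_smul, smul_inv_smul₀ hnorm]
  rw [hscale]
  exact ⟨mul_le_mul_of_nonneg_right (haQ _ hmem) (sq_nonneg _), mul_le_mul_of_nonneg_right
    ((hbQ ⟨_, hmem, rfl⟩).trans (le_max_left _ _)) (sq_nonneg _)⟩

end CompactFamilies

variable {m : ℕ} {M : Type*} [TopologicalSpace M] [ChartedSpace (CSpace m) M]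
  [IsManifold 𝓘(ℂ, CSpace m) ω M] {g : KahlerMetric m M} {φ : M → ℝ} {K L : ℝ}
  {e : OpenPartialHomeomorph M (CSpace m)}

theorem KahlerMetric.PosDefPotential.norm_wirtinger_wirtinger_le {z : CSpace m}
    (hpos : g.PosDefPotential φ) (hφ : ContMDiff 𝓘(ℝ, CSpace m) 𝓘(ℝ) 4 φ)
    (he : e ∈ atlas (CSpace m) M) (hz : z ∈ e.target) (hK : 1 ≤ K)
    (hlap : m + g.laplacian φ (e.symm z) ≤ K) (v : CSpace m) :
    ‖∂ₕ v (∂ₐ v fun y => (φ (e.symm y) : ℂ)) z‖ ≤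
      K * (v.ofLp ⬝ᵥ g.matrix e z *ᵥ star v.ofLp).re := by
  have hC2 : ContDiffAt ℝ 2 (fun y => φ (e.symm y)) z :=
    (contDiffAt_comp_symm hφ he hz).of_le (by norm_num)
  have hhess : ∂ₕ v (∂ₐ v fun y => (φ (e.symm y) : ℂ)) z =
      v.ofLp ⬝ᵥ complexHessian e φ z *ᵥ star v.ofLp := by
    rw [complexHessian_eq_hessianMatrix,
      ← holo_antiholo_wirtinger_eq_dotProduct (contDiffAt_ofReal_comp hC2), sum_smul_stdFrame]
  have hg := re_dotProduct_mulVec_star_nonneg (g.posDef_matrix he hz) v.ofLp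
  have hnonneg := re_dotProduct_mulVec_star_nonneg (hpos e he z hz) v.ofLp
  have hle := re_dotProduct_mulVec_star_le_trace_mul (g.posDef_matrix he hz) (hpos e he z hz) v.ofLp
  rw [g.trace_inv_mul_potential hφ hpos he hz, Complex.ofReal_re] at hle
  rw [Matrix.add_mulVec, dotProduct_add, Complex.add_re, ← hhess] at hle hnonneg
  have hleK := hle.trans (mul_le_mul_of_nonneg_right hlap hg)
  have hgK := le_mul_of_one_le_left hg hK
  rw [holo_antiholo_wirtinger_ofReal hC2] at hleK hnonneg ⊢
  rw [Complex.ofReal_re] at hleK hnonneg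
  rw [Complex.norm_real, Real.norm_eq_abs, abs_le]
  constructor <;> linarith

theorem KahlerMetric.PosDefPotential.norm_sq_wirtinger_le_of_closedBall {z : CSpace m} {a b ρ : ℝ}
    (hpos : g.PosDefPotential φ) (hφ : ContMDiff 𝓘(ℝ, CSpace m) 𝓘(ℝ) 4 φ)
    (he : e ∈ atlas (CSpace m) M) (hL : ∀ x y, φ x - φ y ≤ L) (hK : 1 ≤ K)
    (hlap : ∀ x, m + g.laplacian φ x ≤ K) (ha : 0 < a) (hb : 0 ≤ b) (hρ : 0 < ρ)
    (hball : Metric.closedBall z ρ ⊆ e.target)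
    (hab : ∀ y ∈ Metric.closedBall z ρ, ∀ v : CSpace m,
      a * ‖v‖ ^ 2 ≤ (v.ofLp ⬝ᵥ g.matrix e y *ᵥ star v.ofLp).re ∧
        (v.ofLp ⬝ᵥ g.matrix e y *ᵥ star v.ofLp).re ≤ b * ‖v‖ ^ 2)
    {v : CSpace m} (hv : v.ofLp ⬝ᵥ g.matrix e z *ᵥ star v.ofLp = 1) :
    ‖∂ₕ v (fun y => (φ (e.symm y) : ℂ)) z‖ ^ 2 ≤
      (L / (ρ / √a⁻¹) + (b * √a⁻¹ ^ 2 + 1) * (ρ / √a⁻¹)) ^ 2 * K := by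
  set ν := √a⁻¹
  have hν : 0 < ν := Real.sqrt_pos.2 (inv_pos.2 ha)
  have hvν : ‖v‖ ≤ ν := by
    have hlower := (hab z (Metric.mem_closedBall_self hρ.le) v).1
    rw [hv, Complex.one_re] at hlower
    refine Real.le_sqrt_of_sq_le ?_
    rwa [← one_div, le_div_iff₀' ha]
  have hmem {ζ : ℂ} (hζ : ‖ζ‖ ≤ ρ / ν) : z + ζ • v ∈ Metric.closedBall z ρ := by
    rw [mem_closedBall_iff_norm, add_sub_cancel_left, norm_smul]
    calc ‖ζ‖ * ‖v‖ ≤ ρ / ν * ν := by gcongr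
      _ = ρ := div_mul_cancel₀ ρ hν.ne'
  refine norm_sq_wirtinger_le (div_pos hρ hν) hK
    (fun ζ hζ => (contDiffAt_comp_symm hφ he (hball (hmem hζ))).of_le (by norm_num))
    (fun ζ _ => abs_le'.2 ⟨hL _ _, by rw [neg_sub]; exact hL _ _⟩) fun ζ hζ => ?_
  calc ‖∂ₕ v (∂ₐ v fun y => (φ (e.symm y) : ℂ)) (z + ζ • v)‖
      ≤ K * (v.ofLp ⬝ᵥ g.matrix e (z + ζ • v) *ᵥ star v.ofLp).re :=
        hpos.norm_wirtinger_wirtinger_le hφ he (hball (hmem hζ)) hK (hlap _) v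
    _ ≤ K * (b * ν ^ 2) := by
        gcongr
        exact (hab _ (hmem hζ) v).2.trans (by gcongr)
    _ < (b * ν ^ 2 + 1) * K := by linarith

/-- The gradient bound at `x₀`: for every potential `φ` of oscillation at most `L` with
`m + Δφ ≤ K`, the squared length of `∂φ` at `x₀` in unit directions is at most `C * K`. It is
expressed in one chart, which does not depend on `φ`. -/
def GradientBoundAt (g : KahlerMetric m M) (L C : ℝ) (x₀ : M) : Prop :=
  ∃ e ∈ atlas (CSpace m) M, x₀ ∈ e.source ∧ ∀ φ : M → ℝ, ContMDiff 𝓘(ℝ, CSpace m) 𝓘(ℝ) 4 φ →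
    (∀ x y, φ x - φ y ≤ L) → g.PosDefPotential φ → ∀ K : ℝ, 1 ≤ K →
    (∀ x, m + g.laplacian φ x ≤ K) →
    ∀ v : CSpace m, v.ofLp ⬝ᵥ g.matrix e (e x₀) *ᵥ star v.ofLp = 1 →
      ‖∂ₕ v (fun y => (φ (e.symm y) : ℂ)) (e x₀)‖ ^ 2 ≤ C * K

omit [IsManifold 𝓘(ℂ, CSpace m) ω M] in
theorem GradientBoundAt.mono {C C' : ℝ} {x₀ : M} (h : GradientBoundAt g L C x₀) (hC : C ≤ C') :
    GradientBoundAt g L C' x₀ := by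
  obtain ⟨e, he, hx, hbound⟩ := h
  exact ⟨e, he, hx, fun φ hφ hL hpos K hK hlap v hv =>
    (hbound φ hφ hL hpos K hK hlap v hv).trans
      (mul_le_mul_of_nonneg_right hC (zero_le_one.trans hK))⟩

theorem eventually_gradientBoundAt (g : KahlerMetric m M) (L : ℝ) (x : M) :
    ∃ C : ℝ, ∀ᶠ x₀ in 𝓝 x, GradientBoundAt g L C x₀ := by
  set e := chartAt (CSpace m) x
  have he : e ∈ atlas (CSpace m) M := chart_mem_atlas _ x
  have hx : x ∈ e.source := mem_chart_source _ x
  obtain ⟨R, hR, hball⟩ := Metric.nhds_basis_closedBall.mem_iff.1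
    (e.open_target.mem_nhds (e.map_source hx))
  obtain ⟨a, b, ha, hb, hab⟩ := exists_re_dotProduct_mulVec_star_bounds (G := g.matrix e)
    (isCompact_closedBall (e x) R)
    (fun i j => (g.smooth e he i j).continuousOn.mono hball)
    fun y hy => g.posDef_matrix he (hball hy)
  refine ⟨(L / (R / 2 / √a⁻¹) + (b * √a⁻¹ ^ 2 + 1) * (R / 2 / √a⁻¹)) ^ 2, ?_⟩
  filter_upwards [e.open_source.mem_nhds hx, (e.continuousAt hx).eventually
    (Metric.ball_mem_nhds _ (half_pos hR))] with x₀ hx₀ hdist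
  have hsub : Metric.closedBall (e x₀) (R / 2) ⊆ Metric.closedBall (e x) R :=
    Metric.closedBall_subset_closedBall' (by linarith [Metric.mem_ball.1 hdist])
  exact ⟨e, he, hx₀, fun φ hφ hL hpos K hK hlap v hv =>
    hpos.norm_sq_wirtinger_le_of_closedBall hφ he hL hK hlap ha hb (half_pos hR) (hsub.trans hball)
      (fun y hy => hab y (hsub hy)) hv⟩

theorem exists_gradientBoundAt [CompactSpace M] (g : KahlerMetric m M) (L : ℝ) :
    ∃ C : ℝ, 0 < C ∧ ∀ x₀ : M, GradientBoundAt g L C x₀ := by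
  obtain ⟨C, hC⟩ : ∃ C : ℝ, ∀ x₀ ∈ (Set.univ : Set M), GradientBoundAt g L C x₀ := by
    refine isCompact_univ.induction_on (p := fun s => ∃ C : ℝ, ∀ x₀ ∈ s, GradientBoundAt g L C x₀)
      ⟨0, by simp⟩ (fun s t hst ⟨C, hC⟩ => ⟨C, fun x hx => hC x (hst hx)⟩) ?_ fun x _ => ?_
    · rintro s t ⟨C, hC⟩ ⟨C', hC'⟩
      refine ⟨max C C', ?_⟩
      rintro x (hx | hx)
      · exact (hC x hx).mono (le_max_left _ _)
      · exact (hC' x hx).mono (le_max_right _ _)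
    · obtain ⟨C, hC⟩ := eventually_gradientBoundAt g L x
      exact ⟨_, mem_nhdsWithin_of_mem_nhds hC, C, fun y hy => hy⟩
  exact ⟨max C 1, by positivity, fun x => (hC x trivial).mono (le_max_left _ _)⟩

end GradientBound

section EigenvalueEstimates

variable {ι : Type*} [Fintype ι] {μ : ι → ℝ}

theorem inv_le_sum_inv (hμ : ∀ i, 0 < μ i) (i : ι) : (μ i)⁻¹ ≤ ∑ j, (μ j)⁻¹ :=
  Finset.single_le_sum (f := fun i => (μ i)⁻¹) (fun i _ => (inv_pos.2 (hμ i)).le)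
    (Finset.mem_univ i)

theorem sum_le_sq_sum_sub_mul_sum_inv [Nontrivial ι] (hμ : ∀ i, 0 < μ i) :
    ∑ i, μ i ≤ ((∑ i, μ i) ^ 2 - ∑ i, μ i ^ 2) * ∑ i, (μ i)⁻¹ := by
  set S := ∑ i, μ i with hS
  have hcard : (2 : ℝ) ≤ Fintype.card ι := by exact_mod_cast Fintype.one_lt_card (α := ι)
  have hS0 : 0 ≤ S := Finset.sum_nonneg fun i _ => (hμ i).le
  have hfactor : S ^ 2 - ∑ i, μ i ^ 2 = ∑ j, μ j * (S - μ j) := by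
    simp only [mul_sub, Finset.sum_sub_distrib, ← Finset.sum_mul, ← hS, sq]
  calc S ≤ (Fintype.card ι - 1) * S := le_mul_of_one_le_left hS0 (by linarith)
    _ = ∑ j, (S - μ j) := by
        rw [Finset.sum_sub_distrib, ← hS, Finset.sum_const, Finset.card_univ, nsmul_eq_mul]
        ring
    _ = ∑ j, μ j * (S - μ j) * (μ j)⁻¹ := Finset.sum_congr rfl fun j _ => by
        rw [mul_right_comm, mul_inv_cancel₀ (hμ j).ne', one_mul]
    _ ≤ ∑ j, μ j * (S - μ j) * ∑ i, (μ i)⁻¹ := Finset.sum_le_sum fun j _ => by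
        have hj : μ j ≤ S := Finset.single_le_sum (fun i _ => (hμ i).le) (Finset.mem_univ j)
        exact mul_le_mul_of_nonneg_left (inv_le_sum_inv hμ j)
          (mul_nonneg (hμ j).le (sub_nonneg.2 hj))
    _ = (S ^ 2 - ∑ i, μ i ^ 2) * ∑ i, (μ i)⁻¹ := by rw [hfactor, Finset.sum_mul]

theorem le_mul_sum_inv_pow_of_prod_eq {H : ℝ} (hμ : ∀ i, 0 < μ i) (hH : 0 < H)
    (hprod : ∏ i, μ i = H ^ (Fintype.card ι - 1)) (i : ι) :
    μ i ≤ (H * ∑ j, (μ j)⁻¹) ^ (Fintype.card ι - 1) := by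
  classical
  have hcard : (Finset.univ.erase i).card = Fintype.card ι - 1 := by
    rw [Finset.card_erase_of_mem (Finset.mem_univ i), Finset.card_univ]
  have hP : ∏ j ∈ Finset.univ.erase i, μ j ≠ 0 := (Finset.prod_pos fun j _ => hμ j).ne'
  calc μ i = ∏ j ∈ Finset.univ.erase i, H * (μ j)⁻¹ := by
        rw [Finset.prod_mul_distrib, Finset.prod_const, hcard, ← hprod,
          ← Finset.mul_prod_erase _ _ (Finset.mem_univ i), Finset.prod_inv_distrib,
          mul_inv_cancel_right₀ hP]
    _ ≤ ∏ _j ∈ Finset.univ.erase i, H * ∑ j, (μ j)⁻¹ :=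
        Finset.prod_le_prod (fun j _ => mul_nonneg hH.le (inv_pos.2 (hμ j)).le) fun j _ =>
          mul_le_mul_of_nonneg_left (inv_le_sum_inv hμ j) hH.le
    _ = (H * ∑ j, (μ j)⁻¹) ^ (Fintype.card ι - 1) := by rw [Finset.prod_const, hcard]

variable [Nontrivial ι] {A B C D H K δ : ℝ}

theorem gradient_term_le (hμ : ∀ i, 0 < μ i) (hC : 0 < C)
    (hδ : δ = ((Fintype.card ι : ℝ) - 1) / (4 * Fintype.card ι ^ 2 * C))
    (hK : K ≤ 2 * ∑ i, μ i) :
    Fintype.card ι / (((Fintype.card ι : ℝ) - 1) * ((∑ i, μ i) ^ 2 - ∑ i, μ i ^ 2)) *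
      (δ ^ 2 * (Fintype.card ι * (C * K))) ≤ δ * (∑ i, (μ i)⁻¹) / 2 := by
  have hE := sub_pos.2 (sum_sq_lt_sq_sum hμ)
  have hsum := sum_le_sq_sum_sub_mul_sum_inv hμ
  have hcard : (1 : ℝ) < Fintype.card ι := by exact_mod_cast Fintype.one_lt_card
  set c := (Fintype.card ι : ℝ)
  set E := (∑ i, μ i) ^ 2 - ∑ i, μ i ^ 2
  set σ := ∑ i, (μ i)⁻¹
  have hn : 0 < c - 1 := sub_pos.2 hcard
  calc c / ((c - 1) * E) * (δ ^ 2 * (c * (C * K)))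
      ≤ c / ((c - 1) * E) * (δ ^ 2 * (c * (C * (2 * (E * σ))))) := by
        gcongr
        linarith
    _ = δ * σ * (2 * c ^ 2 * C * δ / (c - 1)) := by field_simp
    _ = δ * σ / 2 := by
        rw [hδ]
        field_simp
        ring

theorem mul_sum_inv_le (hμ : ∀ i, 0 < μ i) (hH : 0 < H) (hHB : H ≤ B) (hAD : -A ≤ D)
    (hC : 0 < C) (hδ : δ = ((Fintype.card ι : ℝ) - 1) / (4 * Fintype.card ι ^ 2 * C))
    (hK : K ≤ 2 * ∑ i, μ i)
    (hineq : ((Fintype.card ι : ℝ) - 1) / H * D -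
      Fintype.card ι / (((Fintype.card ι : ℝ) - 1) * ((∑ i, μ i) ^ 2 - ∑ i, μ i ^ 2)) *
        (δ ^ 2 * (Fintype.card ι * (C * K))) ≤ δ * (Fintype.card ι - ∑ i, (μ i)⁻¹)) :
    H * ∑ i, (μ i)⁻¹ ≤
      2 / δ * ((Fintype.card ι - 1) * |A| + δ * Fintype.card ι * B) := by
  have hgrad := gradient_term_le hμ hC hδ hK
  have hcard : (1 : ℝ) < Fintype.card ι := by exact_mod_cast Fintype.one_lt_card
  set c := (Fintype.card ι : ℝ)
  set σ := ∑ i, (μ i)⁻¹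
  have : 0 < c - 1 := sub_pos.2 hcard
  have hδ0 : 0 < δ := by
    rw [hδ]
    positivity
  have hD : (c - 1) / H * -|A| ≤ (c - 1) / H * D :=
    mul_le_mul_of_nonneg_left ((neg_le_neg (le_abs_self A)).trans hAD) (by positivity)
  have hσ : δ * σ / 2 ≤ δ * c + (c - 1) / H * |A| := by linarith
  calc H * σ = 2 / δ * (H * (δ * σ / 2)) := by field_simp
    _ ≤ 2 / δ * (H * (δ * c + (c - 1) / H * |A|)) := by gcongr
    _ = 2 / δ * ((c - 1) * |A| + δ * c * H) := by
        field_simp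
        ring
    _ ≤ 2 / δ * ((c - 1) * |A| + δ * c * B) := by gcongr

theorem sum_le_of_prod_eq (hμ : ∀ i, 0 < μ i) (hH : 0 < H) (hHB : H ≤ B)
    (hprod : ∏ i, μ i = H ^ (Fintype.card ι - 1)) (hAD : -A ≤ D) (hC : 0 < C)
    (hδ : δ = ((Fintype.card ι : ℝ) - 1) / (4 * Fintype.card ι ^ 2 * C)) (hK : K ≤ 2 * ∑ i, μ i)
    (hineq : ((Fintype.card ι : ℝ) - 1) / H * D -
      Fintype.card ι / (((Fintype.card ι : ℝ) - 1) * ((∑ i, μ i) ^ 2 - ∑ i, μ i ^ 2)) *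
        (δ ^ 2 * (Fintype.card ι * (C * K))) ≤ δ * (Fintype.card ι - ∑ i, (μ i)⁻¹)) :
    ∑ i, μ i ≤ Fintype.card ι *
      (2 / δ * ((Fintype.card ι - 1) * |A| + δ * Fintype.card ι * B)) ^ (Fintype.card ι - 1) := by
  have hσ := mul_sum_inv_le hμ hH hHB hAD hC hδ hK hineq
  have hσ0 : 0 ≤ H * ∑ i, (μ i)⁻¹ :=
    mul_nonneg hH.le (Finset.sum_nonneg fun i _ => (inv_pos.2 (hμ i)).le)
  rw [← nsmul_eq_mul, ← Finset.card_univ]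
  exact Finset.sum_le_card_nsmul _ _ _ fun i _ =>
    (le_mul_sum_inv_pow_of_prod_eq hμ hH hprod i).trans (pow_le_pow_left₀ hσ0 hσ _)

end EigenvalueEstimates

section LaplacianEstimate

variable {m : ℕ} {M : Type*} [TopologicalSpace M] [ChartedSpace (CSpace m) M]
  [IsManifold 𝓘(ℂ, CSpace m) ω M] {g : KahlerMetric m M} {f φ : M → ℝ} {A C K L Λ δ : ℝ}

theorem KahlerMetric.continuous_laplacian (g : KahlerMetric m M)
    (hφ : ContMDiff 𝓘(ℝ, CSpace m) 𝓘(ℝ) 4 φ) (hpos : g.PosDefPotential φ) :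
    Continuous fun x => m + g.laplacian φ x := by
  refine continuous_iff_continuousAt.2 fun x => ?_
  set e := chartAt (CSpace m) x
  have hx : x ∈ e.source := mem_chart_source _ x
  have hchart : ContinuousAt (fun y => m + g.laplacian φ (e.symm (e y))) x :=
    ContinuousAt.comp (g := fun y => m + g.laplacian φ (e.symm y))
      (g.contDiffAt_laplacian hφ hpos (chart_mem_atlas _ x) (e.map_source hx)).continuousAt
      (e.continuousAt hx)
  refine hchart.congr ?_
  filter_upwards [e.open_source.mem_nhds hx] with y hy
  rw [e.left_inv hy]

theorem KahlerMetric.add_laplacian_nonneg (g : KahlerMetric m M)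
    (hφ : ContMDiff 𝓘(ℝ, CSpace m) 𝓘(ℝ) 4 φ) (hpos : g.PosDefPotential φ) (x : M) :
    0 ≤ m + g.laplacian φ x := by
  set e := chartAt (CSpace m) x
  have he : e ∈ atlas (CSpace m) M := chart_mem_atlas _ x
  have hx : x ∈ e.source := mem_chart_source _ x
  have hz := e.map_source hx
  obtain ⟨V, μ, hμ, hVG, hVW⟩ := exists_simultaneous_diagonalization (g.posDef_matrix he hz)
    (hpos e he _ hz)
  have htrace := g.trace_inv_mul_potential hφ hpos he hz
  rw [trace_inv_mul_of_diagonalization hVG hVW, e.left_inv hx] at htrace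
  rw [← Complex.ofReal_injective htrace]
  exact Finset.sum_nonneg fun i _ => (hμ i).le

theorem KahlerMetric.add_laplacian_le_of_isMax (hm : 2 ≤ m)
    (hg : g.NonnegOrthogonalBisectional) (hC : 0 < C)
    (hδ : δ = ((m : ℝ) - 1) / (4 * m ^ 2 * C)) {x₀ : M} (hgrad : GradientBoundAt g L C x₀)
    (hf : ∀ x, 0 < f x) (hfΛ : f x₀ ≤ Λ)
    (hA : -A ≤ g.laplacian (fun y => f y ^ (1 / ((m : ℝ) - 1))) x₀)
    (hφ : ContMDiff 𝓘(ℝ, CSpace m) 𝓘(ℝ) 4 φ) (hL : ∀ x y, φ x - φ y ≤ L)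
    (hMA : g.SolvesMongeAmpere f φ) (hpos : g.PosDefPotential φ)
    (hmax : ∀ x, g.laplacian φ x - δ * φ x ≤ g.laplacian φ x₀ - δ * φ x₀)
    (hK : 1 ≤ K) (hlap : ∀ x, m + g.laplacian φ x ≤ K)
    (hK₀ : K ≤ 2 * (m + g.laplacian φ x₀)) :
    m + g.laplacian φ x₀ ≤
      m * (2 / δ * ((m - 1) * |A| + δ * m * Λ ^ (1 / ((m : ℝ) - 1)))) ^ (m - 1) := by
  have : Nontrivial (Fin m) := Fin.nontrivial_iff_two_le.2 hm
  have hn : 0 ≤ (m : ℝ) - 1 := sub_nonneg.2 (by exact_mod_cast (by omega : 1 ≤ m))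
  obtain ⟨e, he, hxe, hbound⟩ := hgrad
  have hsymm : e.symm (e x₀) = x₀ := e.left_inv hxe
  obtain ⟨μ, hμ, hsum, hprod, hineq⟩ := g.exists_eigenvalues_of_isMax hm hg (T := C * K) hf hφ hMA
    hpos he (e.map_source hxe) (by rwa [hsymm]) (hbound φ hφ hL hpos K hK hlap)
  rw [hsymm] at hsum hprod hineq
  have hH := Real.rpow_pos_of_pos (hf x₀) (1 / ((m : ℝ) - 1))
  have hHΛ := Real.rpow_le_rpow (hf x₀).le hfΛ (one_div_nonneg.2 hn)
  rw [← hsum] at hK₀ ⊢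
  simpa only [Fintype.card_fin] using sum_le_of_prod_eq (K := K) (C := C) hμ hH hHΛ
    (by rwa [Fintype.card_fin]) hA hC (by rwa [Fintype.card_fin]) hK₀ (by rwa [Fintype.card_fin])

theorem KahlerMetric.add_laplacian_le [CompactSpace M] (hm : 2 ≤ m)
    (hg : g.NonnegOrthogonalBisectional) (hC : 0 < C) (hgrad : ∀ x, GradientBoundAt g L C x)
    (hδ : δ = ((m : ℝ) - 1) / (4 * m ^ 2 * C)) (hf : ∀ x, 0 < f x) (hfΛ : ∀ x, f x ≤ Λ)
    (hA : ∀ x, -A ≤ g.laplacian (fun y => f y ^ (1 / ((m : ℝ) - 1))) x)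
    (hφ : ContMDiff 𝓘(ℝ, CSpace m) 𝓘(ℝ) 4 φ) (hL : ∀ x y, φ x - φ y ≤ L)
    (hMA : g.SolvesMongeAmpere f φ) (hpos : g.PosDefPotential φ) (x : M) :
    m + g.laplacian φ x ≤ max (max 1 (2 * (δ * L)))
      (m * (2 / δ * ((m - 1) * |A| + δ * m * Λ ^ (1 / ((m : ℝ) - 1)))) ^ (m - 1) + δ * L) := by
  have : Nonempty M := ⟨x⟩
  have hn : 0 ≤ (m : ℝ) - 1 := sub_nonneg.2 (by exact_mod_cast (by omega : 1 ≤ m))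
  have hδ0 : 0 ≤ δ := hδ ▸ by positivity
  have hcont := g.continuous_laplacian hφ hpos
  obtain ⟨x₁, -, hx₁⟩ := isCompact_univ.exists_isMaxOn Set.univ_nonempty hcont.continuousOn
  obtain ⟨x₀, -, hx₀⟩ := isCompact_univ.exists_isMaxOn Set.univ_nonempty
    (hcont.sub (hφ.continuous.const_mul δ)).continuousOn
  have hmax₁ (y : M) : m + g.laplacian φ y ≤ m + g.laplacian φ x₁ := hx₁ (Set.mem_univ y)
  have hmax₀ (y : M) : m + g.laplacian φ y - δ * φ y ≤ m + g.laplacian φ x₀ - δ * φ x₀ :=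
    hx₀ (Set.mem_univ y)
  refine (hmax₁ x).trans ?_
  set K := m + g.laplacian φ x₁
  obtain hsmall | hlarge := le_or_gt K (max 1 (2 * (δ * L)))
  · exact hsmall.trans (le_max_left _ _)
  obtain ⟨hK, hKL⟩ := max_lt_iff.1 hlarge
  have hosc : K - δ * L ≤ m + g.laplacian φ x₀ := by
    linarith [hmax₀ x₁, mul_le_mul_of_nonneg_left (hL x₁ x₀) hδ0]
  have hmain := add_laplacian_le_of_isMax hm hg hC hδ (hgrad x₀) hf (hfΛ x₀) (hA x₀) hφ hL hMA
    hpos (fun y => by linarith [hmax₀ y]) hK.le hmax₁ (by linarith)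
  exact (by linarith : K ≤ _).trans (le_max_right _ _)

end LaplacianEstimate

end

theorem mainTheorem3 (m : ℕ) (hm : 2 ≤ m) {M : Type*} [TopologicalSpace M] [T2Space M]
    [CompactSpace M] [ChartedSpace (CSpace m) M] [IsManifold 𝓘(ℂ, CSpace m) ω M]
    (g : KahlerMetric m M) (hg : g.NonnegOrthogonalBisectional) (L A Λ : ℝ) :
    ∃ C : ℝ, ∀ f φ : M → ℝ,
      (∀ x, 0 < f x) →
      (∀ x, f x ≤ Λ) →
      (∀ x, -A ≤ g.laplacian (fun y => f y ^ (1 / ((m : ℝ) - 1))) x) →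
      ContMDiff 𝓘(ℝ, CSpace m) 𝓘(ℝ) 4 φ →
      (∀ x y, φ x - φ y ≤ L) →
      g.SolvesMongeAmpere f φ →
      g.PosDefPotential φ →
      ∀ x, |g.laplacian φ x| ≤ C := by
  obtain ⟨C, hC, hgrad⟩ := exists_gradientBoundAt g L
  obtain ⟨δ, hδ⟩ : ∃ δ : ℝ, δ = ((m : ℝ) - 1) / (4 * m ^ 2 * C) := ⟨_, rfl⟩
  refine ⟨max (max 1 (2 * (δ * L)))
    (m * (2 / δ * ((m - 1) * |A| + δ * m * Λ ^ (1 / ((m : ℝ) - 1)))) ^ (m - 1) + δ * L) + m,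
    fun f φ hf hfΛ hA hφ hL hMA hpos x => abs_le.2 ⟨?_, ?_⟩⟩
  · have hnonneg := g.add_laplacian_nonneg hφ hpos x
    have hle := g.add_laplacian_le hm hg hC hgrad hδ hf hfΛ hA hφ hL hMA hpos x
    linarith
  · have hle := g.add_laplacian_le hm hg hC hgrad hδ hf hfΛ hA hφ hL hMA hpos x
    linarith [(Nat.cast_nonneg m : (0 : ℝ) ≤ m)]
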